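/- **Notation.** Matrices carry the Frobenius norm $|A|=\sqrt{\operatorname{tr}(A^\top A)}$; $w^\times\in\mathbb R^{3\times3}$ is the skew matrix with $w^\times v=w\times v$. Let $SE_2(3)$ be the group of $5\times5$ matrices $X=\begin{pmatrix}R&V\\0&I_2\end{pmatrix}$ with $R\in SO(3)$, $V=(v\ \ p)\in\mathbb R^{3\times2}$, and $SIM_2(3)$ the group of matrices $Z=\begin{pmatrix}R_Z&V_Z\\0&A_Z\end{pmatrix}$ with $R_Z\in SO(3)$, $V_Z\in\mathbb R^{3\times2}$, $A_Z\in GL(2)$. Let $g\in\mathbb R^3$, let $\mathring y_m\in\mathbb R^3$ be a unit vector, and put $C_p=(0\ 1)^\top$, $C_v=(1\ 0)^\top$, $$U=\begin{pmatrix}\Omega^\times&(a\ \ 0)\\0&0\end{pmatrix},\quad G=\begin{pmatrix}0&(g\ \ 0)\\0&0\end{pmatrix},\quad D=\begin{pmatrix}0&0\\0&S_D\end{pmatrix},\quad S_D=\begin{pmatrix}0&-1\\0&0\end{pmatrix},$$ with inputs $\Omega(t),a(t)\in\mathbb R^3$. Let $X(t)\in SE_2(3)$, $Z(t)\in SIM_2(3)$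 for $t\ge0$, and $\hat X(t)\in SE_2(3)$ for $t\ge t_0$ ($t_0\ge 0$) be differentiable with $$\dot X=XU+GX+DX-XD,\qquad \dot Z=(G+D)Z-Z\Gamma,$$ $$\dot{\hat X}=\hat XU+G\hat X+D\hat X-\hat XD+Z\Delta Z^{-1}\hat X,$$ $$\Delta=\begin{pmatrix}\Omega_\Delta^\times&W_\Delta\\0&0\end{pmatrix},\qquad \Gamma=\begin{pmatrix}\Omega_\Gamma^\times&W_\Gamma\\0&S_\Gamma\end{pmatrix}.$$ Let $y_p=p$, $y_v=v$, $y_m=R^\top\mathring y_m$ be the outputs of $X$, and $\hat y_p=\hat p$, $\hat y_v=\hat v$ those of $\hat X$. Write $\tilde p=y_p-V_ZA_Z^{-1}C_p$, $\tilde v=y_v-V_ZA_Z^{-1}C_v$. Choose gains $k_p,k_c>0$, $k_v,k_d,k_m\ge0$ and a symmetric positive definite $K_q\in\mathbb R^{2\times2}$, and let $$\begin{aligned} \Omega_\Delta&=4k_cR_Z^\top(\hat y_p-V_ZA_Z^{-1}C_p)^\times\tilde p+4k_dR_Z^\top(\hat y_v-V_ZA_Z^{-1}C_v)^\times\tilde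 v+4k_mR_Z^\top(\hat Ry_m)^\times\mathring y_m,\\ W_\Delta&=(k_p+k_c)R_Z^\top(y_p-\hat y_p)C_p^\top A_Z^{-\top}+(k_v+k_d)R_Z^\top(y_v-\hat y_v)C_v^\top A_Z^{-\top},\\ \Omega_\Gamma&=0,\\ W_\Gamma&=-(k_p+k_c)R_Z^\top\tilde p\,C_p^\top A_Z^{-\top}-(k_v+k_d)R_Z^\top\tilde v\,C_v^\top A_Z^{-\top},\\ S_\Gamma&=\tfrac12A_Z^\top K_qA_Z-\tfrac{k_p}2A_Z^{-1}C_pC_p^\top A_Z^{-\top}-\tfrac{k_v}2A_Z^{-1}C_vC_v^\top A_Z^{-\top}. \end{aligned}$$ The observer error is $\bar E=Z^{-1}X\hat X^{-1}Z\in SE_2(3)$, with rotation part $R_{\bar E}$ and translation part $V_{\bar E}$; put $\mathcal L(\bar E)=\operatorname{tr}(I_3-R_{\bar E})+|V_{\bar E}|^2$. **Theorem.** Suppose that on $[0,\infty)$ the input $U$ is bounded, the state $X$ is bounded and uniformly continuous, and the vectors $\mu_p=\sqrt{k_c}R_Z^\top\tilde p$, $\mu_v=\sqrt{k_d}R_Z^\top\tilde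 v$, $\mu_m=\sqrt{k_m}R_Z^\top\mathring y_m$ are persistently exciting: there are $\delta,T>0$ with $-\int_t^{t+T}\sum_{s\in\{p,v,m\}}\mu_s(\tau)^\times\mu_s(\tau)^\times\,d\tau>\delta I_3$ for all $t\ge0$. Fix $X$ and $Z$, and let $\hat X$ range over all solutions, on $[t_0,\infty)$ with $t_0\ge0$ arbitrary. For every $t_0\geq 0$ and $E_0\in SE_2(3)$ there is such a solution with $\bar E(t_0)=E_0$. Moreover: 1. For every solution $\hat X$, the innovation terms $\Omega_\Delta,W_\Delta,\Omega_\Gamma,W_\Gamma,S_\Gamma$ are bounded and uniformly continuous on $[t_0,\infty)$. 2. $V_{\bar E}$ is globally exponentially stable to $0$: there are $C,\kappa>0$, independent of $t_0$ and $\hat X$, with $|V_{\bar E}(t)|\le Ce^{-\kappa(t-t_0)}|V_{\bar E}(t_0)|$ for all $t\ge t_0$. 3. The attitude error is almost-globally asymptotically and locally exponentially stable to the identity. That is, there are $r,C,\kappa>0$, independent of $t_0$ and $\hat X$, such that $|\bar E(t_0)-I_5|<r$ implies $|\bar E(t)-I_5|\le Ce^{-\kappa(t-t_0)}|\bar E(t_0)-I_5|$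 for all $t\ge t_0$; and for each $t_0$ the set of initial errors $\bar E(t_0)\in SE_2(3)$ of solutions for which $\bar E(t)\not\to I_5$ has measure zero in the $9$-dimensional manifold $SE_2(3)$. The equilibria, in the sense of the errors $\bar E(t_0)$ from which $\frac{d}{dt}\mathcal L(\bar E(t))=0$ for all $t\ge t_0$, are exactly the elements of $\mathcal E_s\cup\mathcal E_u$, where $$\mathcal E_s=\{I_5\},\qquad \mathcal E_u=\{\bar E\in SE_2(3):\operatorname{tr}(R_{\bar E})=-1,\ V_{\bar E}=0\}.$$ The equilibrium $I_5$ is stable, and every $E_0\in\mathcal E_u$ is unstable: for every $t_0\ge0$, arbitrarily close to $E_0$ there are initial errors $\bar E(t_0)$ of solutions with $\mathcal L(\bar E(t_0))<\mathcal L(E_0)$ and $\bar E(t)\to I_5$. 4. For every solution $\hat X$, if $|\bar E(t)-I_5|\to0$ then $|X(t)-\hat X(t)|\to0$ as $t\to\infty$. -/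

import Mathlib

open Filter Topology MeasureTheory Set Matrix

attribute [local instance] Matrix.frobeniusNormedAddCommGroup Matrix.frobeniusNormedSpace

noncomputable section

namespace INS

/-- Vectors of `ℝ³`. -/
abbrev Vec3 : Type := Fin 3 → ℝ

/-- Real `5 × 5` matrices, split into blocks of sizes `3` and `2`. They carry the Frobenius norm
`|A| = √tr(AᵀA)`, as do all matrices in this file. -/
abbrev Mat5 : Type := Matrix (Fin 3 ⊕ Fin 2) (Fin 3 ⊕ Fin 2) ℝ

/-- The skew operator `Ω ↦ Ω^×`. -/
def skew (w : Vec3) : Matrix (Fin 3) (Fin 3) ℝ :=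
  !![0, -w 2, w 1; w 2, 0, -w 0; -w 1, w 0, 0]

/-- The skew operator is the cross product: `Ω^× v = Ω × v`. -/
theorem skew_mulVec (w v : Vec3) : skew w *ᵥ v = crossProduct w v := by
  ext i
  fin_cases i <;>
    simp [skew, cross_apply, Matrix.mulVec, dotProduct, Fin.sum_univ_three] <;> ring

/-- The extended special Euclidean group `SE₂(3)`. -/
def SE23 : Set Mat5 :=
  {X | ∃ R ∈ Matrix.specialOrthogonalGroup (Fin 3) ℝ, ∃ V : Matrix (Fin 3) (Fin 2) ℝ,
    X = fromBlocks R V 0 1}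

/-- The extended similarity group `SIM₂(3)`. -/
def SIM23 : Set Mat5 :=
  {Z | ∃ R ∈ Matrix.specialOrthogonalGroup (Fin 3) ℝ, ∃ V : Matrix (Fin 3) (Fin 2) ℝ,
    ∃ A : Matrix (Fin 2) (Fin 2) ℝ, IsUnit A ∧ Z = fromBlocks R V 0 A}

/-- The rotation block `R`. -/
def rot (X : Mat5) : Matrix (Fin 3) (Fin 3) ℝ := X.toBlocks₁₁

/-- The translation block `V`. -/
def tra (X : Mat5) : Matrix (Fin 3) (Fin 2) ℝ := X.toBlocks₁₂

/-- The scaling block `A`. -/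
def scl (X : Mat5) : Matrix (Fin 2) (Fin 2) ℝ := X.toBlocks₂₂

/-- The matrix `(w 0) ∈ ℝ^{3×2}`. -/
def firstCol (w : Vec3) : Matrix (Fin 3) (Fin 2) ℝ := Matrix.of fun i => ![w i, 0]

/-- The input matrix `U` formed from the angular velocity and the specific acceleration. -/
def inputU (Ω a : Vec3) : Mat5 := fromBlocks (skew Ω) (firstCol a) 0 0

/-- The gravity matrix `G`. -/
def gravG (g : Vec3) : Mat5 := fromBlocks 0 (firstCol g) 0 0

/-- The matrix `D`. -/
def matD : Mat5 := fromBlocks 0 0 0 !![0, -1; 0, 0]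

/-- `C_p = (0 1)ᵀ`. -/
def Cp : Fin 2 → ℝ := ![0, 1]

/-- `C_v = (1 0)ᵀ`. -/
def Cv : Fin 2 → ℝ := ![1, 0]

/-- GNSS position output `h_p(R, v, p) = p`, where `V = (v p)`. -/
def hp (X : Mat5) : Vec3 := fun i => tra X i 1

/-- GNSS velocity output `h_v(R, v, p) = v`, where `V = (v p)`. -/
def hv (X : Mat5) : Vec3 := fun i => tra X i 0

/-- Magnetometer output `h_m(R, v, p) = Rᵀ m` for the reference direction `m`. -/
def hm (m : Vec3) (X : Mat5) : Vec3 := (rot X)ᵀ *ᵥ m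

/-- The observer gains. -/
structure Gains where
  kp : ℝ
  kc : ℝ
  kv : ℝ
  kd : ℝ
  km : ℝ
  Kq : Matrix (Fin 2) (Fin 2) ℝ
  kp_pos : 0 < kp
  kc_pos : 0 < kc
  kv_nonneg : 0 ≤ kv
  kd_nonneg : 0 ≤ kd
  km_nonneg : 0 ≤ km
  Kq_posDef : Kq.PosDef

/-- `w - V_Z A_Z⁻¹ C`. -/
def recentre (Z : Mat5) (C : Fin 2 → ℝ) (w : Vec3) : Vec3 :=
  w - (tra Z * (scl Z)⁻¹) *ᵥ C

/-- `R_Zᵀ w Cᵀ A_Z⁻ᵀ ∈ ℝ^{3×2}`. -/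
def pull (Z : Mat5) (C : Fin 2 → ℝ) (w : Vec3) : Matrix (Fin 3) (Fin 2) ℝ :=
  (rot Z)ᵀ * vecMulVec w C * ((scl Z)⁻¹)ᵀ

/-- `Ω_Δ`, for reference direction `m`, state `X`, estimate `Xh` and auxiliary state `Z`. -/
def OmegaDelta (K : Gains) (m : Vec3) (X Xh Z : Mat5) : Vec3 :=
  (4 * K.kc) • ((rot Z)ᵀ *ᵥ (skew (recentre Z Cp (hp Xh)) *ᵥ recentre Z Cp (hp X)))
  + (4 * K.kd) • ((rot Z)ᵀ *ᵥ (skew (recentre Z Cv (hv Xh)) *ᵥ recentre Z Cv (hv X)))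
  + (4 * K.km) • ((rot Z)ᵀ *ᵥ (skew (rot Xh *ᵥ hm m X) *ᵥ m))

/-- `W_Δ`. -/
def WDelta (K : Gains) (X Xh Z : Mat5) : Matrix (Fin 3) (Fin 2) ℝ :=
  (K.kp + K.kc) • pull Z Cp (hp X - hp Xh) + (K.kv + K.kd) • pull Z Cv (hv X - hv Xh)

/-- `Ω_Γ`. -/
def OmegaGamma : Vec3 := 0

/-- `W_Γ`. -/
def WGamma (K : Gains) (X Z : Mat5) : Matrix (Fin 3) (Fin 2) ℝ :=
  -((K.kp + K.kc) • pull Z Cp (recentre Z Cp (hp X)))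
  - (K.kv + K.kd) • pull Z Cv (recentre Z Cv (hv X))

/-- `S_Γ`. -/
def SGamma (K : Gains) (Z : Mat5) : Matrix (Fin 2) (Fin 2) ℝ :=
  (1 / 2 : ℝ) • ((scl Z)ᵀ * K.Kq * scl Z)
  - (K.kp / 2) • ((scl Z)⁻¹ * vecMulVec Cp Cp * ((scl Z)⁻¹)ᵀ)
  - (K.kv / 2) • ((scl Z)⁻¹ * vecMulVec Cv Cv * ((scl Z)⁻¹)ᵀ)

/-- The correction `Δ ∈ se₂(3)`. -/
def Delta (K : Gains) (m : Vec3) (X Xh Z : Mat5) : Mat5 :=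
  fromBlocks (skew (OmegaDelta K m X Xh Z)) (WDelta K X Xh Z) 0 0

/-- The correction `Γ ∈ sim₂(3)`. -/
def Gamma (K : Gains) (X Z : Mat5) : Mat5 :=
  fromBlocks (skew OmegaGamma) (WGamma K X Z) 0 (SGamma K Z)

/-- `X` is a trajectory in `SE₂(3)`, on `[0, ∞)`, of `Ẋ = X U + G X + D X - X D`. -/
def IsSystem (g : Vec3) (Ω a : ℝ → Vec3) (X : ℝ → Mat5) : Prop :=
  ∀ t, 0 ≤ t → X t ∈ SE23 ∧
    HasDerivWithinAt X
      (X t * inputU (Ω t) (a t) + gravG g * X t + matD * X t - X t * matD) (Ici 0) t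

/-- `Z` is a trajectory in `SIM₂(3)`, on `[0, ∞)`, of `Ż = (G + D) Z - Z Γ`. -/
def IsAuxiliary (K : Gains) (g : Vec3) (X Z : ℝ → Mat5) : Prop :=
  ∀ t, 0 ≤ t → Z t ∈ SIM23 ∧
    HasDerivWithinAt Z ((gravG g + matD) * Z t - Z t * Gamma K (X t) (Z t)) (Ici 0) t

/-- `Xh` is a trajectory in `SE₂(3)`, on `[t₀, ∞)`, of
`Ẋh = Xh U + G Xh + D Xh - Xh D + Ad_Z(Δ) Xh`. -/
def IsEstimate (K : Gains) (g m : Vec3) (Ω a : ℝ → Vec3) (X Z : ℝ → Mat5) (t₀ : ℝ)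
    (Xh : ℝ → Mat5) : Prop :=
  ∀ t, t₀ ≤ t → Xh t ∈ SE23 ∧
    HasDerivWithinAt Xh
      (Xh t * inputU (Ω t) (a t) + gravG g * Xh t + matD * Xh t - Xh t * matD
        + Z t * Delta K m (X t) (Xh t) (Z t) * (Z t)⁻¹ * Xh t) (Ici t₀) t

/-- The observer error `Ē = Z⁻¹ X Xh⁻¹ Z`. -/
def err (X Z Xh : ℝ → Mat5) (t : ℝ) : Mat5 := (Z t)⁻¹ * X t * (Xh t)⁻¹ * Z t

/-- The cost `tr(I₃ - R_E) + |V_E|²`. -/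
def cost (E : Mat5) : ℝ := (1 - rot E).trace + ‖tra E‖ ^ 2

/-- Boundedness of a signal on `[t₀, ∞)`. -/
def BoundedFrom {F : Type*} [Norm F] (t₀ : ℝ) (f : ℝ → F) : Prop :=
  ∃ B : ℝ, ∀ t, t₀ ≤ t → ‖f t‖ ≤ B

/-- A signal that is bounded and uniformly continuous on `[t₀, ∞)`. -/
def BddUnifCont {F : Type*} [NormedAddCommGroup F] (t₀ : ℝ) (f : ℝ → F) : Prop :=
  BoundedFrom t₀ f ∧ UniformContinuousOn f (Ici t₀)

/-- Persistence of excitation of finitely many time-varying vectors; the matrix integral is taken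
entrywise, and `A > B` means that `A - B` is symmetric positive definite. -/
def PersistentlyExciting {n : ℕ} (μ : Fin n → ℝ → Vec3) : Prop :=
  ∃ δ > (0 : ℝ), ∃ T > (0 : ℝ), ∀ t, 0 ≤ t →
    (-(Matrix.of fun i j => ∫ τ in t..(t + T), (∑ k, skew (μ k τ) * skew (μ k τ)) i j)
      - δ • (1 : Matrix (Fin 3) (Fin 3) ℝ)).PosDef

/-- `μ_p`. -/
def muP (K : Gains) (X Z : ℝ → Mat5) (t : ℝ) : Vec3 :=
  √K.kc • ((rot (Z t))ᵀ *ᵥ recentre (Z t) Cp (hp (X t)))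

/-- `μ_v`. -/
def muV (K : Gains) (X Z : ℝ → Mat5) (t : ℝ) : Vec3 :=
  √K.kd • ((rot (Z t))ᵀ *ᵥ recentre (Z t) Cv (hv (X t)))

/-- `μ_m`. -/
def muM (K : Gains) (m : Vec3) (Z : ℝ → Mat5) (t : ℝ) : Vec3 :=
  √K.km • ((rot (Z t))ᵀ *ᵥ m)

/-- The set of unstable equilibria: `tr(R_E) = -1` and `V_E = 0`. -/
def unstableSet : Set Mat5 := {E | E ∈ SE23 ∧ (rot E).trace = -1 ∧ tra E = 0}

/-- The list of entries of a matrix, as a point of Euclidean space. This is an isometry for the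
Frobenius norm. -/
def entries (E : Mat5) : EuclideanSpace ℝ ((Fin 3 ⊕ Fin 2) × (Fin 3 ⊕ Fin 2)) :=
  WithLp.toLp 2 fun ij => E ij.1 ij.2

/-- A subset of the `9`-dimensional submanifold `SE₂(3)` has measure zero: its `9`-dimensional
Hausdorff measure (a constant multiple of the Riemannian volume of the submanifold, which has the
same null sets as Haar measure and as Lebesgue measure in charts) vanishes. -/
def NullInSE23 (S : Set Mat5) : Prop := μH[9] (entries '' S) = 0

/-- The entry list preserves distances, so the measure above is that of the Frobenius metric. -/
theorem norm_entries_sub (E F : Mat5) : ‖entries E - entries F‖ = ‖E - F‖ := by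
  rw [EuclideanSpace.norm_eq, Matrix.frobenius_norm_def, Real.sqrt_eq_rpow, Fintype.sum_prod_type]
  simp [entries]

end INS

end

/-!
Write the error as `Ē = (R, V)`. Read in the frame of `Z`, its equation splits (`error_field`,
`hasDerivWithinAt_err`): with `P` the translation part of `Z⁻¹ X`, the matrix `S = ∑ μ μᵀ` of the
three excitation vectors, and `B = P diag(k_d, k_c) A_Z⁻ᵀ`,
`V' = -V M` and `R' = 4 (Gᵀ - R G R)`, where `G = S - B Vᵀ`,
`M = ½ A_Zᵀ K_q A_Z + A_Z⁻¹ diag(k_v/2 + k_d, k_p/2 + k_c) A_Z⁻ᵀ`.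
Conversely each solution `(R, V)` comes from an estimate (`exists_isEstimate`), so the claims are
about this system, whose properties are collected in `ErrorData`.

*Bounds.* `Q = A_Z A_Zᵀ` solves a Riccati equation with `K_q` as quadratic and `diag(k_v, k_p)` as
constant term, which keeps its trace bounded and its determinant away from zero, even if `k_v = 0`
(`exists_riccati_bounds`). So `A_Z` and `A_Z⁻¹` are bounded and `M` is uniformly coercive: `V` decays
exponentially. The matrix `P A_Z` obeys the same linear equation as `V`, forced by a bounded input, so
`P` is bounded. All coefficients are then bounded and Lipschitz, and so are the innovation
terms, which are polynomials in them and in `R`, `V`.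

*Attitude.* Representing `R` by a homogeneous quaternion `x = (x₀, u)` turns the matrix Riccati
equation into a linear equation (`hasDerivWithinAt_quatRot`). For `V = 0` it conserves `x₀`, and `u`
obeys `u' = -4 (tr S - S) u`. Since `tr S - S = -∑ μ^× μ^×`, persistent excitation makes `u` decay
exponentially (`exists_decay_of_excitation`), and the perturbation by `V` decays exponentially.
Hence `u → 0` and `x₀` has a limit `L V(t₀) x(t₀)`, and `R → I` if this limit is nonzero. The limit
is linear in `x(t₀)`, jointly continuous, and `L V₀ ≠ 0` for each `V₀`: a solution that is purely real
at a late time keeps a nonzero real part, and linear equations can be solved backwards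
(`exists_limit_functional`). So for each `V₀` the nonconvergent attitudes have their quaternions in a
hyperplane; in the four charts `x i = 1` of projective space, Fubini's theorem shows that
nonconvergent errors form a null set (`nullInSE23_of_linear_forms`). Near the identity `x₀` may be
normalised to one, and the decay of `u` gives local exponential stability (`exists_local_decay`).

*Equilibria.* By completion of squares (`cost_deriv_eq`) the derivative of the cost vanishes only if
`V = 0`.
If `V = 0` then `x₀` is conserved and `u → 0`, so the cost `4 |u|² / |x|²` is constant if and only if
`u = 0` or `x₀ = 0`, that is, `R` is the identity or a half turn. Adding a small real part to the
quaternion of a half turn lowers the cost and leads to convergence, whence instability.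
-/

noncomputable section

namespace INS

/-! ### Differential inequalities and derivatives of matrix-valued functions -/

/-- A form of Grönwall's inequality with a variable rate `a = A'`, without sign conditions. -/
theorem le_mul_exp_of_deriv_le_mul {f f' a A : ℝ → ℝ} {t₀ : ℝ}
    (hf : ∀ t, t₀ ≤ t → HasDerivWithinAt f (f' t) (Ici t₀) t)
    (hA : ∀ t, t₀ ≤ t → HasDerivWithinAt A (a t) (Ici t₀) t)
    (h : ∀ t, t₀ ≤ t → f' t ≤ a t * f t) {t : ℝ} (ht : t₀ ≤ t) :
    f t ≤ f t₀ * Real.exp (A t - A t₀) := by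
  have hd : ∀ t, t₀ ≤ t → HasDerivWithinAt (fun s => f s * Real.exp (-A s))
      (f' t * Real.exp (-A t) + f t * (Real.exp (-A t) * -a t)) (Ici t₀) t :=
    fun t ht => (hf t ht).mul (hA t ht).fun_neg.exp
  have hanti : AntitoneOn (fun s => f s * Real.exp (-A s)) (Ici t₀) := by
    apply antitoneOn_of_deriv_nonpos (convex_Ici t₀)
    · exact fun t ht => (hd t ht).continuousWithinAt
    · exact fun t ht => ((hd t (interior_subset ht)).mono interior_subset).differentiableWithinAt
    · intro t ht
      rw [interior_Ici] at ht
      have h1 := (hd t ht.le).hasDerivAt (Ici_mem_nhds ht)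
      rw [h1.deriv]
      nlinarith [h t (le_of_lt ht), Real.exp_pos (-A t)]
  have := hanti (self_mem_Ici) ht ht
  simp only at this
  calc f t = f t * Real.exp (-A t) * Real.exp (A t) := by
        rw [mul_assoc, ← Real.exp_add]; simp
    _ ≤ f t₀ * Real.exp (-A t₀) * Real.exp (A t) := by gcongr
    _ = _ := by rw [mul_assoc, ← Real.exp_add]; ring_nf

theorem le_of_deriv_le_affine {f f' : ℝ → ℝ} {t₀ c η : ℝ} (hc : c ≠ 0)
    (hf : ∀ t, t₀ ≤ t → HasDerivWithinAt f (f' t) (Ici t₀) t)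
    (h : ∀ t, t₀ ≤ t → f' t ≤ -c * f t + η) {t : ℝ} (ht : t₀ ≤ t) :
    f t ≤ Real.exp (-c * (t - t₀)) * (f t₀ - η / c) + η / c := by
  have := le_mul_exp_of_deriv_le_mul (f := fun s => f s - η / c) (f' := f') (a := fun _ => -c)
    (A := fun s => -c * s) (t₀ := t₀) (fun t ht => (hf t ht).sub_const _)
    (fun t _ => by simpa using ((hasDerivAt_id t).const_mul (-c)).hasDerivWithinAt)
    (fun t ht => (h t ht).trans (by field_simp; linarith)) ht
  have e : -c * (t - t₀) = -c * t - -c * t₀ := by ring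
  rw [e]; linarith

theorem le_max_of_deriv_le_affine {f f' : ℝ → ℝ} {t₀ c η : ℝ} (hc : 0 < c)
    (hf : ∀ t, t₀ ≤ t → HasDerivWithinAt f (f' t) (Ici t₀) t)
    (h : ∀ t, t₀ ≤ t → f' t ≤ -c * f t + η) {t : ℝ} (ht : t₀ ≤ t) :
    f t ≤ max (f t₀) (η / c) := by
  have h1 := le_of_deriv_le_affine hc.ne' hf h ht
  have h2 : Real.exp (-c * (t - t₀)) ≤ 1 := Real.exp_le_one_iff.2 (by nlinarith)
  have h3 := Real.exp_pos (-c * (t - t₀))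
  rcases le_total (f t₀) (η / c) with h4 | h4
  · exact le_max_of_le_right (by nlinarith)
  · exact le_max_of_le_left (by nlinarith)

theorem min_le_of_affine_le_deriv {f f' : ℝ → ℝ} {t₀ c η : ℝ} (hc : 0 < c)
    (hf : ∀ t, t₀ ≤ t → HasDerivWithinAt f (f' t) (Ici t₀) t)
    (h : ∀ t, t₀ ≤ t → -c * f t + η ≤ f' t) {t : ℝ} (ht : t₀ ≤ t) :
    min (f t₀) (η / c) ≤ f t := by
  have h1 := le_max_of_deriv_le_affine (f := fun s => -f s) (f' := fun s => -f' s) (η := -η) hc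
    (fun t ht => (hf t ht).fun_neg) (fun t ht => by linarith [h t ht]) ht
  rcases le_max_iff.1 h1 with h2 | h2
  · exact min_le_of_left_le (by linarith)
  · exact min_le_of_right_le (by rw [neg_div] at h2; linarith)

theorem hasDerivWithinAt_matrix {m n : Type*} [Fintype m] [Fintype n] {F : ℝ → Matrix m n ℝ}
    {F' : Matrix m n ℝ} {s : Set ℝ} {t : ℝ} :
    HasDerivWithinAt F F' s t ↔
      ∀ i j, HasDerivWithinAt (fun t => F t i j) (F' i j) s t := by
  refine (hasDerivWithinAt_pi (φ := F) (φ' := F')).trans (forall_congr' fun i => ?_)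
  exact (hasDerivWithinAt_pi (φ := fun t j => F t i j) (φ' := F' i))

theorem hasDerivWithinAt_matrix_mul {l m n : Type*} [Fintype l] [Fintype m] [Fintype n]
    {F : ℝ → Matrix l m ℝ} {G : ℝ → Matrix m n ℝ} {F' : Matrix l m ℝ} {G' : Matrix m n ℝ}
    {s : Set ℝ} {t : ℝ} (hF : HasDerivWithinAt F F' s t) (hG : HasDerivWithinAt G G' s t) :
    HasDerivWithinAt (fun t => F t * G t) (F' * G t + F t * G') s t := by
  rw [hasDerivWithinAt_matrix] at *
  intro i j
  simp only [Matrix.mul_apply, Matrix.add_apply, ← Finset.sum_add_distrib]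
  exact HasDerivWithinAt.fun_sum fun k _ => (hF i k).fun_mul (hG k j)

theorem hasDerivWithinAt_matrix_transpose {m n : Type*} [Fintype m] [Fintype n]
    {F : ℝ → Matrix m n ℝ} {F' : Matrix m n ℝ} {s : Set ℝ} {t : ℝ}
    (hF : HasDerivWithinAt F F' s t) : HasDerivWithinAt (fun t => (F t)ᵀ) F'ᵀ s t := by
  rw [hasDerivWithinAt_matrix] at *
  exact fun i j => hF j i

theorem hasDerivWithinAt_matrix_inv {n : Type*} [Fintype n] [DecidableEq n]
    {F : ℝ → Matrix n n ℝ} {F' : Matrix n n ℝ} {s : Set ℝ} {t : ℝ}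
    (hF : HasDerivWithinAt F F' s t) (hu : IsUnit (F t)) :
    HasDerivWithinAt (fun t => (F t)⁻¹) (-((F t)⁻¹ * F' * (F t)⁻¹)) s t := by
  let _ := Matrix.frobeniusNormedRing (m := n) (α := ℝ)
  let _ := Matrix.frobeniusNormedAlgebra (m := n) (α := ℝ) (R := ℝ)
  obtain ⟨u, hu⟩ := hu
  have h1 := hasFDerivAt_ringInverse (𝕜 := ℝ) u
  rw [hu] at h1
  have h2 := h1.comp_hasDerivWithinAt t hF
  simp only [Matrix.nonsing_inv_eq_ringInverse]
  have h3 : ((u⁻¹ : (Matrix n n ℝ)ˣ) : Matrix n n ℝ) = Ring.inverse (F t) := by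
    rw [← hu, Ring.inverse_unit]
  refine HasDerivWithinAt.congr_deriv h2 ?_
  rw [h3.symm]
  simp only [_root_.neg_apply, ContinuousLinearMap.mulLeftRight_apply]

theorem hasDerivWithinAt_submatrix {l o m n : Type*} [Fintype l] [Fintype o] [Fintype m]
    [Fintype n] {F : ℝ → Matrix m n ℝ} {F' : Matrix m n ℝ} {s : Set ℝ} {t : ℝ} (e : l → m)
    (f : o → n) (hF : HasDerivWithinAt F F' s t) :
    HasDerivWithinAt (fun t => (F t).submatrix e f) (F'.submatrix e f) s t := by
  rw [hasDerivWithinAt_matrix] at *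
  exact fun i j => hF (e i) (f j)

theorem hasDerivWithinAt_fromBlocks {l m n o : Type*} [Fintype l] [Fintype m] [Fintype n]
    [Fintype o] {A : ℝ → Matrix n l ℝ} {B : ℝ → Matrix n m ℝ} {C : ℝ → Matrix o l ℝ}
    {D : ℝ → Matrix o m ℝ} {A' : Matrix n l ℝ} {B' : Matrix n m ℝ} {C' : Matrix o l ℝ}
    {D' : Matrix o m ℝ} {s : Set ℝ} {t : ℝ} (hA : HasDerivWithinAt A A' s t)
    (hB : HasDerivWithinAt B B' s t) (hC : HasDerivWithinAt C C' s t)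
    (hD : HasDerivWithinAt D D' s t) :
    HasDerivWithinAt (fun t => fromBlocks (A t) (B t) (C t) (D t)) (fromBlocks A' B' C' D') s t := by
  rw [hasDerivWithinAt_matrix] at *
  rintro (i | i) (j | j)
  exacts [hA i j, hB i j, hC i j, hD i j]

theorem frobenius_norm_sq {m n : Type*} [Fintype m] [Fintype n] (A : Matrix m n ℝ) :
    ‖A‖ ^ 2 = ∑ i, ∑ j, A i j ^ 2 := by
  rw [Matrix.frobenius_norm_def, ← Real.sqrt_eq_rpow, Real.sq_sqrt (by positivity)]
  simp

theorem abs_entry_le_norm {m n : Type*} [Fintype m] [Fintype n] (A : Matrix m n ℝ) (i : m)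
    (j : n) : |A i j| ≤ ‖A‖ := by
  apply abs_le_of_sq_le_sq _ (norm_nonneg _)
  rw [frobenius_norm_sq]
  calc A i j ^ 2 ≤ ∑ j, A i j ^ 2 :=
        Finset.single_le_sum (f := fun j => A i j ^ 2) (fun _ _ => sq_nonneg _) (Finset.mem_univ j)
    _ ≤ _ := Finset.single_le_sum (f := fun i => ∑ j, A i j ^ 2)
        (fun _ _ => Finset.sum_nonneg fun _ _ => sq_nonneg _) (Finset.mem_univ i)

theorem norm_le_of_abs_entry_le {m n : Type*} [Fintype m] [Fintype n] {A : Matrix m n ℝ} {c : ℝ}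
    (h : ∀ i j, |A i j| ≤ c) (hc : 0 ≤ c) :
    ‖A‖ ≤ Fintype.card m * Fintype.card n * c := by
  have h0 : (Fintype.card m * Fintype.card n : ℝ) ≤ (Fintype.card m * Fintype.card n) ^ 2 := by
    exact_mod_cast Nat.le_self_pow two_ne_zero (Fintype.card m * Fintype.card n)
  apply le_of_sq_le_sq _ (by positivity)
  rw [frobenius_norm_sq]
  calc ∑ i, ∑ j, A i j ^ 2 ≤ ∑ i : m, ∑ j : n, c ^ 2 := by
        refine Finset.sum_le_sum fun i _ => Finset.sum_le_sum fun j _ => ?_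
        exact sq_le_sq.2 ((h i j).trans (le_abs_self c))
    _ = (Fintype.card m * Fintype.card n) * c ^ 2 := by simp [mul_assoc]
    _ ≤ _ := by rw [mul_pow]; gcongr

/-! ### Linear differential equations on the whole line -/

/-- The bound that makes the weighted Volterra operator of `exists_solution_linear_ode` a contraction. -/
theorem abs_integral_exp_abs_le {l : ℝ} (hl : 0 < l) (a t : ℝ) :
    |∫ s in a..t, Real.exp (l * |s - a|)| ≤ Real.exp (l * |t - a|) / l := by
  rcases le_total a t with h | h
  · have : ∫ s in a..t, Real.exp (l * |s - a|) = ∫ s in a..t, Real.exp (l * (s - a)) := by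
      refine intervalIntegral.integral_congr fun s hs => ?_
      rw [uIcc_of_le h] at hs
      simp only [abs_of_nonneg (sub_nonneg.2 hs.1)]
    rw [this, intervalIntegral.integral_eq_sub_of_hasDerivAt
      (f := fun s => Real.exp (l * (s - a)) / l), abs_of_nonneg (sub_nonneg.2 h)]
    · have : Real.exp (l * (t - a)) / l ≥ 1 / l := by
        gcongr; exact Real.one_le_exp (mul_nonneg hl.le (sub_nonneg.2 h))
      have : 0 < 1 / l := by positivity
      simp only [sub_self, mul_zero, Real.exp_zero]
      rw [abs_of_nonneg (by linarith)]; linarith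
    · intro s _
      have := ((((hasDerivAt_id s).sub_const a).const_mul l).exp).div_const l
      refine HasDerivAt.congr_deriv this ?_
      simp only [id]
      field_simp
    · apply Continuous.intervalIntegrable; fun_prop
  · have : ∫ s in a..t, Real.exp (l * |s - a|) = ∫ s in a..t, Real.exp (l * (a - s)) := by
      refine intervalIntegral.integral_congr fun s hs => ?_
      rw [uIcc_of_ge h] at hs
      simp only [abs_of_nonpos (sub_nonpos.2 hs.2), neg_sub]
    rw [this, intervalIntegral.integral_eq_sub_of_hasDerivAt
      (f := fun s => -Real.exp (l * (a - s)) / l), abs_of_nonpos (sub_nonpos.2 h)]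
    · have : Real.exp (l * (a - t)) / l ≥ 1 / l := by
        gcongr; exact Real.one_le_exp (mul_nonneg hl.le (sub_nonneg.2 h))
      have : 0 < 1 / l := by positivity
      simp only [sub_self, mul_zero, Real.exp_zero, neg_sub, neg_div]
      rw [abs_of_nonpos (by linarith)]; linarith
    · intro s _
      have := (((((hasDerivAt_id s).const_sub a).const_mul l).exp).fun_neg).div_const l
      refine HasDerivAt.congr_deriv this ?_
      simp only [id]
      field_simp
    · apply Continuous.intervalIntegrable; fun_prop

open BoundedContinuousFunction in
/-- A linear differential equation with bounded continuous coefficients has a solution on all of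
`ℝ`. Substituting `x t = exp (l |t - t₀|) u t` turns the Volterra operator into a contraction of the
space of bounded continuous functions, for `l` larger than the bound on the coefficients. -/
theorem exists_solution_linear_ode {E : Type*} [NormedAddCommGroup E] [NormedSpace ℝ E]
    [CompleteSpace E] {A : ℝ → E →L[ℝ] E} (hA : Continuous A) {K : ℝ} (hK : ∀ t, ‖A t‖ ≤ K)
    (t₀ : ℝ) (x₀ : E) : ∃ x : ℝ → E, x t₀ = x₀ ∧ ∀ t, HasDerivAt x (A t (x t)) t := by
  have hK0 : 0 ≤ K := (norm_nonneg _).trans (hK 0)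
  set l : ℝ := 2 * (K + 1) with hl
  have hl0 : 0 < l := by positivity
  let g : (ℝ →ᵇ E) → ℝ → E := fun u s => A s (Real.exp (l * |s - t₀|) • u s)
  have hg : ∀ u, Continuous (g u) := fun u =>
    hA.clm_apply ((by fun_prop : Continuous fun s => Real.exp (l * |s - t₀|)).smul u.continuous)
  have hgi : ∀ u a b, IntervalIntegrable (g u) volume a b :=
    fun u a b => (hg u).intervalIntegrable a b
  have hbd : ∀ (h : ℝ → E) (C : ℝ), (∀ s, ‖h s‖ ≤ C * Real.exp (l * |s - t₀|)) → 0 ≤ C → ∀ t,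
      ‖∫ s in t₀..t, h s‖ ≤ C * (Real.exp (l * |t - t₀|) / l) := by
    intro h C hC hC0 t
    have h1 := intervalIntegral.norm_integral_le_abs_of_norm_le (μ := volume) (a := t₀) (b := t)
      (f := h) (g := fun s => C * Real.exp (l * |s - t₀|)) (Eventually.of_forall fun s => hC s)
      (by apply Continuous.intervalIntegrable; fun_prop)
    refine h1.trans ?_
    rw [intervalIntegral.integral_const_mul, abs_mul, abs_of_nonneg hC0]
    gcongr
    exact abs_integral_exp_abs_le hl0 _ _
  have hgn : ∀ u s, ‖g u s‖ ≤ (K * ‖u‖) * Real.exp (l * |s - t₀|) := by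
    intro u s
    calc ‖g u s‖ ≤ ‖A s‖ * ‖Real.exp (l * |s - t₀|) • u s‖ := (A s).le_opNorm _
      _ ≤ K * (Real.exp (l * |s - t₀|) * ‖u‖) := by
        rw [norm_smul, Real.norm_of_nonneg (Real.exp_pos _).le]
        gcongr
        exacts [hK s, u.norm_coe_le_norm s]
      _ = _ := by ring
  let Φ : (ℝ →ᵇ E) → (ℝ →ᵇ E) := fun u =>
    BoundedContinuousFunction.ofNormedAddCommGroup
      (fun t => Real.exp (-(l * |t - t₀|)) • (x₀ + ∫ s in t₀..t, g u s))
      ((by fun_prop : Continuous fun t => Real.exp (-(l * |t - t₀|))).smul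
        (continuous_const.add (intervalIntegral.continuous_primitive (hgi u) t₀)))
      (‖x₀‖ + K * ‖u‖ / l) (by
        intro t
        rw [norm_smul, Real.norm_of_nonneg (Real.exp_pos _).le]
        have h1 := hbd (g u) _ (hgn u) (by positivity) t
        have h2 : Real.exp (-(l * |t - t₀|)) ≤ 1 := Real.exp_le_one_iff.2 (by
          have := mul_nonneg hl0.le (abs_nonneg (t - t₀)); linarith)
        have h3 : Real.exp (-(l * |t - t₀|)) * Real.exp (l * |t - t₀|) = 1 := by
          rw [← Real.exp_add]; simp
        calc Real.exp (-(l * |t - t₀|)) * ‖x₀ + ∫ s in t₀..t, g u s‖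
            ≤ Real.exp (-(l * |t - t₀|)) * (‖x₀‖ + (K * ‖u‖) * (Real.exp (l * |t - t₀|) / l)) := by
              gcongr; exact (norm_add_le _ _).trans (by gcongr)
          _ = Real.exp (-(l * |t - t₀|)) * ‖x₀‖
              + (Real.exp (-(l * |t - t₀|)) * Real.exp (l * |t - t₀|)) * (K * ‖u‖ / l) := by ring
          _ ≤ _ := by rw [h3, one_mul]; gcongr; exact mul_le_of_le_one_left (norm_nonneg _) h2)
  have hΦ : ContractingWith (1 / 2) Φ := by
    refine ⟨by norm_num, LipschitzWith.of_dist_le_mul fun u v => ?_⟩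
    rw [BoundedContinuousFunction.dist_le (by positivity)]
    intro t
    have e : Φ u t - Φ v t = Real.exp (-(l * |t - t₀|)) • ∫ s in t₀..t, g (u - v) s := by
      have : ∫ s in t₀..t, g (u - v) s = (∫ s in t₀..t, g u s) - ∫ s in t₀..t, g v s := by
        rw [← intervalIntegral.integral_sub (hgi u _ _) (hgi v _ _)]
        congr 1; ext s; simp [g, smul_sub]
      rw [this]
      simp [Φ, smul_sub, smul_add]
    have h1 := hbd (g (u - v)) _ (hgn (u - v)) (by positivity) t
    have h3 : Real.exp (-(l * |t - t₀|)) * Real.exp (l * |t - t₀|) = 1 := by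
      rw [← Real.exp_add]; simp
    rw [dist_eq_norm, e, norm_smul, Real.norm_of_nonneg (Real.exp_pos _).le, dist_eq_norm]
    calc _ ≤ Real.exp (-(l * |t - t₀|)) * ((K * ‖u - v‖) * (Real.exp (l * |t - t₀|) / l)) := by
          gcongr
      _ = (Real.exp (-(l * |t - t₀|)) * Real.exp (l * |t - t₀|)) * (K / l) * ‖u - v‖ := by ring
      _ ≤ _ := by
        rw [h3, one_mul]
        gcongr
        rw [div_le_iff₀ hl0, hl]
        simp
  obtain ⟨u, hu⟩ : ∃ u, Φ u = u := ⟨_, hΦ.fixedPoint_isFixedPt⟩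
  have hx : ∀ t, Real.exp (l * |t - t₀|) • u t = x₀ + ∫ s in t₀..t, g u s := by
    intro t
    have h1 : u t = Real.exp (-(l * |t - t₀|)) • (x₀ + ∫ s in t₀..t, g u s) :=
      (DFunLike.congr_fun hu t).symm
    rw [h1, smul_smul, ← Real.exp_add]; simp
  refine ⟨fun t => Real.exp (l * |t - t₀|) • u t, by simpa using hx t₀, fun t => ?_⟩
  have h1 : HasDerivAt (fun t => x₀ + ∫ s in t₀..t, g u s) (g u t) t :=
    (intervalIntegral.integral_hasDerivAt_right (hgi u _ _)
      ((hg u).stronglyMeasurableAtFilter _ _) (hg u).continuousAt).const_add x₀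
  exact h1.congr_of_eventuallyEq (Eventually.of_forall hx)

/-! ### Exponential decay under persistent excitation -/

/-- The derivative of `Λ t = ∫_t^{t+T} (t + T - τ) P τ dτ` is `∫_t^{t+T} P - T P t`, so the
excitation of `P` over a window shows up pointwise in `Λ'`. -/
theorem exists_excitation_integral {H : Type*} [NormedAddCommGroup H] [InnerProductSpace ℝ H]
    [CompleteSpace H] {P : ℝ → H →L[ℝ] H} (hPc : Continuous P)
    (hsymm : ∀ t x y, inner ℝ (P t x) y = inner ℝ x (P t y)) {p : ℝ} (hp : ∀ t, ‖P t‖ ≤ p)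
    {T : ℝ} (hT : 0 < T) :
    ∃ Λ Λ' : ℝ → H →L[ℝ] H, (∀ t, HasDerivAt Λ (Λ' t) t) ∧
      (∀ t x y, inner ℝ (Λ t x) y = inner ℝ x (Λ t y)) ∧
      (∃ ℓ, 0 ≤ ℓ ∧ ∀ t, ‖Λ t‖ ≤ ℓ) ∧
      ∀ t x, inner ℝ x (Λ' t x) =
        (∫ τ in t..(t + T), inner ℝ x (P τ x)) - T * inner ℝ x (P t x) := by
  have hPi : ∀ a b, IntervalIntegrable P volume a b := fun a b => hPc.intervalIntegrable a b
  have hp0 : 0 ≤ p := (norm_nonneg _).trans (hp 0)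
  set Q : ℝ → H →L[ℝ] H := fun t => ∫ τ in (0:ℝ)..t, P τ with hQ
  have hQd : ∀ t, HasDerivAt Q (P t) t := fun t =>
    intervalIntegral.integral_hasDerivAt_right (hPi _ _) (hPc.stronglyMeasurableAtFilter _ _)
      hPc.continuousAt
  have hQc : Continuous Q := continuous_iff_continuousAt.2 fun t => (hQd t).continuousAt
  have hQi : ∀ a b, IntervalIntegrable Q volume a b := fun a b => hQc.intervalIntegrable a b
  set S : ℝ → H →L[ℝ] H := fun t => ∫ τ in (0:ℝ)..t, Q τ with hS
  have hSd : ∀ t, HasDerivAt S (Q t) t := fun t =>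
    intervalIntegral.integral_hasDerivAt_right (hQi _ _) (hQc.stronglyMeasurableAtFilter _ _)
      hQc.continuousAt
  have hsym : ∀ (F : ℝ → H →L[ℝ] H), Continuous F →
      (∀ t x y, inner ℝ (F t x) y = inner ℝ x (F t y)) → ∀ t x y,
      inner ℝ ((∫ τ in (0:ℝ)..t, F τ) x) y = inner ℝ x ((∫ τ in (0:ℝ)..t, F τ) y) := by
    intro F hF h t x y
    have hFi : IntervalIntegrable F volume 0 t := hF.intervalIntegrable _ _
    rw [ContinuousLinearMap.intervalIntegral_apply hFi, ContinuousLinearMap.intervalIntegral_apply hFi]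
    have hi : ∀ z, IntervalIntegrable (fun τ => F τ z) volume 0 t := fun z =>
      (hF.clm_apply continuous_const).intervalIntegrable _ _
    rw [real_inner_comm, ← innerSL_apply_apply ℝ y, ← innerSL_apply_apply ℝ x,
      ← ContinuousLinearMap.intervalIntegral_comp_comm _ (hi x),
      ← ContinuousLinearMap.intervalIntegral_comp_comm _ (hi y)]
    refine intervalIntegral.integral_congr fun τ _ => ?_
    simp only [innerSL_apply_apply]
    rw [real_inner_comm, h]
  have hQs := hsym P hPc hsymm
  have hSs := hsym Q hQc hQs
  have hQdiff : ∀ a b, Q b - Q a = ∫ τ in a..b, P τ := fun a b =>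
    intervalIntegral.integral_interval_sub_left (hPi _ _) (hPi _ _)
  have hSdiff : ∀ a b, S b - S a = ∫ τ in a..b, Q τ := fun a b =>
    intervalIntegral.integral_interval_sub_left (hQi _ _) (hQi _ _)
  refine ⟨fun t => S (t + T) - S t - T • Q t, fun t => Q (t + T) - Q t - T • P t,
    fun t => ?_, fun t x y => ?_, ⟨T * p * T, by positivity, fun t => ?_⟩, fun t x => ?_⟩
  · exact (((hSd (t + T)).comp_add_const t T).sub (hSd t)).sub ((hQd t).const_smul T)
  · simp only [_root_.sub_apply, _root_.smul_apply, inner_sub_left, inner_sub_right,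
      real_inner_smul_left, real_inner_smul_right]
    rw [show S = fun t => ∫ τ in (0:ℝ)..t, Q τ from rfl]
    simp only [hSs]
    rw [hQs t x y]
  · have e : S (t + T) - S t - T • Q t = ∫ τ in t..(t + T), (Q τ - Q t) := by
      rw [intervalIntegral.integral_sub (hQi _ _) (by simp), ← hSdiff]
      simp
    simp only [e]
    refine (intervalIntegral.norm_integral_le_of_norm_le_const (C := T * p) fun τ hτ => ?_).trans ?_
    · rw [uIoc_of_le (by linarith)] at hτ
      rw [hQdiff]
      refine (intervalIntegral.norm_integral_le_of_norm_le_const fun s _ => hp s).trans ?_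
      rw [abs_of_nonneg (by linarith [hτ.1]), mul_comm]
      gcongr
      linarith [hτ.2]
    · simp [abs_of_pos hT]
  · simp only [_root_.sub_apply, _root_.smul_apply, inner_sub_right, real_inner_smul_right]
    rw [← inner_sub_right, ← _root_.sub_apply, hQdiff]
    rw [ContinuousLinearMap.intervalIntegral_apply (hPi _ _), ← innerSL_apply_apply ℝ x,
      ← ContinuousLinearMap.intervalIntegral_comp_comm]
    · rfl
    · exact (hPc.clm_apply continuous_const).intervalIntegrable _ _

/-- Decay of `n` from a Lyapunov function `W` comparable to `n²`, with an exponentially decaying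
source `φ`. The rate `κ` of the source is at most half of the decay rate `c`, so it survives in the
conclusion. -/
theorem le_exp_of_deriv_le_of_sq_le {W W' n φ : ℝ → ℝ} {t₀ m c D κ B : ℝ} (hm0 : 0 < m)
    (hc0 : 0 < c) (hD0 : 0 ≤ D) (hκc : 2 * κ ≤ c) (hB : 0 ≤ B)
    (hWd : ∀ t, t₀ ≤ t → HasDerivWithinAt W (W' t) (Ici t₀) t)
    (hWge : ∀ t, t₀ ≤ t → n t ^ 2 ≤ W t) (hWle : ∀ t, t₀ ≤ t → W t ≤ m * n t ^ 2)
    (hn : ∀ t, t₀ ≤ t → 0 ≤ n t)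
    (hW' : ∀ t, t₀ ≤ t → W' t ≤ -(2 * c) * W t + D * φ t ^ 2) (hφ0 : ∀ t, t₀ ≤ t → 0 ≤ φ t)
    (hφ : ∀ t, t₀ ≤ t → φ t ≤ B * Real.exp (-κ * (t - t₀))) {t : ℝ} (ht : t₀ ≤ t) :
    n t ≤ √(m + D / c) * Real.exp (-κ * (t - t₀)) * (n t₀ + B) := by
  -- the weighted function `W exp (2κ(t - t₀))` obeys an affine differential inequality
  have hE : ∀ t, HasDerivAt (fun s => Real.exp (2 * κ * (s - t₀)))
      (Real.exp (2 * κ * (t - t₀)) * (2 * κ)) t := by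
    intro t
    have := (((hasDerivAt_id t).sub_const t₀).const_mul (2 * κ)).exp
    simpa using this
  have hmain : ∀ t, t₀ ≤ t → W t * Real.exp (2 * κ * (t - t₀)) ≤ m * n t₀ ^ 2 + D / c * B ^ 2 := by
    intro t ht
    have h := le_max_of_deriv_le_affine (η := D * B ^ 2) hc0
      (fun t ht => (hWd t ht).mul (hE t).hasDerivWithinAt) (fun t ht => ?_) ht
    · simp only [Pi.mul_apply, sub_self, mul_zero, Real.exp_zero, mul_one] at h
      have h1 := hWle t₀ le_rfl
      have h2 : D * B ^ 2 / c = D / c * B ^ 2 := by ring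
      have h3 : 0 ≤ D / c * B ^ 2 := by positivity
      have h4 : 0 ≤ m * n t₀ ^ 2 := by positivity
      rw [h2] at h
      exact h.trans (max_le (by linarith) (by linarith))
    · simp only [Pi.mul_apply]
      set e := Real.exp (2 * κ * (t - t₀)) with he
      have he0 : 0 < e := Real.exp_pos _
      have hfe : φ t ^ 2 * e ≤ B ^ 2 := by
        have h1 : φ t ^ 2 ≤ (B * Real.exp (-κ * (t - t₀))) ^ 2 := by have := hφ0 t ht; gcongr; exact hφ t ht
        calc _ ≤ (B * Real.exp (-κ * (t - t₀))) ^ 2 * e := by gcongr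
          _ = B ^ 2 * (Real.exp (-κ * (t - t₀)) * Real.exp (-κ * (t - t₀)) * e) := by ring
          _ = B ^ 2 := by
            rw [he, ← Real.exp_add, ← Real.exp_add]
            ring_nf; simp
      have h1 := hW' t ht
      have hW0 : 0 ≤ W t := (sq_nonneg _).trans (hWge t ht)
      have h4 : W' t * e ≤ (-(2 * c) * W t + D * φ t ^ 2) * e := by gcongr
      have h5 : W t * e * (2 * κ) ≤ W t * e * c := by gcongr
      have h6 : D * (φ t ^ 2 * e) ≤ D * B ^ 2 := by gcongr
      nlinarith
  apply le_of_sq_le_sq _ (by have := hn t₀ le_rfl; positivity)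
  have h1 := hmain t ht
  have h2 := hWge t ht
  have h3 : Real.exp (-κ * (t - t₀)) ^ 2 * Real.exp (2 * κ * (t - t₀)) = 1 := by
    rw [sq, ← Real.exp_add, ← Real.exp_add]; ring_nf; simp
  calc n t ^ 2 ≤ W t := h2
    _ = Real.exp (-κ * (t - t₀)) ^ 2 * (W t * Real.exp (2 * κ * (t - t₀))) := by
      rw [mul_comm (W t), ← mul_assoc, h3, one_mul]
    _ ≤ Real.exp (-κ * (t - t₀)) ^ 2 * (m * n t₀ ^ 2 + D / c * B ^ 2) := by gcongr
    _ ≤ Real.exp (-κ * (t - t₀)) ^ 2 * ((m + D / c) * (n t₀ + B) ^ 2) := by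
      gcongr
      have : 0 ≤ D / c := by positivity
      nlinarith [mul_nonneg hm0.le (mul_nonneg (hn t₀ le_rfl) hB),
        mul_nonneg this (mul_nonneg (hn t₀ le_rfl) hB),
        mul_nonneg hm0.le (sq_nonneg B), mul_nonneg this (sq_nonneg (n t₀))]
    _ = _ := by rw [mul_pow, mul_pow, Real.sq_sqrt (by positivity)]; ring

/-- Solutions of `u' = -g P u + f` decay exponentially when `P` is positive semidefinite and
persistently exciting and `f` decays exponentially. With `Λ` as in `exists_excitation_integral` and
`γ` large, `γ |u|² - ⟪u, Λ u⟫` is a strict Lyapunov function. -/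
theorem exists_decay_of_excitation {H : Type*} [NormedAddCommGroup H] [InnerProductSpace ℝ H]
    [CompleteSpace H] {P : ℝ → H →L[ℝ] H} (hPc : Continuous P)
    (hsymm : ∀ t x y, inner ℝ (P t x) y = inner ℝ x (P t y))
    (hpos : ∀ t x, 0 ≤ inner ℝ x (P t x)) {p : ℝ} (hp : ∀ t, ‖P t‖ ≤ p)
    {T : ℝ} (hT : 0 < T) {δ : ℝ} (hδ : 0 < δ)
    (hPE : ∀ t, 0 ≤ t → ∀ x, δ * ‖x‖ ^ 2 ≤ ∫ τ in t..(t + T), inner ℝ x (P τ x))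
    {g : ℝ} (hg : 0 < g) {κ₀ : ℝ} (hκ₀ : 0 < κ₀) :
    ∃ κ > 0, κ ≤ κ₀ ∧ ∃ C > 0, ∀ t₀, 0 ≤ t₀ → ∀ (u f : ℝ → H) (B : ℝ), 0 ≤ B →
      (∀ t, t₀ ≤ t → HasDerivWithinAt u (-(g • P t (u t)) + f t) (Ici t₀) t) →
      (∀ t, t₀ ≤ t → ‖f t‖ ≤ B * Real.exp (-κ * (t - t₀))) →
      ∀ t, t₀ ≤ t → ‖u t‖ ≤ C * Real.exp (-κ * (t - t₀)) * (‖u t₀‖ + B) := by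
  obtain ⟨Λ, Λ', hΛ, hΛs, ⟨ℓ, hℓ0, hℓ⟩, hΛ'⟩ := exists_excitation_integral hPc hsymm hp hT
  have hp0 : 0 ≤ p := (norm_nonneg _).trans (hp 0)
  -- weight of the Young inequality for the cross term `⟪Λ u, P u⟫`
  set ε : ℝ := δ / (4 * g * (p * ℓ ^ 2 + 1)) with hε
  have hε0 : 0 < ε := by positivity
  have hεle : g * ε * (p * ℓ ^ 2) ≤ δ / 4 := by
    have : g * ε * (p * ℓ ^ 2 + 1) = δ / 4 := by rw [hε]; field_simp
    nlinarith [mul_pos hg hε0]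
  set γ : ℝ := ℓ + 1 + (T + g / ε) / (2 * g) with hγ
  have hγ1 : T + g / ε ≤ 2 * γ * g := by
    have : (T + g / ε) / (2 * g) * (2 * g) = T + g / ε := by field_simp
    nlinarith
  have hγ2 : ℓ + 1 ≤ γ := by rw [hγ]; linarith [show 0 ≤ (T + g / ε) / (2 * g) by positivity]
  set m : ℝ := γ + ℓ with hm
  have hm0 : 0 < m := by positivity
  set D : ℝ := 4 * m ^ 2 / δ with hD
  have hD0 : 0 < D := by positivity
  set c : ℝ := δ / (4 * m) with hc
  have hc0 : 0 < c := by positivity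
  refine ⟨min κ₀ (c / 2), by positivity, min_le_left _ _, √(m + D / c), by positivity, ?_⟩
  intro t₀ ht₀ u f B hB hu hf
  set κ := min κ₀ (c / 2) with hκ
  have hκc : 2 * κ ≤ c := by linarith [min_le_right κ₀ (c / 2)]
  set W : ℝ → ℝ := fun t => γ * inner ℝ (u t) (u t) - inner ℝ (u t) (Λ t (u t)) with hW
  have hWle : ∀ t, W t ≤ m * ‖u t‖ ^ 2 := by
    intro t
    have h1 := abs_le.1 (abs_real_inner_le_norm (u t) (Λ t (u t)))
    have h2 : ‖Λ t (u t)‖ ≤ ℓ * ‖u t‖ := (Λ t).le_of_opNorm_le (hℓ t) _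
    simp only [hW, real_inner_self_eq_norm_sq, hm]
    nlinarith [norm_nonneg (u t)]
  have hWge : ∀ t, ‖u t‖ ^ 2 ≤ W t := by
    intro t
    have h1 := abs_le.1 (abs_real_inner_le_norm (u t) (Λ t (u t)))
    have h2 : ‖Λ t (u t)‖ ≤ ℓ * ‖u t‖ := (Λ t).le_of_opNorm_le (hℓ t) _
    simp only [hW, real_inner_self_eq_norm_sq]
    nlinarith [norm_nonneg (u t), sq_nonneg (‖u t‖)]
  set u' : ℝ → H := fun t => -(g • P t (u t)) + f t with hu'
  set W' : ℝ → ℝ := fun t => γ * (inner ℝ (u t) (u' t) + inner ℝ (u' t) (u t))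
    - (inner ℝ (u t) (Λ' t (u t) + Λ t (u' t)) + inner ℝ (u' t) (Λ t (u t))) with hW'
  have hWd : ∀ t, t₀ ≤ t → HasDerivWithinAt W (W' t) (Ici t₀) t := by
    intro t ht
    have h1 := hu t ht
    exact ((h1.inner ℝ h1).const_mul γ).sub
      (h1.inner ℝ ((hΛ t).hasDerivWithinAt.clm_apply h1))
  have hW'le : ∀ t, t₀ ≤ t → W' t ≤ -(δ / 2) * ‖u t‖ ^ 2 + D * ‖f t‖ ^ 2 := by
    intro t ht
    have e1 : W' t = 2 * γ * inner ℝ (u t) (u' t) - inner ℝ (u t) (Λ' t (u t))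
        - 2 * inner ℝ (Λ t (u t)) (u' t) := by
      simp only [hW', inner_add_right]
      rw [real_inner_comm (u t) (u' t), real_inner_comm (Λ t (u t)) (u' t), ← hΛs]
      ring
    rw [e1, hΛ']
    simp only [hu', inner_add_right, inner_neg_right, real_inner_smul_right]
    have h1 := hPE t (ht₀.trans ht) (u t)
    have h2 := hpos t (u t)
    -- Young: `2 ⟪Λ u, P u⟫ ≤ ε ⟪Λ u, P Λ u⟫ + ε⁻¹ ⟪u, P u⟫`
    have h3 : 2 * inner ℝ (Λ t (u t)) (P t (u t)) ≤
        ε * inner ℝ (Λ t (u t)) (P t (Λ t (u t))) + 1 / ε * inner ℝ (u t) (P t (u t)) := by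
      have h := hpos t (ε • Λ t (u t) - u t)
      simp only [map_sub, map_smul, inner_sub_left, inner_sub_right, real_inner_smul_left,
        real_inner_smul_right] at h
      rw [real_inner_comm (P t (Λ t (u t))) (u t), hsymm t (Λ t (u t)) (u t)] at h
      have : 0 ≤ (1 / ε) * (ε * (ε * inner ℝ (Λ t (u t)) (P t (Λ t (u t))))
          - ε * inner ℝ (Λ t (u t)) (P t (u t)) - (ε * inner ℝ (Λ t (u t)) (P t (u t))
          - inner ℝ (u t) (P t (u t)))) := mul_nonneg (by positivity) (by linarith)
      have e : (1 / ε) * (ε * (ε * inner ℝ (Λ t (u t)) (P t (Λ t (u t))))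
          - ε * inner ℝ (Λ t (u t)) (P t (u t)) - (ε * inner ℝ (Λ t (u t)) (P t (u t))
          - inner ℝ (u t) (P t (u t)))) = ε * inner ℝ (Λ t (u t)) (P t (Λ t (u t)))
          - 2 * inner ℝ (Λ t (u t)) (P t (u t)) + 1 / ε * inner ℝ (u t) (P t (u t)) := by
        field_simp; ring
      linarith
    have h4 : inner ℝ (Λ t (u t)) (P t (Λ t (u t))) ≤ p * ℓ ^ 2 * ‖u t‖ ^ 2 := by
      have h := real_inner_le_norm (Λ t (u t)) (P t (Λ t (u t)))
      have ha : ‖Λ t (u t)‖ ≤ ℓ * ‖u t‖ := (Λ t).le_of_opNorm_le (hℓ t) _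
      have hb : ‖P t (Λ t (u t))‖ ≤ p * ‖Λ t (u t)‖ := (P t).le_of_opNorm_le (hp t) _
      calc _ ≤ _ := h
        _ ≤ ‖Λ t (u t)‖ * (p * ‖Λ t (u t)‖) := by gcongr
        _ = p * ‖Λ t (u t)‖ ^ 2 := by ring
        _ ≤ p * (ℓ * ‖u t‖) ^ 2 := by gcongr
        _ = _ := by ring
    have h5 : inner ℝ (u t) (f t) ≤ ‖u t‖ * ‖f t‖ := real_inner_le_norm _ _
    have h6 : -inner ℝ (Λ t (u t)) (f t) ≤ ℓ * ‖u t‖ * ‖f t‖ := by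
      have ha : ‖Λ t (u t)‖ ≤ ℓ * ‖u t‖ := (Λ t).le_of_opNorm_le (hℓ t) _
      have := (abs_le.1 (abs_real_inner_le_norm (Λ t (u t)) (f t))).1
      nlinarith [norm_nonneg (f t)]
    have h7 : 2 * m * (‖u t‖ * ‖f t‖) ≤ δ / 4 * ‖u t‖ ^ 2 + D * ‖f t‖ ^ 2 := by
      have : δ / 4 * ‖u t‖ ^ 2 + D * ‖f t‖ ^ 2 - 2 * m * (‖u t‖ * ‖f t‖)
          = δ / 4 * (‖u t‖ - 4 * m / δ * ‖f t‖) ^ 2 := by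
        rw [hD]; field_simp; ring
      have : 0 ≤ δ / 4 * (‖u t‖ - 4 * m / δ * ‖f t‖) ^ 2 := by positivity
      linarith
    set I := inner ℝ (u t) (P t (u t))
    have h8 : g * (2 * inner ℝ (Λ t (u t)) (P t (u t))) ≤
        δ / 4 * ‖u t‖ ^ 2 + g / ε * I := by
      calc _ ≤ g * (ε * (p * ℓ ^ 2 * ‖u t‖ ^ 2) + 1 / ε * I) := by
            gcongr; exact h3.trans (by gcongr)
        _ = (g * ε * (p * ℓ ^ 2)) * ‖u t‖ ^ 2 + g / ε * I := by ring
        _ ≤ _ := by gcongr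
    have h9 : (T + g / ε) * I ≤ 2 * γ * g * I := by gcongr
    have h10 : 2 * γ * inner ℝ (u t) (f t) ≤ 2 * γ * (‖u t‖ * ‖f t‖) := by
      have : 0 ≤ 2 * γ := by positivity
      gcongr
    rw [hm] at h7
    linarith
  refine fun t ht => le_exp_of_deriv_le_of_sq_le hm0 hc0 hD0.le hκc hB hWd (fun t _ => hWge t)
    (fun t _ => hWle t) (fun t _ => norm_nonneg (u t)) (fun t ht => ?_) (fun t _ => norm_nonneg _)
    hf ht
  have h2 : δ / 2 * ‖u t‖ ^ 2 = 2 * c * (m * ‖u t‖ ^ 2) := by rw [hc]; field_simp; ring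
  have h3 : 2 * c * W t ≤ 2 * c * (m * ‖u t‖ ^ 2) := by gcongr; exact hWle t
  linarith [hW'le t ht]

/-! ### Rotations and quaternions -/

theorem mul_transpose_of_mem_SO3 {R : Matrix (Fin 3) (Fin 3) ℝ}
    (hR : R ∈ specialOrthogonalGroup (Fin 3) ℝ) : R * Rᵀ = 1 :=
  (mem_orthogonalGroup_iff (Fin 3) ℝ).1 (mem_specialOrthogonalGroup_iff.1 hR).1

theorem transpose_mul_of_mem_SO3 {R : Matrix (Fin 3) (Fin 3) ℝ}
    (hR : R ∈ specialOrthogonalGroup (Fin 3) ℝ) : Rᵀ * R = 1 :=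
  (mem_orthogonalGroup_iff' (Fin 3) ℝ).1 (mem_specialOrthogonalGroup_iff.1 hR).1

theorem transpose_mem_SO3 {R : Matrix (Fin 3) (Fin 3) ℝ}
    (hR : R ∈ specialOrthogonalGroup (Fin 3) ℝ) : Rᵀ ∈ specialOrthogonalGroup (Fin 3) ℝ := by
  rw [mem_specialOrthogonalGroup_iff, mem_orthogonalGroup_iff]
  refine ⟨?_, by rw [det_transpose]; exact (mem_specialOrthogonalGroup_iff.1 hR).2⟩
  rw [transpose_transpose]
  exact transpose_mul_of_mem_SO3 hR

theorem adjugate_of_mem_SO3 {R : Matrix (Fin 3) (Fin 3) ℝ}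
    (hR : R ∈ specialOrthogonalGroup (Fin 3) ℝ) : R.adjugate = Rᵀ := by
  have h1 : R.adjugate * R = 1 := by
    rw [adjugate_mul, (mem_specialOrthogonalGroup_iff.1 hR).2, one_smul]
  calc R.adjugate = R.adjugate * (R * Rᵀ) := by rw [mul_transpose_of_mem_SO3 hR, mul_one]
    _ = Rᵀ := by rw [← mul_assoc, h1, one_mul]

theorem abs_entry_le_one_of_mem_SO3 {R : Matrix (Fin 3) (Fin 3) ℝ}
    (hR : R ∈ specialOrthogonalGroup (Fin 3) ℝ) (i j : Fin 3) : |R i j| ≤ 1 := by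
  have h : (R * Rᵀ) i i = 1 := by rw [mul_transpose_of_mem_SO3 hR]; simp
  rw [Matrix.mul_apply] at h
  simp only [transpose_apply] at h
  have h2 : R i j * R i j ≤ ∑ k, R i k * R i k :=
    Finset.single_le_sum (f := fun k => R i k * R i k) (fun k _ => mul_self_nonneg _)
      (Finset.mem_univ j)
  exact abs_le_one_iff_mul_self_le_one.2 (h ▸ h2)

/-- A crude bound, from the number of entries; the Frobenius norm of a rotation is `√3`. -/
theorem norm_le_of_mem_SO3 {R : Matrix (Fin 3) (Fin 3) ℝ}
    (hR : R ∈ specialOrthogonalGroup (Fin 3) ℝ) : ‖R‖ ≤ 9 := by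
  have := norm_le_of_abs_entry_le (abs_entry_le_one_of_mem_SO3 hR) zero_le_one
  norm_num at this
  exact this

/-- Every entry of a rotation matrix is its own cofactor. -/
theorem cofactors_of_mem_SO3 {R : Matrix (Fin 3) (Fin 3) ℝ}
    (hR : R ∈ specialOrthogonalGroup (Fin 3) ℝ) :
    (R 0 0 = R 1 1 * R 2 2 - R 1 2 * R 2 1 ∧ R 0 1 = R 1 2 * R 2 0 - R 1 0 * R 2 2 ∧
      R 0 2 = R 1 0 * R 2 1 - R 1 1 * R 2 0) ∧
    (R 1 0 = R 0 2 * R 2 1 - R 0 1 * R 2 2 ∧ R 1 1 = R 0 0 * R 2 2 - R 0 2 * R 2 0 ∧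
      R 1 2 = R 0 1 * R 2 0 - R 0 0 * R 2 1) ∧
    (R 2 0 = R 0 1 * R 1 2 - R 0 2 * R 1 1 ∧ R 2 1 = R 0 2 * R 1 0 - R 0 0 * R 1 2 ∧
      R 2 2 = R 0 0 * R 1 1 - R 0 1 * R 1 0) := by
  have h := adjugate_of_mem_SO3 hR
  rw [adjugate_fin_three] at h
  have e : ∀ i j, R i j = _ := fun i j => (congrFun (congrFun h j) i).symm
  refine ⟨⟨?_, ?_, ?_⟩, ⟨?_, ?_, ?_⟩, ⟨?_, ?_, ?_⟩⟩
  · have := e 0 0; simp at this; linarith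
  · have := e 0 1; simp at this; linarith
  · have := e 0 2; simp at this; linarith
  · have := e 1 0; simp at this; linarith
  · have := e 1 1; simp at this; linarith
  · have := e 1 2; simp at this; linarith
  · have := e 2 0; simp at this; linarith
  · have := e 2 1; simp at this; linarith
  · have := e 2 2; simp at this; linarith

theorem skew_mulVec_of_mem_SO3 {Q : Matrix (Fin 3) (Fin 3) ℝ}
    (hQ : Q ∈ specialOrthogonalGroup (Fin 3) ℝ) (w : Vec3) :
    skew (Q *ᵥ w) = Q * skew w * Qᵀ := by
  obtain ⟨⟨h00, h01, h02⟩, ⟨h10, h11, h12⟩, h20, h21, h22⟩ := cofactors_of_mem_SO3 hQ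
  ext i j
  fin_cases i <;> fin_cases j <;>
    simp [skew, mulVec, dotProduct, Matrix.mul_apply, Fin.sum_univ_three]
  · ring
  · linear_combination -w 0 * h20 - w 1 * h21 - w 2 * h22
  · linear_combination w 0 * h10 + w 1 * h11 + w 2 * h12
  · linear_combination w 0 * h20 + w 1 * h21 + w 2 * h22
  · ring
  · linear_combination -w 0 * h00 - w 1 * h01 - w 2 * h02
  · linear_combination -w 0 * h10 - w 1 * h11 - w 2 * h12
  · linear_combination w 0 * h00 + w 1 * h01 + w 2 * h02
  · ring

theorem skew_skew_mulVec (v w : Vec3) :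
    skew (skew v *ᵥ w) = vecMulVec w v - vecMulVec v w := by
  ext i j
  fin_cases i <;> fin_cases j <;>
    simp [skew, mulVec, dotProduct, Fin.sum_univ_three, vecMulVec_apply] <;> ring

theorem skew_add (v w : Vec3) : skew (v + w) = skew v + skew w := by
  ext i j
  fin_cases i <;> fin_cases j <;> simp [skew] <;> ring

theorem skew_smul (c : ℝ) (v : Vec3) : skew (c • v) = c • skew v := by
  ext i j
  fin_cases i <;> fin_cases j <;> simp [skew]

/-- The squared norm of a quaternion `x`, with real part `x 0`. -/
def normSq (x : Fin 4 → ℝ) : ℝ := x 0 * x 0 + x 1 * x 1 + x 2 * x 2 + x 3 * x 3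

/-- The squared norm of the imaginary part of a quaternion. -/
def imNormSq (x : Fin 4 → ℝ) : ℝ := x 1 * x 1 + x 2 * x 2 + x 3 * x 3

/-- The homogeneous Euler–Rodrigues matrix `v ↦ x v x̄` of a quaternion. -/
def quatMat (x : Fin 4 → ℝ) : Matrix (Fin 3) (Fin 3) ℝ :=
  !![x 0 * x 0 + x 1 * x 1 - x 2 * x 2 - x 3 * x 3, 2 * (x 1 * x 2 - x 0 * x 3),
      2 * (x 1 * x 3 + x 0 * x 2);
    2 * (x 1 * x 2 + x 0 * x 3), x 0 * x 0 - x 1 * x 1 + x 2 * x 2 - x 3 * x 3,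
      2 * (x 2 * x 3 - x 0 * x 1);
    2 * (x 1 * x 3 - x 0 * x 2), 2 * (x 2 * x 3 + x 0 * x 1),
      x 0 * x 0 - x 1 * x 1 - x 2 * x 2 + x 3 * x 3]

/-- The rotation matrix represented by a nonzero quaternion. -/
def quatRot (x : Fin 4 → ℝ) : Matrix (Fin 3) (Fin 3) ℝ := (normSq x)⁻¹ • quatMat x

theorem normSq_eq (x : Fin 4 → ℝ) : normSq x = x 0 * x 0 + imNormSq x := by
  simp only [normSq, imNormSq]; ring

theorem imNormSq_nonneg (x : Fin 4 → ℝ) : 0 ≤ imNormSq x := by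
  simp only [imNormSq]; nlinarith [sq_nonneg (x 1), sq_nonneg (x 2), sq_nonneg (x 3)]

theorem sq_le_normSq (x : Fin 4 → ℝ) (i : Fin 4) : x i ^ 2 ≤ normSq x := by
  simp only [normSq]
  fin_cases i <;> simp <;>
    nlinarith [sq_nonneg (x 0), sq_nonneg (x 1), sq_nonneg (x 2), sq_nonneg (x 3)]

theorem normSq_nonneg (x : Fin 4 → ℝ) : 0 ≤ normSq x :=
  (sq_nonneg _).trans (sq_le_normSq x 0)

theorem normSq_pos {x : Fin 4 → ℝ} (hx : x ≠ 0) : 0 < normSq x := by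
  obtain ⟨i, hi⟩ := Function.ne_iff.1 hx
  exact lt_of_lt_of_le (by have : x i ≠ 0 := hi; positivity) (sq_le_normSq x i)

theorem quatMat_smul (c : ℝ) (x : Fin 4 → ℝ) : quatMat (c • x) = (c * c) • quatMat x := by
  ext i j
  fin_cases i <;> fin_cases j <;> simp [quatMat] <;> ring

theorem normSq_smul (c : ℝ) (x : Fin 4 → ℝ) : normSq (c • x) = (c * c) * normSq x := by
  simp [normSq]; ring

theorem quatRot_smul {c : ℝ} (hc : c ≠ 0) (x : Fin 4 → ℝ) : quatRot (c • x) = quatRot x := by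
  rw [quatRot, quatRot, quatMat_smul, normSq_smul, smul_smul]
  congr 1
  field_simp

theorem quatMat_mul_transpose (x : Fin 4 → ℝ) :
    quatMat x * (quatMat x)ᵀ = (normSq x * normSq x) • (1 : Matrix (Fin 3) (Fin 3) ℝ) := by
  ext i j
  fin_cases i <;> fin_cases j <;>
    simp [quatMat, normSq, Matrix.mul_apply, Fin.sum_univ_three] <;> ring

theorem quatRot_mem {x : Fin 4 → ℝ} (hx : x ≠ 0) :
    quatRot x ∈ specialOrthogonalGroup (Fin 3) ℝ := by
  have h := (normSq_pos hx).ne'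
  rw [mem_specialOrthogonalGroup_iff, mem_orthogonalGroup_iff, quatRot, transpose_smul, smul_mul_smul_comm,
    quatMat_mul_transpose, smul_smul, det_smul]
  refine ⟨?_, ?_⟩
  · rw [show (normSq x)⁻¹ * (normSq x)⁻¹ * (normSq x * normSq x) = 1 by field_simp, one_smul]
  · have : (quatMat x).det = normSq x ^ 3 := by
      simp [det_fin_three, quatMat, normSq]; ring
    rw [this]
    simp [h]

/-- Every rotation is represented by a quaternion. For a rotation `R` the symmetric matrix
`4 x xᵀ` of a unit quaternion `x` representing `R` has entries affine in `R`; any nonzero column of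
it is proportional to `x`. -/
theorem exists_quatRot_eq {R : Matrix (Fin 3) (Fin 3) ℝ}
    (hR : R ∈ specialOrthogonalGroup (Fin 3) ℝ) : ∃ x : Fin 4 → ℝ, x ≠ 0 ∧ quatRot x = R := by
  obtain ⟨⟨h00, h01, h02⟩, ⟨h10, h11, h12⟩, h20, h21, h22⟩ := cofactors_of_mem_SO3 hR
  have hr := mul_transpose_of_mem_SO3 hR
  have hc := transpose_mul_of_mem_SO3 hR
  have er : ∀ i j, R i 0 * R j 0 + R i 1 * R j 1 + R i 2 * R j 2 = (1 : Matrix _ _ ℝ) i j := by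
    intro i j; rw [← hr]; simp [Matrix.mul_apply, Fin.sum_univ_three]
  have ec : ∀ i j, R 0 i * R 0 j + R 1 i * R 1 j + R 2 i * R 2 j = (1 : Matrix _ _ ℝ) i j := by
    intro i j; rw [← hc]; simp [Matrix.mul_apply, Fin.sum_univ_three]
  have r00 := er 0 0; have r01 := er 0 1; have r02 := er 0 2
  have r11 := er 1 1; have r12 := er 1 2; have r22 := er 2 2
  have c00 := ec 0 0; have c01 := ec 0 1; have c02 := ec 0 2
  have c11 := ec 1 1; have c12 := ec 1 2; have c22 := ec 2 2
  simp at r00 r01 r02 r11 r12 r22 c00 c01 c02 c11 c12 c22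
  clear hr hc er ec hR
  have key : ∀ (x : Fin 4 → ℝ) (i : Fin 4), x i ≠ 0 → normSq x = 4 * x i →
      quatMat x = (4 * x i) • R → ∃ x : Fin 4 → ℝ, x ≠ 0 ∧ quatRot x = R := by
    intro x i hi hn hq
    refine ⟨x, fun h => hi (by simp [h]), ?_⟩
    rw [quatRot, hn, hq, smul_smul, inv_mul_cancel₀ (by simpa using hi), one_smul]
  by_cases h0 : 1 + R 0 0 + R 1 1 + R 2 2 = 0
  · by_cases h1 : 1 + R 0 0 - R 1 1 - R 2 2 = 0
    · by_cases h2 : 1 - R 0 0 + R 1 1 - R 2 2 = 0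
      · have h3 : 1 - R 0 0 - R 1 1 + R 2 2 ≠ 0 := by intro h3; linarith
        refine key ![R 1 0 - R 0 1, R 0 2 + R 2 0, R 1 2 + R 2 1, 1 - R 0 0 - R 1 1 + R 2 2] 3 h3
          ?_ ?_
        · simp [normSq]; linarith
        · ext i j
          fin_cases i <;> fin_cases j <;> simp [quatMat] <;> linarith
      · refine key ![R 0 2 - R 2 0, R 0 1 + R 1 0, 1 - R 0 0 + R 1 1 - R 2 2, R 1 2 + R 2 1] 2 h2
          ?_ ?_
        · simp [normSq]; linarith
        · ext i j
          fin_cases i <;> fin_cases j <;> simp [quatMat] <;> linarith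
    · refine key ![R 2 1 - R 1 2, 1 + R 0 0 - R 1 1 - R 2 2, R 0 1 + R 1 0, R 0 2 + R 2 0] 1 h1
        ?_ ?_
      · simp [normSq]; linarith
      · ext i j
        fin_cases i <;> fin_cases j <;> simp [quatMat] <;> linarith
  · refine key ![1 + R 0 0 + R 1 1 + R 2 2, R 2 1 - R 1 2, R 0 2 - R 2 0, R 1 0 - R 0 1] 0 h0
      ?_ ?_
    · simp [normSq]; linarith
    · ext i j
      fin_cases i <;> fin_cases j <;> simp [quatMat] <;> linarith

theorem trace_quatRot {x : Fin 4 → ℝ} (hx : x ≠ 0) :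
    (1 - quatRot x).trace = 4 * imNormSq x / normSq x := by
  have h := (normSq_pos hx).ne'
  rw [trace_sub, quatRot, trace_smul]
  simp only [trace_one, Fintype.card_fin, trace_fin_three, quatMat, smul_eq_mul]
  simp
  field_simp
  simp only [normSq, imNormSq]; ring

theorem norm_quatRot_sub_one_sq {x : Fin 4 → ℝ} (hx : x ≠ 0) :
    ‖quatRot x - 1‖ ^ 2 = 8 * imNormSq x / normSq x := by
  have h := (normSq_pos hx).ne'
  have e : quatRot x - 1 = (normSq x)⁻¹ • (quatMat x - normSq x • 1) := by
    rw [smul_sub, smul_smul, inv_mul_cancel₀ h, one_smul, quatRot]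
  have e2 : ‖quatMat x - normSq x • (1 : Matrix (Fin 3) (Fin 3) ℝ)‖ ^ 2
      = 8 * imNormSq x * normSq x := by
    rw [frobenius_norm_sq]
    simp [quatMat, normSq, imNormSq, Fin.sum_univ_three]; ring
  rw [e, norm_smul, mul_pow, e2, Real.norm_eq_abs, sq_abs]
  field_simp

/-- The coefficient matrix of the linear quaternion equation that lifts the matrix Riccati equation
`R' = 4 (Gᵀ - R G R)`. Up to a multiple of the identity it is twice Davenport's matrix of `G`; the
multiple is chosen so that the coefficient of `x 0` in `x 0'` vanishes. -/
def quatGen (G : Matrix (Fin 3) (Fin 3) ℝ) : Matrix (Fin 4) (Fin 4) ℝ :=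
  !![0, 2 * (G 1 2 - G 2 1), 2 * (G 2 0 - G 0 2), 2 * (G 0 1 - G 1 0);
    2 * (G 1 2 - G 2 1), -4 * (G 1 1 + G 2 2), 2 * (G 0 1 + G 1 0), 2 * (G 0 2 + G 2 0);
    2 * (G 2 0 - G 0 2), 2 * (G 0 1 + G 1 0), -4 * (G 0 0 + G 2 2), 2 * (G 1 2 + G 2 1);
    2 * (G 0 1 - G 1 0), 2 * (G 0 2 + G 2 0), 2 * (G 1 2 + G 2 1), -4 * (G 0 0 + G 1 1)]

theorem hasDerivWithinAt_quatRot {x : ℝ → Fin 4 → ℝ} {G : Matrix (Fin 3) (Fin 3) ℝ} {s : Set ℝ}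
    {t : ℝ} (hx : HasDerivWithinAt x (quatGen G *ᵥ x t) s t) (h0 : x t ≠ 0) :
    HasDerivWithinAt (fun t => quatRot (x t))
      ((4 : ℝ) • (Gᵀ - quatRot (x t) * G * quatRot (x t))) s t := by
  have hρ := (normSq_pos h0).ne'
  rw [hasDerivWithinAt_pi] at hx
  have h : ∀ i j, HasDerivWithinAt (fun t => x t i * x t j)
      ((quatGen G *ᵥ x t) i * x t j + x t i * (quatGen G *ᵥ x t) j) s t :=
    fun i j => (hx i).fun_mul (hx j)
  have hn : HasDerivWithinAt (fun t => normSq (x t)) _ s t :=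
    (((h 0 0).fun_add (h 1 1)).fun_add (h 2 2)).fun_add (h 3 3)
  have e : quatRot (x t) * G * quatRot (x t)
      = (normSq (x t))⁻¹ ^ 2 • (quatMat (x t) * G * quatMat (x t)) := by
    simp only [quatRot, Matrix.smul_mul, Matrix.mul_smul, smul_smul, sq]
  rw [hasDerivWithinAt_matrix, e]
  have fin : ∀ i j (q' : ℝ), HasDerivWithinAt (fun t => quatMat (x t) i j) q' s t →
      q' * normSq (x t) - quatMat (x t) i j * (((((quatGen G *ᵥ x t) 0 * x t 0 + x t 0 * (quatGen G *ᵥ x t) 0)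
        + ((quatGen G *ᵥ x t) 1 * x t 1 + x t 1 * (quatGen G *ᵥ x t) 1))
        + ((quatGen G *ᵥ x t) 2 * x t 2 + x t 2 * (quatGen G *ᵥ x t) 2))
        + ((quatGen G *ᵥ x t) 3 * x t 3 + x t 3 * (quatGen G *ᵥ x t) 3))
        = 4 * (normSq (x t) ^ 2 * G j i - (quatMat (x t) * G * quatMat (x t)) i j) →
      HasDerivWithinAt (fun t => quatRot (x t) i j)
        (((4 : ℝ) • (Gᵀ - (normSq (x t))⁻¹ ^ 2 • (quatMat (x t) * G * quatMat (x t)))) i j) s t := by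
    intro i j q' hq hid
    have h1 := hq.fun_div hn hρ
    rw [hid] at h1
    have e2 : (fun t => quatRot (x t) i j) = fun t => quatMat (x t) i j / normSq (x t) := by
      ext t; simp [quatRot, div_eq_inv_mul]
    rw [e2]
    refine h1.congr_deriv ?_
    simp only [Matrix.smul_apply, Matrix.sub_apply, transpose_apply, smul_eq_mul]
    field_simp
  have triple : ∀ (A : Matrix (Fin 3) (Fin 3) ℝ) i j, (A * G * A) i j =
      (A i 0 * G 0 0 + A i 1 * G 1 0 + A i 2 * G 2 0) * A 0 j
      + (A i 0 * G 0 1 + A i 1 * G 1 1 + A i 2 * G 2 1) * A 1 j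
      + (A i 0 * G 0 2 + A i 1 * G 1 2 + A i 2 * G 2 2) * A 2 j := fun A i j => by
    simp only [Matrix.mul_apply, Fin.sum_univ_three]
  have hv : ∀ i, (quatGen G *ᵥ x t) i = quatGen G i 0 * x t 0 + quatGen G i 1 * x t 1
      + quatGen G i 2 * x t 2 + quatGen G i 3 * x t 3 := fun i => by
    simp only [mulVec, dotProduct, Fin.sum_univ_four]
  intro i j
  fin_cases i <;> fin_cases j
  · refine fin 0 0 _ ((((h 0 0).fun_add (h 1 1)).fun_sub (h 2 2)).fun_sub (h 3 3)) ?_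
    rw [triple]; simp only [hv]; simp [quatMat, quatGen, normSq]; ring
  · refine fin 0 1 _ (((h 1 2).fun_sub (h 0 3)).const_mul 2) ?_
    rw [triple]; simp only [hv]; simp [quatMat, quatGen, normSq]; ring
  · refine fin 0 2 _ (((h 1 3).fun_add (h 0 2)).const_mul 2) ?_
    rw [triple]; simp only [hv]; simp [quatMat, quatGen, normSq]; ring
  · refine fin 1 0 _ (((h 1 2).fun_add (h 0 3)).const_mul 2) ?_
    rw [triple]; simp only [hv]; simp [quatMat, quatGen, normSq]; ring
  · refine fin 1 1 _ ((((h 0 0).fun_sub (h 1 1)).fun_add (h 2 2)).fun_sub (h 3 3)) ?_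
    rw [triple]; simp only [hv]; simp [quatMat, quatGen, normSq]; ring
  · refine fin 1 2 _ (((h 2 3).fun_sub (h 0 1)).const_mul 2) ?_
    rw [triple]; simp only [hv]; simp [quatMat, quatGen, normSq]; ring
  · refine fin 2 0 _ (((h 1 3).fun_sub (h 0 2)).const_mul 2) ?_
    rw [triple]; simp only [hv]; simp [quatMat, quatGen, normSq]; ring
  · refine fin 2 1 _ (((h 2 3).fun_add (h 0 1)).const_mul 2) ?_
    rw [triple]; simp only [hv]; simp [quatMat, quatGen, normSq]; ring
  · refine fin 2 2 _ ((((h 0 0).fun_sub (h 1 1)).fun_sub (h 2 2)).fun_add (h 3 3)) ?_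
    rw [triple]; simp only [hv]; simp [quatMat, quatGen, normSq]; ring

/-! ### The reduced error system -/

theorem exists_solution_bilinear_ode {A E : Type*} [NormedAddCommGroup A] [NormedSpace ℝ A]
    [FiniteDimensional ℝ A] [NormedAddCommGroup E] [NormedSpace ℝ E] [FiniteDimensional ℝ E]
    (f : A →ₗ[ℝ] E →ₗ[ℝ] E) {a : ℝ → A} (ha : Continuous a) {K : ℝ} (hK : ∀ t, ‖a t‖ ≤ K)
    (t₀ : ℝ) (x₀ : E) : ∃ x : ℝ → E, x t₀ = x₀ ∧ ∀ t, HasDerivAt x (f (a t) (x t)) t := by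
  have : CompleteSpace E := FiniteDimensional.complete ℝ E
  let Φ : A →L[ℝ] E →L[ℝ] E := LinearMap.toContinuousLinearMap
    ((LinearMap.toContinuousLinearMap (𝕜 := ℝ) (E := E) (F' := E)).toLinearMap ∘ₗ f)
  exact exists_solution_linear_ode (A := fun t => Φ (a t)) (Φ.continuous.comp ha)
    (fun t => (Φ.le_opNorm (a t)).trans (mul_le_mul_of_nonneg_left (hK t) (norm_nonneg _))) t₀ x₀

theorem exists_linearMap_bound {A E : Type*} [NormedAddCommGroup A] [NormedSpace ℝ A]
    [FiniteDimensional ℝ A] [NormedAddCommGroup E] [NormedSpace ℝ E] (f : A →ₗ[ℝ] E) :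
    ∃ C, 0 ≤ C ∧ ∀ a, ‖f a‖ ≤ C * ‖a‖ :=
  ⟨‖LinearMap.toContinuousLinearMap f‖, norm_nonneg _,
    fun a => (LinearMap.toContinuousLinearMap f).le_opNorm a⟩

/-- The matrix `∑ (|μ|² - μ μᵀ) = -∑ μ^× μ^×` attached to `S = ∑ μ μᵀ`. -/
def excitation (S : Matrix (Fin 3) (Fin 3) ℝ) : Matrix (Fin 3) (Fin 3) ℝ := S.trace • 1 - S

/-- The data of the error dynamics `R' = 4 (Gᵀ - R G R)`, `V' = -V M` with `G = S - B Vᵀ`.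
The coefficients are defined and bounded on all of `ℝ`, but `S` is excited at positive times only. -/
structure ErrorData where
  S : ℝ → Matrix (Fin 3) (Fin 3) ℝ
  B : ℝ → Matrix (Fin 3) (Fin 2) ℝ
  M : ℝ → Matrix (Fin 2) (Fin 2) ℝ
  S_cont : Continuous S
  B_cont : Continuous B
  M_cont : Continuous M
  bound : ℝ
  S_le : ∀ t, ‖S t‖ ≤ bound
  B_le : ∀ t, ‖B t‖ ≤ bound
  M_le : ∀ t, ‖M t‖ ≤ bound
  S_symm : ∀ t, (S t)ᵀ = S t
  exc_nonneg : ∀ t (w : Vec3), 0 ≤ w ⬝ᵥ excitation (S t) *ᵥ w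
  δ : ℝ
  T : ℝ
  δ_pos : 0 < δ
  T_pos : 0 < T
  excited : ∀ t, 0 ≤ t → ∀ w : Vec3,
    δ * (w ⬝ᵥ w) ≤ ∫ τ in t..(t + T), w ⬝ᵥ excitation (S τ) *ᵥ w
  κM : ℝ
  κM_pos : 0 < κM
  coercive : ∀ t (n : Fin 2 → ℝ), κM * (n ⬝ᵥ n) ≤ n ⬝ᵥ M t *ᵥ n

namespace ErrorData

variable (D : ErrorData)

/-- The coefficient of the matrix Riccati equation for the attitude error. -/
def G (t : ℝ) (V : Matrix (Fin 3) (Fin 2) ℝ) : Matrix (Fin 3) (Fin 3) ℝ := D.S t - D.B t * Vᵀ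

/-- `V` solves the translation error equation on `[t₀, ∞)`. -/
def IsTra (t₀ : ℝ) (V : ℝ → Matrix (Fin 3) (Fin 2) ℝ) : Prop :=
  ∀ t, t₀ ≤ t → HasDerivWithinAt V (-(V t * D.M t)) (Ici t₀) t

/-- `R` solves the attitude error equation on `[t₀, ∞)`. -/
def IsRot (t₀ : ℝ) (V : ℝ → Matrix (Fin 3) (Fin 2) ℝ) (R : ℝ → Matrix (Fin 3) (Fin 3) ℝ) : Prop :=
  ∀ t, t₀ ≤ t → HasDerivWithinAt R
    ((4 : ℝ) • ((D.G t (V t))ᵀ - R t * D.G t (V t) * R t)) (Ici t₀) t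

/-- `x` solves, on `[t₀, ∞)`, the linear quaternion equation lifting the attitude error equation. -/
def IsLift (t₀ : ℝ) (V : ℝ → Matrix (Fin 3) (Fin 2) ℝ) (x : ℝ → Fin 4 → ℝ) : Prop :=
  ∀ t, t₀ ≤ t → HasDerivWithinAt x (quatGen (D.G t (V t)) *ᵥ x t) (Ici t₀) t

variable {D}

theorem bound_nonneg : 0 ≤ D.bound := (norm_nonneg _).trans (D.S_le 0)

theorem IsTra.sub {t₀ : ℝ} {V W : ℝ → Matrix (Fin 3) (Fin 2) ℝ} (hV : D.IsTra t₀ V)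
    (hW : D.IsTra t₀ W) : D.IsTra t₀ (fun t => V t - W t) := fun t ht =>
  ((hV t ht).fun_sub (hW t ht)).congr_deriv (by rw [Matrix.sub_mul]; abel)

theorem IsTra.norm_le {t₀ : ℝ} {V : ℝ → Matrix (Fin 3) (Fin 2) ℝ} (hV : D.IsTra t₀ V) {t : ℝ}
    (ht : t₀ ≤ t) : ‖V t‖ ≤ Real.exp (-D.κM * (t - t₀)) * ‖V t₀‖ := by
  have hd : ∀ t, t₀ ≤ t → HasDerivWithinAt (fun t => ‖V t‖ ^ 2)
      (∑ i, ∑ j, 2 * (V t i j * -(V t * D.M t) i j)) (Ici t₀) t := by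
    intro t ht
    simp only [frobenius_norm_sq]
    refine HasDerivWithinAt.fun_sum fun i _ => HasDerivWithinAt.fun_sum fun j _ => ?_
    have := (hasDerivWithinAt_matrix.1 (hV t ht) i j).fun_pow 2
    refine this.congr_deriv ?_
    simp only [Matrix.neg_apply]; ring
  have h := le_of_deriv_le_affine (η := 0) (c := 2 * D.κM) (by have := D.κM_pos; positivity) hd
    (fun t _ => ?_) ht
  · apply le_of_sq_le_sq _ (by positivity)
    refine h.trans (le_of_eq ?_)
    rw [mul_pow, ← Real.exp_nat_mul]
    simp; left; ring
  · have : ∀ i, D.κM * ∑ j, V t i j ^ 2 ≤ ∑ j, V t i j * (V t * D.M t) i j := by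
      intro i
      have h1 := D.coercive t (fun j => V t i j)
      simp only [dotProduct, mulVec, Fin.sum_univ_two, Matrix.mul_apply] at h1 ⊢
      linarith
    have h2 : D.κM * ∑ i, ∑ j, V t i j ^ 2 ≤ ∑ i, ∑ j, V t i j * (V t * D.M t) i j := by
      rw [Finset.mul_sum]; exact Finset.sum_le_sum fun i _ => this i
    have h3 : (∑ i, ∑ j, 2 * (V t i j * -(V t * D.M t) i j))
        = -2 * ∑ i, ∑ j, V t i j * (V t * D.M t) i j := by
      simp only [Finset.mul_sum]
      exact Finset.sum_congr rfl fun i _ => Finset.sum_congr rfl fun j _ => by ring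
    rw [h3, frobenius_norm_sq]
    linarith

theorem exists_isTra (D : ErrorData) (t₀ : ℝ) (V₀ : Matrix (Fin 3) (Fin 2) ℝ) :
    ∃ V, V t₀ = V₀ ∧ D.IsTra t₀ V := by
  obtain ⟨V, h0, hV⟩ := exists_solution_bilinear_ode
    (LinearMap.mk₂ ℝ (fun (M : Matrix (Fin 2) (Fin 2) ℝ) (V : Matrix (Fin 3) (Fin 2) ℝ) => -(V * M))
      (fun _ _ _ => by rw [Matrix.mul_add]; abel) (fun _ _ _ => by simp)
      (fun _ _ _ => by rw [Matrix.add_mul]; abel) (fun _ _ _ => by simp))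
    D.M_cont D.M_le t₀ V₀
  exact ⟨V, h0, fun t _ => (hV t).hasDerivWithinAt⟩

theorem quatGen_sub (F G : Matrix (Fin 3) (Fin 3) ℝ) : quatGen (F - G) = quatGen F - quatGen G := by
  ext i j
  fin_cases i <;> fin_cases j <;> simp [quatGen] <;> ring

theorem continuous_quatGen : Continuous quatGen := by
  refine continuous_matrix fun i j => ?_
  have h : ∀ i j, Continuous fun G : Matrix (Fin 3) (Fin 3) ℝ => G i j :=
    fun i j => continuous_id.matrix_elem i j
  have h1 := h 0 0; have h2 := h 0 1; have h3 := h 0 2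
  have h4 := h 1 0; have h5 := h 1 1; have h6 := h 1 2
  have h7 := h 2 0; have h8 := h 2 1; have h9 := h 2 2
  fin_cases i <;> fin_cases j <;> simp [quatGen] <;> fun_prop

theorem abs_quatGen_le (F : Matrix (Fin 3) (Fin 3) ℝ) (i j : Fin 4) : |quatGen F i j| ≤ 8 * ‖F‖ := by
  have h := fun i j => abs_le.1 (abs_entry_le_norm F i j)
  have h1 := h 0 0; have h2 := h 0 1; have h3 := h 0 2
  have h4 := h 1 0; have h5 := h 1 1; have h6 := h 1 2
  have h7 := h 2 0; have h8 := h 2 1; have h9 := h 2 2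
  rw [abs_le]
  fin_cases i <;> fin_cases j <;> simp [quatGen] <;> constructor <;> linarith [norm_nonneg F]

theorem norm_quatGen_mulVec_le (F : Matrix (Fin 3) (Fin 3) ℝ) (x : Fin 4 → ℝ) :
    ‖quatGen F *ᵥ x‖ ≤ 32 * ‖F‖ * ‖x‖ := by
  rw [pi_norm_le_iff_of_nonneg (by positivity)]
  intro i
  rw [Real.norm_eq_abs, mulVec, dotProduct]
  calc |∑ j, quatGen F i j * x j| ≤ ∑ j, |quatGen F i j * x j| := Finset.abs_sum_le_sum_abs _ _
    _ ≤ ∑ _j : Fin 4, 8 * ‖F‖ * ‖x‖ := by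
      refine Finset.sum_le_sum fun j _ => ?_
      rw [abs_mul]
      gcongr
      exacts [abs_quatGen_le F i j, norm_le_pi_norm x j]
    _ = _ := by simp; ring

theorem exists_isLift (D : ErrorData) {t₀ s : ℝ} {V : ℝ → Matrix (Fin 3) (Fin 2) ℝ}
    (hV : D.IsTra t₀ V) (x₀ : Fin 4 → ℝ) : ∃ x, x s = x₀ ∧ D.IsLift t₀ V x := by
  have hVc : ContinuousOn V (Ici t₀) := fun t ht => (hV t ht).continuousWithinAt
  have hmax : Continuous fun t => V (max t t₀) :=
    hVc.comp_continuous (by fun_prop) fun t => le_max_right t t₀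
  have hGc : Continuous fun t => D.G t (V (max t t₀)) :=
    D.S_cont.sub (D.B_cont.matrix_mul hmax.matrix_transpose)
  have hGb : ∀ t, ‖D.G t (V (max t t₀))‖ ≤ D.bound + D.bound * ‖V t₀‖ := by
    intro t
    refine (norm_sub_le _ _).trans (add_le_add (D.S_le t) ?_)
    refine (Matrix.frobenius_norm_mul _ _).trans ?_
    rw [Matrix.frobenius_norm_transpose]
    gcongr
    · exact bound_nonneg
    · exact D.B_le t
    · refine (hV.norm_le (le_max_right t t₀)).trans (mul_le_of_le_one_left (norm_nonneg _) ?_)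
      rw [Real.exp_le_one_iff]
      nlinarith [D.κM_pos, le_max_right t t₀]
  obtain ⟨x, h0, hx⟩ := exists_solution_bilinear_ode
    (LinearMap.mk₂ ℝ (fun (A : Matrix (Fin 4) (Fin 4) ℝ) (x : Fin 4 → ℝ) => A *ᵥ x)
      (fun _ _ _ => Matrix.add_mulVec _ _ _) (fun _ _ _ => Matrix.smul_mulVec _ _ _)
      (fun _ _ _ => Matrix.mulVec_add _ _ _) (fun _ _ _ => Matrix.mulVec_smul _ _ _))
    (continuous_quatGen.comp hGc) (K := 4 * 4 * (8 * (D.bound + D.bound * ‖V t₀‖)))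
    (fun t => by
      have h0 : 0 ≤ D.bound + D.bound * ‖V t₀‖ := (norm_nonneg _).trans (hGb t)
      have := norm_le_of_abs_entry_le (A := quatGen (D.G t (V (max t t₀))))
        (c := 8 * (D.bound + D.bound * ‖V t₀‖))
        (fun i j => (abs_quatGen_le _ i j).trans (by linarith [hGb t])) (by positivity)
      simpa using this) s x₀
  refine ⟨x, h0, fun t ht => ?_⟩
  have := (hx t).hasDerivWithinAt (s := Ici t₀)
  simpa [max_eq_left ht] using this

theorem IsLift.sub {t₀ : ℝ} {V W : ℝ → Matrix (Fin 3) (Fin 2) ℝ} {x y : ℝ → Fin 4 → ℝ}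
    (hx : D.IsLift t₀ V x) (hy : D.IsLift t₀ W y) (t : ℝ) (ht : t₀ ≤ t) :
    HasDerivWithinAt (fun t => x t - y t) (quatGen (D.S t) *ᵥ (x t - y t) +
      (-(quatGen (D.B t * (V t)ᵀ) *ᵥ (x t - y t))
        - quatGen (D.B t * (V t - W t)ᵀ) *ᵥ y t)) (Ici t₀) t := by
  refine ((hx t ht).fun_sub (hy t ht)).congr_deriv ?_
  have e : D.B t * (V t - W t)ᵀ = D.B t * (V t)ᵀ - D.B t * (W t)ᵀ := by
    rw [transpose_sub, Matrix.mul_sub]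
  rw [e]
  simp only [G, quatGen_sub, Matrix.sub_mulVec, Matrix.mulVec_sub]
  abel

/-- The imaginary part of a quaternion, as a Euclidean vector. -/
def imPart : (Fin 4 → ℝ) →L[ℝ] EuclideanSpace ℝ (Fin 3) :=
  LinearMap.toContinuousLinearMap
    { toFun := fun x => WithLp.toLp 2 fun i => x i.succ
      map_add' := fun _ _ => rfl
      map_smul' := fun _ _ => rfl }

theorem imPart_apply (x : Fin 4 → ℝ) : imPart x = WithLp.toLp 2 fun i => x i.succ := rfl

theorem norm_imPart_sq (x : Fin 4 → ℝ) : ‖imPart x‖ ^ 2 = imNormSq x := by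
  rw [imPart_apply, EuclideanSpace.norm_sq_eq]
  simp [Fin.sum_univ_three, imNormSq, sq]

theorem norm_imPart_le (x : Fin 4 → ℝ) : ‖imPart x‖ ≤ 2 * ‖x‖ := by
  apply le_of_sq_le_sq _ (by positivity)
  rw [norm_imPart_sq, imNormSq]
  have h : ∀ i, x i * x i ≤ ‖x‖ ^ 2 := fun i => by
    rw [← sq]; exact sq_le_sq.2 (by rw [abs_norm]; exact norm_le_pi_norm x i)
  nlinarith [h 1, h 2, h 3, norm_nonneg x]

theorem sq_norm_le_normSq (x : Fin 4 → ℝ) : ‖x‖ ^ 2 ≤ normSq x := by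
  have : ‖x‖ ≤ √(normSq x) := by
    rw [pi_norm_le_iff_of_nonneg (Real.sqrt_nonneg _)]
    exact fun i => Real.abs_le_sqrt (sq_le_normSq x i)
  calc ‖x‖ ^ 2 ≤ √(normSq x) ^ 2 := by gcongr
    _ = _ := Real.sq_sqrt (normSq_nonneg x)

theorem normSq_le_sq_norm (x : Fin 4 → ℝ) : normSq x ≤ 4 * ‖x‖ ^ 2 := by
  have h : ∀ i, x i * x i ≤ ‖x‖ ^ 2 := fun i => by
    rw [← sq]; exact sq_le_sq.2 (by rw [abs_norm]; exact norm_le_pi_norm x i)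
  rw [normSq]
  linarith [h 0, h 1, h 2, h 3]

/-- The excitation matrix as an operator. -/
def excOp (D : ErrorData) (t : ℝ) : EuclideanSpace ℝ (Fin 3) →L[ℝ] EuclideanSpace ℝ (Fin 3) :=
  Matrix.toEuclideanCLM (𝕜 := ℝ) (n := Fin 3) (excitation (D.S t))

theorem inner_excOp (D : ErrorData) (t : ℝ) (u w : EuclideanSpace ℝ (Fin 3)) :
    inner ℝ u (D.excOp t w) = u.ofLp ⬝ᵥ excitation (D.S t) *ᵥ w.ofLp := by
  rw [excOp, EuclideanSpace.inner_eq_star_dotProduct, ofLp_toEuclideanCLM]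
  simp [dotProduct_comm]

theorem excitation_transpose (D : ErrorData) (t : ℝ) :
    (excitation (D.S t))ᵀ = excitation (D.S t) := by
  rw [excitation, transpose_sub, transpose_smul, transpose_one, D.S_symm]

theorem excOp_symm (D : ErrorData) (t : ℝ) (u w : EuclideanSpace ℝ (Fin 3)) :
    inner ℝ (D.excOp t u) w = inner ℝ u (D.excOp t w) := by
  rw [real_inner_comm, inner_excOp, inner_excOp, dotProduct_mulVec, ← mulVec_transpose,
    excitation_transpose, dotProduct_comm]

theorem continuous_excOp (D : ErrorData) : Continuous D.excOp := by
  let Φ : Matrix (Fin 3) (Fin 3) ℝ →ₗ[ℝ]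
      (EuclideanSpace ℝ (Fin 3) →L[ℝ] EuclideanSpace ℝ (Fin 3)) :=
    (Matrix.toEuclideanCLM (𝕜 := ℝ) (n := Fin 3)).toAlgEquiv.toLinearMap
  have h1 : Continuous Φ := Φ.continuous_of_finiteDimensional
  have h2 : Continuous fun t => excitation (D.S t) := by
    unfold excitation
    exact (D.S_cont.matrix_trace.smul continuous_const).sub D.S_cont
  exact h1.comp h2

theorem exists_excOp_le (D : ErrorData) : ∃ p, ∀ t, ‖D.excOp t‖ ≤ p := by
  let Φ : Matrix (Fin 3) (Fin 3) ℝ →ₗ[ℝ]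
      (EuclideanSpace ℝ (Fin 3) →L[ℝ] EuclideanSpace ℝ (Fin 3)) :=
    (Matrix.toEuclideanCLM (𝕜 := ℝ) (n := Fin 3)).toAlgEquiv.toLinearMap ∘ₗ
      { toFun := excitation
        map_add' := fun A B => by simp only [excitation, trace_add, add_smul]; abel
        map_smul' := fun c A => by simp [excitation, smul_sub, smul_smul] }
  obtain ⟨C, hC0, hC⟩ := exists_linearMap_bound Φ
  exact ⟨C * D.bound, fun t => (hC (D.S t)).trans (by gcongr; exact D.S_le t)⟩

theorem imPart_quatGen_mulVec (D : ErrorData) (t : ℝ) (x : Fin 4 → ℝ) :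
    imPart (quatGen (D.S t) *ᵥ x) = -((4 : ℝ) • D.excOp t (imPart x)) := by
  have hs : ∀ i j, D.S t i j = D.S t j i := fun i j => congrFun (congrFun (D.S_symm t) j) i
  have h1 := hs 0 1; have h2 := hs 0 2; have h3 := hs 1 2
  ext i
  rw [imPart_apply, excOp]
  simp only [PiLp.neg_apply, PiLp.smul_apply, ofLp_toEuclideanCLM, imPart_apply]
  fin_cases i <;>
    simp [quatGen, excitation, mulVec, dotProduct, Fin.sum_univ_four, Fin.sum_univ_three,
      trace_fin_three, h1, h2, h3] <;> ring

theorem quatGen_mulVec_zero (D : ErrorData) (t : ℝ) (x : Fin 4 → ℝ) :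
    (quatGen (D.S t) *ᵥ x) 0 = 0 := by
  have hs : ∀ i j, D.S t i j = D.S t j i := fun i j => congrFun (congrFun (D.S_symm t) j) i
  have h1 := hs 0 1; have h2 := hs 0 2; have h3 := hs 1 2
  simp [quatGen, mulVec, dotProduct, Fin.sum_univ_four, h1, h2, h3]

end ErrorData

/-! ### Asymptotics of the quaternion equation -/

theorem sub_le_of_deriv_le_exp {f f' : ℝ → ℝ} {t₀ β κ : ℝ} (hκ : 0 < κ) (hβ : 0 ≤ β)
    (hf : ∀ t, t₀ ≤ t → HasDerivWithinAt f (f' t) (Ici t₀) t)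
    (h : ∀ t, t₀ ≤ t → f' t ≤ β * Real.exp (-κ * (t - t₀))) {s t : ℝ} (hs : t₀ ≤ s) (hst : s ≤ t) :
    f t - f s ≤ β / κ * Real.exp (-κ * (s - t₀)) := by
  have he : ∀ t, HasDerivAt (fun t => β / κ * Real.exp (-κ * (t - t₀)))
      (-(β * Real.exp (-κ * (t - t₀)))) t := by
    intro t
    have := ((((hasDerivAt_id t).sub_const t₀).const_mul (-κ)).exp).const_mul (β / κ)
    refine HasDerivAt.congr_deriv this ?_
    simp only [id]
    field_simp
  have hd : ∀ t, t₀ ≤ t → HasDerivWithinAt (fun t => f t + β / κ * Real.exp (-κ * (t - t₀)))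
      (f' t + -(β * Real.exp (-κ * (t - t₀)))) (Ici t₀) t :=
    fun t ht => (hf t ht).fun_add (he t).hasDerivWithinAt
  have hanti : AntitoneOn (fun t => f t + β / κ * Real.exp (-κ * (t - t₀))) (Ici t₀) := by
    apply antitoneOn_of_deriv_nonpos (convex_Ici t₀)
    · exact fun t ht => (hd t ht).continuousWithinAt
    · exact fun t ht => ((hd t (interior_subset ht)).mono interior_subset).differentiableWithinAt
    · intro t ht
      rw [interior_Ici] at ht
      have h1 := (hd t (le_of_lt ht)).hasDerivAt (Ici_mem_nhds ht)
      rw [h1.deriv]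
      linarith [h t (le_of_lt ht)]
  have h1 := hanti hs (hs.trans hst) hst
  simp only at h1
  have h2 : 0 ≤ β / κ * Real.exp (-κ * (t - t₀)) := by positivity
  linarith

namespace ErrorData

variable {D : ErrorData}

theorem hasDerivWithinAt_normSq {x : ℝ → Fin 4 → ℝ} {x' : Fin 4 → ℝ} {s : Set ℝ} {t : ℝ}
    (hx : HasDerivWithinAt x x' s t) :
    HasDerivWithinAt (fun t => normSq (x t)) (2 * (x t ⬝ᵥ x')) s t := by
  rw [hasDerivWithinAt_pi] at hx
  have h : ∀ i, HasDerivWithinAt (fun t => x t i * x t i) (x' i * x t i + x t i * x' i) s t :=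
    fun i => (hx i).fun_mul (hx i)
  refine ((((h 0).fun_add (h 1)).fun_add (h 2)).fun_add (h 3)).congr_deriv ?_
  simp only [dotProduct, Fin.sum_univ_four]; ring

theorem dotProduct_le (x y : Fin 4 → ℝ) : |x ⬝ᵥ y| ≤ 4 * (‖x‖ * ‖y‖) := by
  rw [dotProduct]
  calc |∑ i, x i * y i| ≤ ∑ i, |x i * y i| := Finset.abs_sum_le_sum_abs _ _
    _ ≤ ∑ _i : Fin 4, ‖x‖ * ‖y‖ := by
      refine Finset.sum_le_sum fun i _ => ?_
      rw [abs_mul]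
      gcongr
      exacts [norm_le_pi_norm x i, norm_le_pi_norm y i]
    _ = _ := by simp

theorem dotProduct_quatGen_nonpos (D : ErrorData) (t : ℝ) (x : Fin 4 → ℝ) :
    x ⬝ᵥ quatGen (D.S t) *ᵥ x ≤ 0 := by
  have h1 : ∀ y : Fin 4 → ℝ, x ⬝ᵥ y = x 0 * y 0 + inner ℝ (imPart x) (imPart y) := by
    intro y
    rw [dotProduct, Fin.sum_univ_succ, imPart_apply, imPart_apply,
      EuclideanSpace.inner_eq_star_dotProduct]
    simp [dotProduct, mul_comm]
  rw [h1, D.quatGen_mulVec_zero, D.imPart_quatGen_mulVec, inner_neg_right, real_inner_smul_right,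
    D.inner_excOp]
  have := D.exc_nonneg t (imPart x).ofLp
  linarith

/-- Growth factor of solutions of the quaternion equation under a perturbation of size
`v exp (-κ (t - t₀))`. -/
def growth (κ v : ℝ) : ℝ := 2 * Real.exp (4 * (v + 1) / κ)

theorem growth_pos (κ v : ℝ) : 0 < growth κ v := by unfold growth; positivity

theorem growth_mono {κ v w : ℝ} (hκ : 0 < κ) (h : v ≤ w) : growth κ v ≤ growth κ w := by
  unfold growth; gcongr

theorem continuous_growth (κ : ℝ) : Continuous (growth κ) := by unfold growth; fun_prop

/-- Decaying perturbations of the excited quaternion equation lead to bounded solutions: the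
unperturbed equation does not increase the norm, and the perturbation is integrable. -/
theorem norm_le_growth {κ v h t₀ : ℝ} (hκ : 0 < κ) (hv : 0 ≤ v) (hh : 0 ≤ h)
    {x φ : ℝ → Fin 4 → ℝ}
    (hx : ∀ t, t₀ ≤ t → HasDerivWithinAt x (quatGen (D.S t) *ᵥ x t + φ t) (Ici t₀) t)
    (hφ : ∀ t, t₀ ≤ t → ‖φ t‖ ≤ Real.exp (-κ * (t - t₀)) * (v * ‖x t‖ + h)) {t : ℝ}
    (ht : t₀ ≤ t) : ‖x t‖ ≤ growth κ v * (‖x t₀‖ + h) := by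
  have hA : ∀ t, HasDerivAt (fun t => -(8 * (v + 1) / κ) * Real.exp (-κ * (t - t₀)))
      (8 * (v + 1) * Real.exp (-κ * (t - t₀))) t := by
    intro t
    have := ((((hasDerivAt_id t).sub_const t₀).const_mul (-κ)).exp).const_mul (-(8 * (v + 1) / κ))
    refine HasDerivAt.congr_deriv this ?_
    simp only [id]
    field_simp
  have h1 := le_mul_exp_of_deriv_le_mul (f := fun t => normSq (x t) + h ^ 2)
    (fun t ht => (hasDerivWithinAt_normSq (hx t ht)).add_const _)
    (fun t _ => (hA t).hasDerivWithinAt) (fun t ht => ?_) ht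
  · have h2 : Real.exp (-(8 * (v + 1) / κ) * Real.exp (-κ * (t - t₀))
        - -(8 * (v + 1) / κ) * Real.exp (-κ * (t₀ - t₀))) ≤ Real.exp (8 * (v + 1) / κ) := by
      apply Real.exp_le_exp.2
      have : 0 ≤ 8 * (v + 1) / κ * Real.exp (-κ * (t - t₀)) := by positivity
      simp only [sub_self, mul_zero, Real.exp_zero]
      linarith
    have h3 := normSq_le_sq_norm (x t₀)
    have h4 := sq_norm_le_normSq (x t)
    have h0 := normSq_nonneg (x t₀)
    have e : Real.exp (8 * (v + 1) / κ) = Real.exp (4 * (v + 1) / κ) ^ 2 := by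
      rw [← Real.exp_nat_mul]; congr 1; push_cast; ring
    apply le_of_sq_le_sq _ (by have := growth_pos κ v; positivity)
    calc ‖x t‖ ^ 2 ≤ normSq (x t) + h ^ 2 := by linarith [sq_nonneg h]
      _ ≤ (normSq (x t₀) + h ^ 2) * Real.exp (8 * (v + 1) / κ) := h1.trans (by gcongr)
      _ ≤ (2 * (‖x t₀‖ + h)) ^ 2 * Real.exp (8 * (v + 1) / κ) := by
        gcongr
        nlinarith [mul_nonneg (norm_nonneg (x t₀)) hh]
      _ = _ := by rw [e, growth]; ring
  · have h1 := hφ t ht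
    have h2 := D.dotProduct_quatGen_nonpos t (x t)
    have h3 := (abs_le.1 (dotProduct_le (x t) (φ t))).2
    have h4 := sq_norm_le_normSq (x t)
    set e := Real.exp (-κ * (t - t₀)) with he
    have he0 : 0 < e := Real.exp_pos _
    rw [dotProduct_add]
    have h5 : ‖x t‖ * ‖φ t‖ ≤ e * ((v + 1) * (normSq (x t) + h ^ 2)) := by
      calc ‖x t‖ * ‖φ t‖ ≤ ‖x t‖ * (e * (v * ‖x t‖ + h)) := by gcongr
        _ = e * (v * ‖x t‖ ^ 2 + ‖x t‖ * h) := by ring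
        _ ≤ _ := by
          gcongr
          have : v * ‖x t‖ ^ 2 ≤ v * normSq (x t) := by gcongr
          nlinarith [sq_nonneg (‖x t‖ - h), mul_nonneg hv (sq_nonneg h)]
    linarith

/-- The rates with which the excited quaternion equation forgets the imaginary part of its initial
value and its real part converges, under a forcing bounded by `β exp (-κ (t - t₀))`. -/
def Decay (D : ErrorData) (κ C : ℝ) : Prop :=
  ∀ t₀, 0 ≤ t₀ → ∀ (x φ : ℝ → Fin 4 → ℝ) (β : ℝ), 0 ≤ β →
    (∀ t, t₀ ≤ t → HasDerivWithinAt x (quatGen (D.S t) *ᵥ x t + φ t) (Ici t₀) t) →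
    (∀ t, t₀ ≤ t → ‖φ t‖ ≤ β * Real.exp (-κ * (t - t₀))) →
    (∀ t, t₀ ≤ t → ‖imPart (x t)‖ ≤ C * Real.exp (-κ * (t - t₀)) * (‖imPart (x t₀)‖ + β)) ∧
    (∀ s t, t₀ ≤ s → s ≤ t → |x t 0 - x s 0| ≤ C * β * Real.exp (-κ * (s - t₀)))

theorem exists_decay (D : ErrorData) : ∃ κ C, 0 < κ ∧ κ ≤ D.κM ∧ 0 < C ∧ D.Decay κ C := by
  obtain ⟨p, hp⟩ := D.exists_excOp_le
  obtain ⟨κ, hκ, hκM, C, hC, h⟩ := exists_decay_of_excitation D.continuous_excOp D.excOp_symm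
    (fun t u => by rw [D.inner_excOp]; exact D.exc_nonneg t _) hp D.T_pos D.δ_pos
    (fun t ht u => by
      simp only [D.inner_excOp]
      refine (le_of_eq ?_).trans (D.excited t ht u.ofLp)
      rw [EuclideanSpace.norm_sq_eq]; simp [dotProduct, sq]) four_pos D.κM_pos
  refine ⟨κ, max (2 * C) (1 / κ), hκ, hκM, by positivity, ?_⟩
  intro t₀ ht₀ x φ β hβ hx hφ
  constructor
  · intro t ht
    have h1 := h t₀ ht₀ (fun t => imPart (x t)) (fun t => imPart (φ t)) (2 * β) (by positivity)
      (fun t ht => by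
        have := (imPart.hasFDerivAt (x := x t)).comp_hasDerivWithinAt t (hx t ht)
        refine HasDerivWithinAt.congr_deriv this ?_
        rw [map_add, D.imPart_quatGen_mulVec])
      (fun t ht => by
        have := norm_imPart_le (φ t)
        have := hφ t ht
        linarith) t ht
    refine h1.trans ?_
    have h2 : 0 ≤ Real.exp (-κ * (t - t₀)) * (‖imPart (x t₀)‖ + β) := by positivity
    calc _ ≤ C * Real.exp (-κ * (t - t₀)) * (2 * (‖imPart (x t₀)‖ + β)) := by
          gcongr; linarith [norm_nonneg (imPart (x t₀))]
      _ = (2 * C) * (Real.exp (-κ * (t - t₀)) * (‖imPart (x t₀)‖ + β)) := by ring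
      _ ≤ max (2 * C) (1 / κ) * (Real.exp (-κ * (t - t₀)) * (‖imPart (x t₀)‖ + β)) := by
        gcongr; exact le_max_left _ _
      _ = _ := by ring
  · intro s t hs hst
    have h0 : ∀ t, t₀ ≤ t → HasDerivWithinAt (fun t => x t 0) (φ t 0) (Ici t₀) t := by
      intro t ht
      have := hasDerivWithinAt_pi.1 (hx t ht) 0
      simpa [D.quatGen_mulVec_zero] using this
    have hb : ∀ t, t₀ ≤ t → |φ t 0| ≤ β * Real.exp (-κ * (t - t₀)) := fun t ht =>
      (norm_le_pi_norm (φ t) 0).trans (hφ t ht)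
    have h1 := sub_le_of_deriv_le_exp hκ hβ h0 (fun t ht => (abs_le.1 (hb t ht)).2) hs hst
    have h2 := sub_le_of_deriv_le_exp hκ hβ (fun t ht => (h0 t ht).fun_neg)
      (fun t ht => by linarith [(abs_le.1 (hb t ht)).1]) hs hst
    have h3 : β / κ * Real.exp (-κ * (s - t₀))
        ≤ max (2 * C) (1 / κ) * β * Real.exp (-κ * (s - t₀)) := by
      rw [div_eq_mul_one_div, mul_comm β]; gcongr; exact le_max_right _ _
    rw [abs_le]
    constructor <;> linarith

theorem norm_perturbation_le {κ t₀ : ℝ} (hκ : κ ≤ D.κM)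
    {V : ℝ → Matrix (Fin 3) (Fin 2) ℝ} (hV : D.IsTra t₀ V) {t : ℝ} (ht : t₀ ≤ t)
    (y : Fin 4 → ℝ) : ‖quatGen (D.B t * (V t)ᵀ) *ᵥ y‖
      ≤ Real.exp (-κ * (t - t₀)) * (32 * D.bound * ‖V t₀‖ * ‖y‖) := by
  have hb : 0 ≤ D.bound := bound_nonneg
  have h1 : ‖D.B t * (V t)ᵀ‖ ≤ D.bound * (Real.exp (-κ * (t - t₀)) * ‖V t₀‖) := by
    refine (Matrix.frobenius_norm_mul _ _).trans ?_
    rw [Matrix.frobenius_norm_transpose]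
    gcongr
    · exact D.B_le t
    · refine (hV.norm_le ht).trans ?_
      gcongr
  calc _ ≤ 32 * ‖D.B t * (V t)ᵀ‖ * ‖y‖ := norm_quatGen_mulVec_le _ _
    _ ≤ 32 * (D.bound * (Real.exp (-κ * (t - t₀)) * ‖V t₀‖)) * ‖y‖ := by gcongr
    _ = _ := by ring

section lift

variable {κ C t₀ : ℝ} {V W : ℝ → Matrix (Fin 3) (Fin 2) ℝ} {x y : ℝ → Fin 4 → ℝ}

theorem IsLift.hasDerivWithinAt_add (hx : D.IsLift t₀ V x) {t : ℝ} (ht : t₀ ≤ t) :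
    HasDerivWithinAt x (quatGen (D.S t) *ᵥ x t + -(quatGen (D.B t * (V t)ᵀ) *ᵥ x t)) (Ici t₀) t := by
  refine (hx t ht).congr_deriv ?_
  simp only [G, quatGen_sub, Matrix.sub_mulVec]
  abel

theorem IsLift.norm_le (hκ : 0 < κ) (hκM : κ ≤ D.κM) (hV : D.IsTra t₀ V) (hx : D.IsLift t₀ V x)
    {t : ℝ} (ht : t₀ ≤ t) : ‖x t‖ ≤ growth κ (32 * D.bound * ‖V t₀‖) * ‖x t₀‖ := by
  have hb : 0 ≤ D.bound := bound_nonneg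
  have := norm_le_growth (v := 32 * D.bound * ‖V t₀‖) (h := 0) hκ (by positivity) le_rfl
    (fun t ht => hx.hasDerivWithinAt_add ht)
    (fun t ht => by
      rw [norm_neg, add_zero]
      exact norm_perturbation_le hκM hV ht _) ht
  simpa using this

theorem IsLift.decay (hκ : 0 < κ) (hκM : κ ≤ D.κM) (hD : D.Decay κ C) (ht₀ : 0 ≤ t₀)
    (hV : D.IsTra t₀ V) (hx : D.IsLift t₀ V x) :
    let β := 32 * D.bound * ‖V t₀‖ * (growth κ (32 * D.bound * ‖V t₀‖) * ‖x t₀‖)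
    (∀ t, t₀ ≤ t → ‖imPart (x t)‖ ≤ C * Real.exp (-κ * (t - t₀)) * (‖imPart (x t₀)‖ + β)) ∧
    (∀ s t, t₀ ≤ s → s ≤ t → |x t 0 - x s 0| ≤ C * β * Real.exp (-κ * (s - t₀))) := by
  intro β
  have hb : 0 ≤ D.bound := bound_nonneg
  have hg := (growth_pos κ (32 * D.bound * ‖V t₀‖)).le
  refine hD t₀ ht₀ x _ β (by positivity) (fun t ht => hx.hasDerivWithinAt_add ht) fun t ht => ?_
  rw [norm_neg, mul_comm β]
  refine (norm_perturbation_le hκM hV ht _).trans ?_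
  gcongr
  exact mul_le_mul_of_nonneg_left (hx.norm_le hκ hκM hV ht) (by positivity)

/-- Continuous dependence on the initial value, uniformly in time. -/
theorem IsLift.norm_sub_le (hκ : 0 < κ) (hκM : κ ≤ D.κM)
    (hV : D.IsTra t₀ V) (hW : D.IsTra t₀ W) (hx : D.IsLift t₀ V x) (hy : D.IsLift t₀ W y)
    {t : ℝ} (ht : t₀ ≤ t) :
    ‖x t - y t‖ ≤ growth κ (32 * D.bound * ‖V t₀‖) * (‖x t₀ - y t₀‖ +
      32 * D.bound * ‖V t₀ - W t₀‖ * (growth κ (32 * D.bound * ‖W t₀‖) * ‖y t₀‖)) := by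
  have hb : 0 ≤ D.bound := bound_nonneg
  have hg := (growth_pos κ (32 * D.bound * ‖W t₀‖)).le
  refine norm_le_growth (x := fun t => x t - y t) (v := 32 * D.bound * ‖V t₀‖) hκ (by positivity)
    (by positivity) (fun t ht => hx.sub hy t ht) (fun t ht => ?_) ht
  refine (_root_.norm_sub_le _ _).trans ?_
  rw [norm_neg, mul_add]
  refine add_le_add (norm_perturbation_le hκM hV ht _) ?_
  refine (norm_perturbation_le hκM (hV.sub hW) ht _).trans ?_
  gcongr
  exact hy.norm_le hκ hκM hW ht

theorem IsLift.exists_tendsto (ht₀ : 0 ≤ t₀) (hV : D.IsTra t₀ V) (hx : D.IsLift t₀ V x) :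
    ∃ ℓ, Tendsto (fun t => x t 0) atTop (𝓝 ℓ) := by
  obtain ⟨κ, C, hκ, hκM, hC, hD⟩ := D.exists_decay
  have h := (hx.decay hκ hκM hD ht₀ hV).2
  set β := 32 * D.bound * ‖V t₀‖ * (growth κ (32 * D.bound * ‖V t₀‖) * ‖x t₀‖)
  have hc : CauchySeq fun t => x (max t t₀) 0 := by
    refine cauchySeq_of_le_tendsto_0 (fun N => 2 * (C * β * Real.exp (-κ * (max N t₀ - t₀)))) ?_ ?_
    · intro n m N hn hm
      have h1 := h (max N t₀) (max n t₀) (le_max_right _ _) (max_le_max_right _ hn)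
      have h2 := h (max N t₀) (max m t₀) (le_max_right _ _) (max_le_max_right _ hm)
      rw [Real.dist_eq]
      rw [abs_le] at *
      constructor <;> linarith
    · have h1 : Tendsto (fun N : ℝ => κ * (max N t₀ - t₀)) atTop atTop := by
        apply Tendsto.const_mul_atTop hκ
        apply tendsto_atTop_add_const_right
        exact tendsto_atTop_mono (fun N => le_max_left N t₀) tendsto_id
      have h2 := (Real.tendsto_exp_neg_atTop_nhds_zero.comp h1).const_mul (2 * (C * β))
      simp only [mul_zero] at h2
      refine h2.congr fun N => ?_
      simp only [Function.comp, neg_mul]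
      ring
  obtain ⟨ℓ, hℓ⟩ := cauchySeq_tendsto_of_complete hc
  refine ⟨ℓ, hℓ.congr' ?_⟩
  filter_upwards [eventually_ge_atTop t₀] with t ht
  rw [max_eq_left ht]

theorem tendsto_exp_neg_mul_sub {κ : ℝ} (hκ : 0 < κ) (t₀ : ℝ) :
    Tendsto (fun t => Real.exp (-κ * (t - t₀))) atTop (𝓝 0) := by
  have h1 : Tendsto (fun t : ℝ => κ * (t - t₀)) atTop atTop :=
    Tendsto.const_mul_atTop hκ (tendsto_atTop_add_const_right _ _ tendsto_id)
  refine (Real.tendsto_exp_neg_atTop_nhds_zero.comp h1).congr fun t => ?_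
  simp [Function.comp]

theorem IsTra.tendsto_zero (hV : D.IsTra t₀ V) : Tendsto V atTop (𝓝 0) := by
  have h := (tendsto_exp_neg_mul_sub D.κM_pos t₀).mul_const ‖V t₀‖
  rw [zero_mul] at h
  refine squeeze_zero_norm' ?_ h
  filter_upwards [eventually_ge_atTop t₀] with t ht using hV.norm_le ht

theorem IsLift.imPart_tendsto_zero (ht₀ : 0 ≤ t₀) (hV : D.IsTra t₀ V) (hx : D.IsLift t₀ V x) :
    Tendsto (fun t => imPart (x t)) atTop (𝓝 0) := by
  obtain ⟨κ, C, hκ, hκM, hC, hD⟩ := D.exists_decay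
  have h := (hx.decay hκ hκM hD ht₀ hV).1
  have h2 := ((tendsto_exp_neg_mul_sub hκ t₀).const_mul C).mul_const (‖imPart (x t₀)‖ +
    32 * D.bound * ‖V t₀‖ * (growth κ (32 * D.bound * ‖V t₀‖) * ‖x t₀‖))
  rw [mul_zero, zero_mul] at h2
  refine squeeze_zero_norm' ?_ h2
  filter_upwards [eventually_ge_atTop t₀] with t ht using h t ht

/-- If the real part of the quaternion does not tend to zero, the rotation tends to the identity. -/
theorem IsLift.quatRot_tendsto_one (ht₀ : 0 ≤ t₀) (hV : D.IsTra t₀ V) (hx : D.IsLift t₀ V x)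
    {ℓ : ℝ} (hℓ : Tendsto (fun t => x t 0) atTop (𝓝 ℓ)) (h0 : ℓ ≠ 0) :
    Tendsto (fun t => quatRot (x t)) atTop (𝓝 1) := by
  have him : Tendsto (fun t => imNormSq (x t)) atTop (𝓝 0) := by
    have := ((hx.imPart_tendsto_zero ht₀ hV).norm).pow 2
    simpa [norm_imPart_sq] using this
  have hn : Tendsto (fun t => normSq (x t)) atTop (𝓝 (ℓ * ℓ)) := by
    have := (hℓ.mul hℓ).add him
    simpa [normSq_eq] using this
  have h1 : Tendsto (fun t => 8 * imNormSq (x t) / normSq (x t)) atTop (𝓝 0) := by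
    have := (him.const_mul 8).div hn (mul_ne_zero h0 h0)
    rw [mul_zero, zero_div] at this
    exact this
  have h2 : Tendsto (fun t => ‖quatRot (x t) - 1‖) atTop (𝓝 0) := by
    have h3 := h1.sqrt
    rw [Real.sqrt_zero] at h3
    refine h3.congr' ?_
    filter_upwards [hℓ.eventually_ne h0] with t ht
    have hx0 : x t ≠ 0 := fun h => ht (by rw [h]; rfl)
    rw [← norm_quatRot_sub_one_sq hx0, Real.sqrt_sq (norm_nonneg _)]
  exact tendsto_iff_norm_sub_tendsto_zero.2 h2

end lift

end ErrorData

/-! ### Lifting attitude errors to quaternions -/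

namespace ErrorData

variable {D : ErrorData} {t₀ : ℝ} {V : ℝ → Matrix (Fin 3) (Fin 2) ℝ} {x : ℝ → Fin 4 → ℝ}

theorem IsTra.norm_G_le (hV : D.IsTra t₀ V) {t : ℝ} (ht : t₀ ≤ t) :
    ‖D.G t (V t)‖ ≤ D.bound + D.bound * ‖V t₀‖ := by
  have hb : 0 ≤ D.bound := bound_nonneg
  refine (_root_.norm_sub_le _ _).trans (add_le_add (D.S_le t) ?_)
  refine (Matrix.frobenius_norm_mul _ _).trans ?_
  rw [Matrix.frobenius_norm_transpose]
  gcongr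
  · exact D.B_le t
  · refine (hV.norm_le ht).trans (mul_le_of_le_one_left (norm_nonneg _) ?_)
    rw [Real.exp_le_one_iff]
    nlinarith [D.κM_pos]

/-- A solution of the linear quaternion equation does not reach zero in finite time. -/
theorem IsLift.ne_zero (hV : D.IsTra t₀ V) (hx : D.IsLift t₀ V x) (h0 : x t₀ ≠ 0) {t : ℝ}
    (ht : t₀ ≤ t) : x t ≠ 0 := by
  set K := 8 * (32 * (D.bound + D.bound * ‖V t₀‖)) with hK
  have h1 := le_mul_exp_of_deriv_le_mul (f := fun t => -normSq (x t)) (a := fun _ => -K)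
    (A := fun s => -K * s) (t₀ := t₀)
    (fun t ht => (hasDerivWithinAt_normSq (hx t ht)).fun_neg)
    (fun t _ => by simpa using ((hasDerivAt_id t).const_mul (-K)).hasDerivWithinAt)
    (fun t ht => ?_) ht
  · intro h
    have h2 := normSq_pos h0
    rw [h] at h1
    simp only [normSq, Pi.zero_apply, mul_zero, add_zero, neg_zero] at h1
    have := mul_pos h2 (Real.exp_pos (-K * t - -K * t₀))
    simp only [normSq] at this
    linarith
  · have h2 := (abs_le.1 (dotProduct_le (x t) (quatGen (D.G t (V t)) *ᵥ x t))).1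
    have h3 := norm_quatGen_mulVec_le (D.G t (V t)) (x t)
    have h4 := hV.norm_G_le ht
    have h5 : ‖x t‖ * ‖quatGen (D.G t (V t)) *ᵥ x t‖
        ≤ ‖x t‖ * (32 * (D.bound + D.bound * ‖V t₀‖) * ‖x t‖) := by
      gcongr
      exact h3.trans (by gcongr)
    have h6 : ‖x t‖ * (32 * (D.bound + D.bound * ‖V t₀‖) * ‖x t‖)
        ≤ 32 * (D.bound + D.bound * ‖V t₀‖) * normSq (x t) := by
      have := sq_norm_le_normSq (x t)
      have h7 : 0 ≤ D.bound + D.bound * ‖V t₀‖ := (norm_nonneg _).trans h4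
      calc _ = 32 * (D.bound + D.bound * ‖V t₀‖) * ‖x t‖ ^ 2 := by ring
        _ ≤ _ := by gcongr
    simp only [hK]
    linarith

theorem IsLift.isRot (hV : D.IsTra t₀ V) (hx : D.IsLift t₀ V x) (h0 : x t₀ ≠ 0) :
    D.IsRot t₀ V (fun t => quatRot (x t)) := fun t ht =>
  hasDerivWithinAt_quatRot (hx t ht) (hx.ne_zero hV h0 ht)

/-- The Riccati equation has a unique solution among rotations, on which the vector field is
Lipschitz. -/
theorem IsRot.unique {R R' : ℝ → Matrix (Fin 3) (Fin 3) ℝ} (hV : D.IsTra t₀ V)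
    (hR : D.IsRot t₀ V R) (hR' : D.IsRot t₀ V R')
    (hm : ∀ t, t₀ ≤ t → R t ∈ specialOrthogonalGroup (Fin 3) ℝ)
    (hm' : ∀ t, t₀ ≤ t → R' t ∈ specialOrthogonalGroup (Fin 3) ℝ) (h0 : R t₀ = R' t₀) {t : ℝ}
    (ht : t₀ ≤ t) : R t = R' t := by
  have hd : ∀ t, t₀ ≤ t → HasDerivWithinAt (fun t => R t - R' t)
      (-((4 : ℝ) • ((R t - R' t) * D.G t (V t) * R t + R' t * D.G t (V t) * (R t - R' t))))
      (Ici t₀) t := fun t ht => ((hR t ht).fun_sub (hR' t ht)).congr_deriv (by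
    rw [← smul_sub, ← smul_neg]; congr 1
    simp only [Matrix.sub_mul, Matrix.mul_sub]; abel)
  have := eq_zero_of_abs_deriv_le_mul_abs_self_of_eq_zero_right (a := t₀) (b := t)
    (f := fun t => R t - R' t) (K := 72 * (D.bound + D.bound * ‖V t₀‖))
    (fun s hs => ((hd s hs.1).mono Icc_subset_Ici_self).continuousWithinAt)
    (fun s hs => (hd s hs.1).mono (Ici_subset_Ici.2 hs.1)) (sub_eq_zero.2 h0)
    (fun s hs => ?_) t (right_mem_Icc.2 ht)
  · exact sub_eq_zero.1 this
  · have hG := hV.norm_G_le hs.1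
    have hG0 : 0 ≤ D.bound + D.bound * ‖V t₀‖ := (norm_nonneg _).trans hG
    have h1 := norm_le_of_mem_SO3 (hm s hs.1)
    have h2 := norm_le_of_mem_SO3 (hm' s hs.1)
    rw [norm_neg, norm_smul, Real.norm_of_nonneg (by norm_num : (0:ℝ) ≤ 4)]
    have h3 : ‖(R s - R' s) * D.G s (V s) * R s‖
        ≤ ‖R s - R' s‖ * (D.bound + D.bound * ‖V t₀‖) * 9 :=
      (Matrix.frobenius_norm_mul _ _).trans (mul_le_mul ((Matrix.frobenius_norm_mul _ _).trans
        (by gcongr)) h1 (norm_nonneg _) (by positivity))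
    have h4 : ‖R' s * D.G s (V s) * (R s - R' s)‖
        ≤ 9 * (D.bound + D.bound * ‖V t₀‖) * ‖R s - R' s‖ :=
      (Matrix.frobenius_norm_mul _ _).trans (mul_le_mul ((Matrix.frobenius_norm_mul _ _).trans
        (by gcongr)) le_rfl (norm_nonneg _) (by positivity))
    have h5 := norm_add_le ((R s - R' s) * D.G s (V s) * R s) (R' s * D.G s (V s) * (R s - R' s))
    linarith

variable (D) in
/-- `(R, V)` is a solution of the error equations in `SO(3) × ℝ^{3×2}` on `[t₀, ∞)`. -/
structure IsErr (t₀ : ℝ) (R : ℝ → Matrix (Fin 3) (Fin 3) ℝ)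
    (V : ℝ → Matrix (Fin 3) (Fin 2) ℝ) : Prop where
  tra : D.IsTra t₀ V
  rot : D.IsRot t₀ V R
  mem : ∀ t, t₀ ≤ t → R t ∈ specialOrthogonalGroup (Fin 3) ℝ

/-- Every attitude error trajectory lifts to a solution of the linear quaternion equation. -/
theorem IsErr.exists_lift {R : ℝ → Matrix (Fin 3) (Fin 3) ℝ} (h : D.IsErr t₀ R V)
    {x₀ : Fin 4 → ℝ} (hx₀ : x₀ ≠ 0) (hR : quatRot x₀ = R t₀) :
    ∃ x, x t₀ = x₀ ∧ D.IsLift t₀ V x ∧ ∀ t, t₀ ≤ t → x t ≠ 0 ∧ R t = quatRot (x t) := by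
  obtain ⟨x, h0, hx⟩ := D.exists_isLift (s := t₀) h.tra x₀
  have hne : x t₀ ≠ 0 := by rwa [h0]
  refine ⟨x, h0, hx, fun t ht => ⟨hx.ne_zero h.tra hne ht, ?_⟩⟩
  exact h.rot.unique h.tra (hx.isRot h.tra hne) h.mem
    (fun t ht => quatRot_mem (hx.ne_zero h.tra hne ht)) (by rw [h0, hR]) ht

theorem exists_isErr (D : ErrorData) (t₀ : ℝ) {R₀ : Matrix (Fin 3) (Fin 3) ℝ}
    (hR : R₀ ∈ specialOrthogonalGroup (Fin 3) ℝ) (V₀ : Matrix (Fin 3) (Fin 2) ℝ) :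
    ∃ R V, D.IsErr t₀ R V ∧ R t₀ = R₀ ∧ V t₀ = V₀ := by
  obtain ⟨V, hV0, hV⟩ := D.exists_isTra t₀ V₀
  obtain ⟨x₀, hx₀, hq⟩ := exists_quatRot_eq hR
  obtain ⟨x, h0, hx⟩ := D.exists_isLift (s := t₀) hV x₀
  have hne : x t₀ ≠ 0 := by rwa [h0]
  exact ⟨fun t => quatRot (x t), V, ⟨hV, hx.isRot hV hne, fun t ht =>
    quatRot_mem (hx.ne_zero hV hne ht)⟩, by simp only [h0, hq], hV0⟩

/-- Local exponential stability of the attitude error, with the translation error as an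
exponentially decaying input. -/
theorem exists_local_decay (D : ErrorData) : ∃ r > 0, ∃ C > 0, ∃ κ > 0, κ ≤ D.κM ∧ ∀ t₀, 0 ≤ t₀ →
    ∀ R V, D.IsErr t₀ R V → ‖R t₀ - 1‖ + ‖V t₀‖ < r → ∀ t, t₀ ≤ t →
      ‖R t - 1‖ ≤ C * Real.exp (-κ * (t - t₀)) * (‖R t₀ - 1‖ + ‖V t₀‖) := by
  obtain ⟨κ, C, hκ, hκM, hC, hD⟩ := D.exists_decay
  have hb : 0 ≤ D.bound := bound_nonneg
  set b := 32 * D.bound with hbdef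
  set g := growth κ b with hg
  have hg0 : 0 < g := growth_pos _ _
  refine ⟨1 / (1 + 4 * C * b * g), by positivity, 6 * C * (1 + 2 * b * g), by positivity, κ, hκ,
    hκM, ?_⟩
  intro t₀ ht₀ R V h hr t ht
  set ρ := ‖R t₀ - 1‖ + ‖V t₀‖ with hρ
  have hρ0 : 0 ≤ ρ := by positivity
  have hρ1 : ρ * (1 + 4 * C * b * g) < 1 := by rwa [lt_div_iff₀ (by positivity)] at hr
  have hρ2 : 0 ≤ ρ * (4 * C * b * g) := by positivity
  have hRρ : ‖R t₀ - 1‖ ≤ ρ := by linarith [norm_nonneg (V t₀)]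
  have hVρ : ‖V t₀‖ ≤ ρ := by linarith [norm_nonneg (R t₀ - 1)]
  obtain ⟨y, hy, hyR⟩ := exists_quatRot_eq (h.mem t₀ le_rfl)
  have hn := norm_quatRot_sub_one_sq hy
  rw [hyR, eq_div_iff (normSq_pos hy).ne'] at hn
  have hRsq : ‖R t₀ - 1‖ ^ 2 < 1 := by nlinarith [norm_nonneg (R t₀ - 1)]
  have hy0 : y 0 ≠ 0 := by
    intro h0
    have h1 := normSq_eq y
    rw [h0, zero_mul, zero_add] at h1
    have := normSq_pos hy
    rw [← h1] at hn
    nlinarith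
  -- normalise the quaternion to have real part one
  set x₀ := (y 0)⁻¹ • y with hx₀
  have hx00 : x₀ 0 = 1 := by simp [hx₀, hy0]
  have hx₀ne : x₀ ≠ 0 := fun h => by rw [h] at hx00; simp at hx00
  have hx₀R : quatRot x₀ = R t₀ := by rw [hx₀, quatRot_smul (inv_ne_zero hy0), hyR]
  have hn := norm_quatRot_sub_one_sq hx₀ne
  rw [hx₀R, eq_div_iff (normSq_pos hx₀ne).ne', normSq_eq, hx00] at hn
  have him0 := imNormSq_nonneg x₀
  have him : imNormSq x₀ ≤ ‖R t₀ - 1‖ ^ 2 := by nlinarith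
  have hxn : ‖x₀‖ ≤ 2 := by
    have h1 := sq_norm_le_normSq x₀
    rw [normSq_eq, hx00] at h1
    nlinarith [norm_nonneg x₀]
  obtain ⟨x, hx0, hx, hxR⟩ := h.exists_lift hx₀ne hx₀R
  obtain ⟨h1, h2⟩ := hx.decay hκ hκM hD ht₀ h.tra
  rw [hx0, ← hbdef] at h1 h2
  have hβ : b * ‖V t₀‖ * (growth κ (b * ‖V t₀‖) * ‖x₀‖) ≤ ρ * (2 * b * g) := by
    have h3 : growth κ (b * ‖V t₀‖) ≤ g := growth_mono hκ (by
      have : ‖V t₀‖ ≤ 1 := by linarith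
      calc b * ‖V t₀‖ ≤ b * 1 := by gcongr
        _ = b := mul_one b)
    have := (growth_pos κ (b * ‖V t₀‖)).le
    calc _ ≤ b * ρ * (g * 2) := by gcongr
      _ = _ := by ring
  have hx1 : 1 / 2 ≤ x t 0 := by
    have h3 := h2 t₀ t le_rfl ht
    rw [hx0, hx00, sub_self, mul_zero, Real.exp_zero, mul_one] at h3
    have h4 := (abs_le.1 h3).1
    have h5 : C * (b * ‖V t₀‖ * (growth κ (b * ‖V t₀‖) * ‖x₀‖)) ≤ C * (ρ * (2 * b * g)) := by gcongr
    linarith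
  have himx : ‖imPart x₀‖ ≤ ρ := by
    refine le_trans ?_ hRρ
    apply le_of_sq_le_sq _ (norm_nonneg _)
    rw [norm_imPart_sq]; exact him
  have himt : ‖imPart (x t)‖ ≤ C * Real.exp (-κ * (t - t₀)) * (ρ * (1 + 2 * b * g)) := by
    refine (h1 t ht).trans ?_
    gcongr
    linarith
  obtain ⟨hxt, hRt⟩ := hxR t ht
  have hfin : ‖R t - 1‖ ≤ 6 * ‖imPart (x t)‖ := by
    apply le_of_sq_le_sq _ (by positivity)
    rw [hRt, norm_quatRot_sub_one_sq hxt, mul_pow, norm_imPart_sq, div_le_iff₀ (normSq_pos hxt)]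
    have h3 := imNormSq_nonneg (x t)
    have h4 : 1 / 4 ≤ normSq (x t) := by rw [normSq_eq]; nlinarith
    nlinarith
  calc _ ≤ 6 * (C * Real.exp (-κ * (t - t₀)) * (ρ * (1 + 2 * b * g))) :=
        hfin.trans (by gcongr)
    _ = _ := by ring

/-! ### The limit of the real part -/

/-- The limit `L V₀ x₀` of the real part of the quaternion, as a function of the initial values: it
is continuous, and linear in the quaternion. The linear form `L V₀` is nonzero for every translation
error `V₀`, and for `V₀ = 0`, when the real part is conserved, it is the real part itself. -/
theorem exists_limit_functional (D : ErrorData) (ht₀ : 0 ≤ t₀) :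
    ∃ L : Matrix (Fin 3) (Fin 2) ℝ → (Fin 4 → ℝ) →ₗ[ℝ] ℝ,
      (∀ V x, D.IsTra t₀ V → D.IsLift t₀ V x →
        Tendsto (fun t => x t 0) atTop (𝓝 (L (V t₀) (x t₀)))) ∧
      (Continuous fun p : Matrix (Fin 3) (Fin 2) ℝ × (Fin 4 → ℝ) => L p.1 p.2) ∧
      (∀ V₀, L V₀ ≠ 0) ∧ ∀ x₀, L 0 x₀ = x₀ 0 := by
  obtain ⟨κ, C, hκ, hκM, hC, hD⟩ := D.exists_decay
  have hb : 0 ≤ D.bound := bound_nonneg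
  choose v hv0 hv using fun V₀ => D.exists_isTra t₀ V₀
  choose q hq0 hq using fun V₀ x₀ => D.exists_isLift (s := t₀) (hv V₀) x₀
  choose L hL using fun V₀ x₀ => (hq V₀ x₀).exists_tendsto ht₀ (hv V₀)
  have hlim : ∀ V x, D.IsTra t₀ V → D.IsLift t₀ V x →
      Tendsto (fun t => x t 0) atTop (𝓝 (L (V t₀) (x t₀))) := by
    intro V x hV hx
    refine (hL (V t₀) (x t₀)).congr' ?_
    filter_upwards [eventually_ge_atTop t₀] with t ht
    have := (hq (V t₀) (x t₀)).norm_sub_le hκ hκM (hv (V t₀)) hV hx ht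
    rw [hv0, hq0, sub_self, sub_self, norm_zero, norm_zero, mul_zero, zero_mul, add_zero,
      mul_zero] at this
    have h2 := norm_le_zero_iff.1 this
    exact congrFun (sub_eq_zero.1 h2) 0
  have hadd : ∀ V₀ x₀ y₀, L V₀ (x₀ + y₀) = L V₀ x₀ + L V₀ y₀ := by
    intro V₀ x₀ y₀
    have h1 : D.IsLift t₀ (v V₀) (fun t => q V₀ x₀ t + q V₀ y₀ t) := fun t ht =>
      ((hq V₀ x₀ t ht).fun_add (hq V₀ y₀ t ht)).congr_deriv (Matrix.mulVec_add _ _ _).symm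
    have h2 := hlim _ _ (hv V₀) h1
    rw [hv0, hq0, hq0] at h2
    exact tendsto_nhds_unique h2 ((hL V₀ x₀).add (hL V₀ y₀))
  have hsmul : ∀ V₀ (c : ℝ) x₀, L V₀ (c • x₀) = c * L V₀ x₀ := by
    intro V₀ c x₀
    have h1 : D.IsLift t₀ (v V₀) (fun t => c • q V₀ x₀ t) := fun t ht =>
      ((hq V₀ x₀ t ht).fun_const_smul c).congr_deriv (Matrix.mulVec_smul _ _ _).symm
    have h2 := hlim _ _ (hv V₀) h1
    rw [hv0, hq0] at h2
    exact tendsto_nhds_unique h2 ((hL V₀ x₀).const_mul c)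
  refine ⟨fun V₀ => { toFun := L V₀, map_add' := hadd V₀, map_smul' := hsmul V₀ }, hlim, ?_, ?_, ?_⟩
  · rw [continuous_iff_continuousAt]
    rintro ⟨W₀, y₀⟩
    have hle : ∀ p : Matrix (Fin 3) (Fin 2) ℝ × (Fin 4 → ℝ), ‖L p.1 p.2 - L W₀ y₀‖ ≤
        growth κ (32 * D.bound * ‖p.1‖) * (‖p.2 - y₀‖ +
          32 * D.bound * ‖p.1 - W₀‖ * (growth κ (32 * D.bound * ‖W₀‖) * ‖y₀‖)) := by
      intro p
      refine le_of_tendsto ((hL p.1 p.2).sub (hL W₀ y₀)).norm ?_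
      filter_upwards [eventually_ge_atTop t₀] with t ht
      have := (hq p.1 p.2).norm_sub_le hκ hκM (hv p.1) (hv W₀) (hq W₀ y₀) ht
      rw [hv0, hv0, hq0, hq0] at this
      exact (norm_le_pi_norm (q p.1 p.2 t - q W₀ y₀ t) 0).trans this
    have hc : Continuous fun p : Matrix (Fin 3) (Fin 2) ℝ × (Fin 4 → ℝ) =>
        growth κ (32 * D.bound * ‖p.1‖) * (‖p.2 - y₀‖ +
          32 * D.bound * ‖p.1 - W₀‖ * (growth κ (32 * D.bound * ‖W₀‖) * ‖y₀‖)) := by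
      have h1 : Continuous fun p : Matrix (Fin 3) (Fin 2) ℝ × (Fin 4 → ℝ) => ‖p.1‖ :=
        continuous_norm.comp continuous_fst
      have h2 : Continuous fun p : Matrix (Fin 3) (Fin 2) ℝ × (Fin 4 → ℝ) => ‖p.1 - W₀‖ :=
        continuous_norm.comp (continuous_fst.sub continuous_const)
      have h3 := (continuous_growth κ).comp
        (continuous_const.mul h1 (X := _) (M := ℝ) (f := fun _ => 32 * D.bound))
      exact h3.mul (((continuous_snd.sub continuous_const).norm).add
        ((continuous_const.mul h2).mul continuous_const))
    have hc0 := hc.tendsto (W₀, y₀)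
    simp only [sub_self, norm_zero, mul_zero, zero_mul, add_zero] at hc0
    exact tendsto_iff_norm_sub_tendsto_zero.2 (squeeze_zero (fun _ => norm_nonneg _) hle hc0)
  · -- the solution equal to `(1, 0)` at a late time `T` has a real part that stays near `1`
    intro V₀ hzero
    have hlimV := (hv V₀).tendsto_zero
    set b := 32 * D.bound with hbdef
    have h1 : Tendsto (fun T => C * (b * ‖v V₀ T‖ * (growth κ (b * ‖v V₀ T‖)
        * ‖(![1, 0, 0, 0] : Fin 4 → ℝ)‖))) atTop (𝓝 0) := by
      have h2 := (tendsto_zero_iff_norm_tendsto_zero.1 hlimV).const_mul b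
      rw [mul_zero] at h2
      have h3 := ((continuous_growth κ).tendsto 0).comp h2
      have h4 := (h2.mul (h3.mul_const ‖(![1, 0, 0, 0] : Fin 4 → ℝ)‖)).const_mul C
      simpa using h4
    obtain ⟨T, hT, hTt⟩ := ((h1.eventually (gt_mem_nhds (by norm_num : (0:ℝ) < 1 / 2))).and
      (eventually_ge_atTop t₀)).exists
    obtain ⟨x, hx0, hx⟩ := D.exists_isLift (s := T) (hv V₀) ![1, 0, 0, 0]
    have hx' : D.IsLift T (v V₀) x := fun t ht =>
      (hx t (hTt.trans ht)).mono (Ici_subset_Ici.2 hTt)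
    have hv' : D.IsTra T (v V₀) := fun t ht =>
      (hv V₀ t (hTt.trans ht)).mono (Ici_subset_Ici.2 hTt)
    have h2 := (hx'.decay hκ hκM hD (ht₀.trans hTt) hv').2 T
    have h3 := hlim _ _ (hv V₀) hx
    have h4 : L (v V₀ t₀) (x t₀) = 0 := by
      rw [hv0]; exact LinearMap.congr_fun hzero (x t₀)
    rw [h4] at h3
    have h5 : (1 / 2 : ℝ) ≤ 0 := by
      refine ge_of_tendsto h3 ?_
      filter_upwards [eventually_ge_atTop T] with t ht
      have h6 := h2 t le_rfl ht
      rw [sub_self, mul_zero, Real.exp_zero, mul_one, hx0, ← hbdef] at h6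
      have h7 := (abs_le.1 h6).1
      simp only [cons_val_zero] at h7
      linarith
    norm_num at h5
  · intro x₀
    have h0 : ∀ t, t₀ ≤ t → v 0 t = 0 := fun t ht => by
      have := (hv 0).norm_le ht
      rw [hv0, norm_zero, mul_zero] at this
      exact norm_le_zero_iff.1 this
    refine tendsto_nhds_unique (hL 0 x₀) ?_
    refine (tendsto_const_nhds (x := x₀ 0)).congr' ?_
    filter_upwards [eventually_ge_atTop t₀] with t ht
    have := ((hq 0 x₀).decay hκ hκM hD ht₀ (hv 0)).2 t₀ t le_rfl ht
    rw [hv0, norm_zero, mul_zero, zero_mul, mul_zero, zero_mul, hq0] at this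
    linarith [abs_nonpos_iff.1 this]

end ErrorData

/-! ### Null sets of `SE₂(3)` -/

/-- Locally Lipschitz maps send Lebesgue null sets of `ℝⁿ` to `n`-dimensional Hausdorff null sets. -/
theorem hausdorffMeasure_image_eq_zero {ι Y : Type*} [Fintype ι] [MetricSpace Y]
    [MeasurableSpace Y] [BorelSpace Y] {f : (ι → ℝ) → Y} (hf : LocallyLipschitz f)
    {N : Set (ι → ℝ)} (hN : volume N = 0) {d : ℝ} (hd : d = Fintype.card ι) :
    μH[d] (f '' N) = 0 := by
  choose K t ht hK using hf
  obtain ⟨s, hs, hcov⟩ := TopologicalSpace.countable_cover_nhds ht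
  have hsub : f '' N ⊆ ⋃ x ∈ s, f '' (N ∩ t x) := by
    rintro _ ⟨p, hp, rfl⟩
    have : p ∈ ⋃ x ∈ s, t x := hcov ▸ mem_univ p
    simp only [mem_iUnion] at this ⊢
    obtain ⟨x, hx, hpx⟩ := this
    exact ⟨x, hx, mem_image_of_mem f ⟨hp, hpx⟩⟩
  refine measure_mono_null hsub ((measure_biUnion_null_iff hs).2 fun x _ => ?_)
  have h1 := ((hK x).mono (inter_subset_right (s := N))).hausdorffMeasure_image_le (d := d)
    (hd ▸ Nat.cast_nonneg _)
  have h2 : μH[d] (N ∩ t x) = 0 := by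
    rw [hd, hausdorffMeasure_pi_real]
    exact measure_mono_null inter_subset_left hN
  rw [h2, mul_zero] at h1
  exact le_antisymm h1 bot_le

/-- In each affine chart `x i = 1`, the zero set of a nonzero linear form is null. -/
theorem volume_chart_hyperplane {ℓ : (Fin 4 → ℝ) →ₗ[ℝ] ℝ} (hℓ : ℓ ≠ 0) (i : Fin 4) :
    volume {θ : Fin 3 → ℝ | ℓ (i.insertNth (1 : ℝ) θ : Fin 4 → ℝ) = 0} = 0 := by
  let s : AffineSubspace ℝ (Fin 3 → ℝ) :=
    { carrier := {θ : Fin 3 → ℝ | ℓ (i.insertNth (1 : ℝ) θ : Fin 4 → ℝ) = 0}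
      smul_vsub_vadd_mem' := by
        intro c p₁ p₂ p₃ h₁ h₂ h₃
        have e : (i.insertNth (1 : ℝ) (c • (p₁ -ᵥ p₂) +ᵥ p₃) : Fin 4 → ℝ) =
            c • ((i.insertNth (1 : ℝ) p₁ : Fin 4 → ℝ) - i.insertNth (1 : ℝ) p₂)
              + i.insertNth (1 : ℝ) p₃ := by
          funext j
          revert j
          rw [Fin.forall_iff_succAbove i]
          simp
        simp only [mem_ofPred_eq] at h₁ h₂ h₃ ⊢
        rw [e, map_add, map_smul, map_sub, h₁, h₂, h₃]
        simp }
  refine Measure.addHaar_affineSubspace volume s fun hs => hℓ ?_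
  have hall : ∀ θ : Fin 3 → ℝ, ℓ (i.insertNth (1 : ℝ) θ : Fin 4 → ℝ) = 0 := fun θ => by
    have : θ ∈ s := hs ▸ AffineSubspace.mem_top ℝ _ θ
    exact this
  refine LinearMap.ext fun x => ?_
  have e : x = (i.insertNth (1 : ℝ) (fun k => x (i.succAbove k)) : Fin 4 → ℝ)
      - i.insertNth (1 : ℝ) 0 + x i • i.insertNth (1 : ℝ) 0 := by
    funext j
    revert j
    rw [Fin.forall_iff_succAbove i]
    simp
  rw [e, map_add, map_sub, map_smul, hall, hall]
  simp

/-- The affine chart `x i = 1` of the quaternions, together with the translation part, as a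
parametrisation of a part of `SE₂(3)` by `ℝ⁹`. -/
def chart (i : Fin 4) (p : (Fin 3 × Fin 2) ⊕ Fin 3 → ℝ) : Mat5 :=
  fromBlocks (quatRot (i.insertNth (1 : ℝ) fun k => p (Sum.inr k)))
    (Matrix.of fun a b => p (Sum.inl (a, b))) 0 1

theorem contDiff_insertNth (i : Fin 4) (j : Fin 4) :
    ContDiff ℝ 1 fun p : (Fin 3 × Fin 2) ⊕ Fin 3 → ℝ =>
      (i.insertNth (1 : ℝ) (fun k => p (Sum.inr k)) : Fin 4 → ℝ) j := by
  revert j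
  rw [Fin.forall_iff_succAbove i]
  simp only [Fin.insertNth_apply_same, Fin.insertNth_apply_succAbove]
  exact ⟨contDiff_const, fun k => contDiff_apply _ _ _⟩

theorem locallyLipschitz_entries_chart (i : Fin 4) :
    LocallyLipschitz fun p => entries (chart i p) := by
  apply ContDiff.locallyLipschitz (𝕂 := ℝ)
  rw [contDiff_euclidean]
  have hx := contDiff_insertNth i
  have h0 := hx 0; have h1 := hx 1; have h2 := hx 2; have h3 := hx 3
  have hn : ContDiff ℝ 1 fun p : (Fin 3 × Fin 2) ⊕ Fin 3 → ℝ =>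
      (normSq (i.insertNth (1 : ℝ) fun k => p (Sum.inr k)))⁻¹ := by
    refine ContDiff.inv ?_ fun p => ?_
    · unfold normSq; fun_prop
    · have := sq_le_normSq (i.insertNth (1 : ℝ) fun k => p (Sum.inr k)) i
      rw [Fin.insertNth_apply_same] at this
      intro h
      linarith
  rintro ⟨a | a, b | b⟩
  · have hq : ContDiff ℝ 1 fun p : (Fin 3 × Fin 2) ⊕ Fin 3 → ℝ =>
        quatMat (i.insertNth (1 : ℝ) fun k => p (Sum.inr k)) a b := by
      fin_cases a <;> fin_cases b <;> simp only [quatMat] <;> simp <;> fun_prop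
    exact hn.mul hq
  · exact contDiff_apply ℝ ℝ _
  · exact contDiff_const
  · exact contDiff_const

/-- If for every translation part the quaternions of the rotation part are confined to a hyperplane
that depends continuously on the translation part, the errors form a null set. -/
theorem nullInSE23_of_linear_forms {L : Matrix (Fin 3) (Fin 2) ℝ → (Fin 4 → ℝ) →ₗ[ℝ] ℝ}
    (hc : Continuous fun p : Matrix (Fin 3) (Fin 2) ℝ × (Fin 4 → ℝ) => L p.1 p.2)
    (hL : ∀ V, L V ≠ 0) :
    NullInSE23 {E | ∃ x, x ≠ 0 ∧ ∃ V, L V x = 0 ∧ E = fromBlocks (quatRot x) V 0 1} := by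
  set N : Fin 4 → Set ((Fin 3 × Fin 2) ⊕ Fin 3 → ℝ) := fun i =>
    {p | L (Matrix.of fun a b => p (Sum.inl (a, b)))
      (i.insertNth (1 : ℝ) fun k => p (Sum.inr k)) = 0} with hN
  have hN0 : ∀ i, volume (N i) = 0 := by
    intro i
    let e := MeasurableEquiv.sumPiEquivProdPi (fun _ : (Fin 3 × Fin 2) ⊕ Fin 3 => ℝ)
    let N' : Set ((Fin 3 × Fin 2 → ℝ) × (Fin 3 → ℝ)) := {p | L (Matrix.of fun a b => p.1 (a, b))
      (i.insertNth (1 : ℝ) p.2) = 0}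
    have hcl : IsClosed N' := by
      refine isClosed_eq (hc.comp (Continuous.prodMk ?_ ?_)) continuous_const
      · exact continuous_matrix fun a b => (continuous_apply (a, b)).comp continuous_fst
      · suffices h : ∀ j, Continuous fun p : (Fin 3 × Fin 2 → ℝ) × (Fin 3 → ℝ) =>
            (i.insertNth (1 : ℝ) p.2 : Fin 4 → ℝ) j from continuous_pi h
        rw [Fin.forall_iff_succAbove i]
        simp only [Fin.insertNth_apply_same, Fin.insertNth_apply_succAbove]
        exact ⟨continuous_const, fun k => (continuous_apply k).comp continuous_snd⟩
    have hpre : N i = e ⁻¹' N' := rfl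
    rw [hpre, (volume_measurePreserving_sumPiEquivProdPi _).measure_preimage_equiv]
    refine (Measure.measure_prod_null hcl.measurableSet).2 (Eventually.of_forall fun v => ?_)
    exact volume_chart_hyperplane (hL (Matrix.of fun a b => v (a, b))) i
  have hsub : entries '' {E | ∃ x, x ≠ 0 ∧ ∃ V, L V x = 0 ∧ E = fromBlocks (quatRot x) V 0 1} ⊆
      ⋃ i, (fun p => entries (chart i p)) '' N i := by
    rintro _ ⟨_, ⟨x, hx, V, hLx, rfl⟩, rfl⟩
    obtain ⟨i, hi⟩ := Function.ne_iff.1 hx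
    have hi : x i ≠ 0 := hi
    have hins : (i.insertNth (1 : ℝ) (fun k => (x i)⁻¹ * x (i.succAbove k)) : Fin 4 → ℝ)
        = (x i)⁻¹ • x := by
      funext j
      revert j
      rw [Fin.forall_iff_succAbove i]
      simp [hi]
    refine mem_iUnion.2 ⟨i, Sum.elim (fun ab => V ab.1 ab.2) (fun k => (x i)⁻¹ * x (i.succAbove k)),
      ?_, ?_⟩
    · simp only [hN, mem_ofPred_eq, Sum.elim_inl, Sum.elim_inr, hins, map_smul, smul_eq_mul]
      exact mul_eq_zero_of_right _ hLx
    · simp only [chart, Sum.elim_inl, Sum.elim_inr, hins, quatRot_smul (inv_ne_zero hi)]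
      rfl
  refine measure_mono_null hsub (measure_iUnion_null fun i => ?_)
  exact hausdorffMeasure_image_eq_zero (locallyLipschitz_entries_chart i) (hN0 i) (by simp)

/-! ### A matrix Riccati equation in dimension two -/

theorem exists_quadratic_form_lower_bound {α β γ : ℝ} (hα : 0 < α) (hγ : 0 < γ)
    (hK : 0 < α * γ - β ^ 2) :
    ∃ k > 0, ∀ u v : ℝ, k * (u ^ 2 + v ^ 2) ≤ α * u ^ 2 + 2 * β * u * v + γ * v ^ 2 := by
  refine ⟨(α * γ - β ^ 2) / (α + γ), by positivity, fun u v => ?_⟩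
  rw [div_mul_eq_mul_div, div_le_iff₀ (by positivity)]
  nlinarith [sq_nonneg (α * u + β * v), sq_nonneg (β * u + γ * v)]

set_option maxHeartbeats 1000000 in
/-- Bounds for the `2 × 2` matrix Riccati equation `Q' = S_D Q + Q S_Dᵀ - Q K Q + diag(kv, kp)`,
written in the entries `x, y, z` of `Q` and `α, β, γ` of `K`: the trace is bounded above and the
determinant is bounded away from zero. Only `kp` is positive; the coupling `-z` in the equation of
`y`, an observability property, keeps the matrix away from the degenerate ones. -/
theorem exists_riccati_bounds {x y z : ℝ → ℝ} {α β γ kv kp : ℝ} (hα : 0 < α) (hγ : 0 < γ)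
    (hK : 0 < α * γ - β ^ 2) (hkv : 0 ≤ kv) (hkp : 0 < kp)
    (hx : ∀ t, 0 ≤ t → HasDerivWithinAt x
      (-2 * y t - (α * x t ^ 2 + 2 * β * x t * y t + γ * y t ^ 2) + kv) (Ici 0) t)
    (hy : ∀ t, 0 ≤ t → HasDerivWithinAt y
      (-z t - (α * x t * y t + β * (x t * z t + y t ^ 2) + γ * y t * z t)) (Ici 0) t)
    (hz : ∀ t, 0 ≤ t → HasDerivWithinAt z
      (-(α * y t ^ 2 + 2 * β * y t * z t + γ * z t ^ 2) + kp) (Ici 0) t)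
    (hx0 : ∀ t, 0 ≤ t → 0 < x t) (hz0 : ∀ t, 0 ≤ t → 0 < z t)
    (hd0 : ∀ t, 0 ≤ t → 0 < x t * z t - y t ^ 2) :
    ∃ b d, 0 < d ∧ ∀ t, 0 ≤ t → x t + z t ≤ b ∧ d ≤ x t * z t - y t ^ 2 := by
  -- the trace
  obtain ⟨k, hk, hkK⟩ := exists_quadratic_form_lower_bound hα hγ hK
  have htr : ∀ t, 0 ≤ t → -2 * y t - (α * x t ^ 2 + 2 * β * x t * y t + γ * y t ^ 2) + kv
      + (-(α * y t ^ 2 + 2 * β * y t * z t + γ * z t ^ 2) + kp) ≤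
      -1 * (x t + z t) + (2 / k + kv + kp) := by
    intro t _
    have h1 := hkK (x t) (y t)
    have h2 := hkK (y t) (z t)
    have h3 : ∀ u : ℝ, u ≤ k * u ^ 2 + (4 * k)⁻¹ := fun u => by
      have : k * u ^ 2 + (4 * k)⁻¹ - u = k * (u - (2 * k)⁻¹) ^ 2 := by field_simp; ring
      nlinarith [mul_nonneg hk.le (sq_nonneg (u - (2 * k)⁻¹))]
    have h4 := h3 (x t); have h5 := h3 (z t); have h6 := h3 (-y t)
    have h7 : (2 / k) = 8 * (4 * k)⁻¹ := by field_simp; norm_num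
    have h8 : 0 < (4 * k)⁻¹ := by positivity
    linarith
  obtain ⟨b, hb⟩ : ∃ b, ∀ t, 0 ≤ t → x t + z t ≤ b :=
    ⟨_, fun t ht => le_max_of_deriv_le_affine one_pos (fun t ht => (hx t ht).fun_add (hz t ht))
      htr ht⟩
  have hb0 : 0 < b := by linarith [hb 0 le_rfl, hx0 0 le_rfl, hz0 0 le_rfl]
  have hxb : ∀ t, 0 ≤ t → x t ≤ b := fun t ht => by linarith [hb t ht, hz0 t ht]
  have hzb : ∀ t, 0 ≤ t → z t ≤ b := fun t ht => by linarith [hb t ht, hx0 t ht]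
  have hyb : ∀ t, 0 ≤ t → |y t| ≤ b := fun t ht => abs_le_of_sq_le_sq (by
    nlinarith [hd0 t ht, hxb t ht, hzb t ht, hx0 t ht, hz0 t ht]) hb0.le
  set c : ℝ := (α + 2 * |β| + γ) * b with hc
  have hc0 : 0 < c := by positivity
  have hβ0 : 0 ≤ |β| := abs_nonneg β
  have hβy : ∀ t, 0 ≤ t → |β * y t| ≤ |β| * b := fun t ht => by
    rw [abs_mul]; exact mul_le_mul_of_nonneg_left (hyb t ht) hβ0
  -- the lower right entry
  obtain ⟨z₁, hz₁, hzl⟩ : ∃ z₁ > 0, ∀ t, 0 ≤ t → z₁ ≤ z t := by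
    refine ⟨min (z 0) (kp / c), lt_min (hz0 0 le_rfl) (by positivity), fun t ht => ?_⟩
    refine min_le_of_affine_le_deriv hc0 hz (fun t ht => ?_) ht
    have h1 := abs_le.1 (hβy t ht)
    have h2 := hz0 t ht; have h3 := hx0 t ht; have h4 := hd0 t ht
    have h5 : α * y t ^ 2 ≤ α * b * z t := by
      rw [mul_assoc]
      exact mul_le_mul_of_nonneg_left (by nlinarith [hxb t ht]) hα.le
    have h6 : β * y t * z t ≤ |β| * b * z t := mul_le_mul_of_nonneg_right h1.2 h2.le
    have h7 : γ * z t ^ 2 ≤ γ * b * z t := by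
      rw [mul_assoc]
      exact mul_le_mul_of_nonneg_left (by nlinarith [hzb t ht]) hγ.le
    rw [hc]; linarith
  -- the determinant
  have hd : ∀ t, 0 ≤ t → HasDerivWithinAt (fun t => x t * z t - y t ^ 2)
      (-(x t * z t - y t ^ 2) * (α * x t + 2 * β * y t + γ * z t) + kv * z t + kp * x t)
      (Ici 0) t := fun t ht =>
    (((hx t ht).fun_mul (hz t ht)).fun_sub ((hy t ht).fun_pow 2)).congr_deriv (by
      simp; ring)
  have hdl : ∀ t, 0 ≤ t → -c * (x t * z t - y t ^ 2) + kp * x t ≤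
      -(x t * z t - y t ^ 2) * (α * x t + 2 * β * y t + γ * z t) + kv * z t + kp * x t := by
    intro t ht
    have h1 := abs_le.1 (hβy t ht)
    have h2 : α * x t + 2 * β * y t + γ * z t ≤ c := by
      have := mul_le_mul_of_nonneg_left (hxb t ht) hα.le
      have := mul_le_mul_of_nonneg_left (hzb t ht) hγ.le
      rw [hc]; linarith
    have := mul_le_mul_of_nonneg_left h2 (hd0 t ht).le
    have := mul_nonneg hkv (hz0 t ht).le
    linarith
  -- `det Q - l y` obeys an affine differential inequality with a positive source, for small `l`
  obtain ⟨l, hl, hl1, hl2⟩ : ∃ l > 0, l * (2 * c ^ 2 * b / z₁ + c) ≤ kp ∧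
      l * |y 0| < x 0 * z 0 - y 0 ^ 2 := by
    have hp : 0 < 2 * c ^ 2 * b / z₁ + c := by positivity
    have hq : 0 < |y 0| + 1 := by positivity
    have hd00 := hd0 0 le_rfl
    refine ⟨min (kp / (2 * c ^ 2 * b / z₁ + c)) ((x 0 * z 0 - y 0 ^ 2) / (|y 0| + 1)),
      lt_min (by positivity) (by positivity), ?_, ?_⟩
    · exact (mul_le_mul_of_nonneg_right (min_le_left _ _) hp.le).trans
        (div_mul_cancel₀ _ hp.ne').le
    · refine (mul_le_mul_of_nonneg_right (min_le_right _ _) (abs_nonneg _)).trans_lt ?_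
      rw [div_mul_eq_mul_div, div_lt_iff₀ hq]
      nlinarith
  obtain ⟨ω, hω, hwl⟩ : ∃ ω > 0, ∀ t, 0 ≤ t → ω ≤ x t * z t - y t ^ 2 - l * y t := by
    refine ⟨min (x 0 * z 0 - y 0 ^ 2 - l * y 0) (l * z₁ / 2 / c),
      lt_min ?_ (by positivity), fun t ht => ?_⟩
    · have := mul_le_mul_of_nonneg_left (le_abs_self (y 0)) hl.le
      linarith
    refine min_le_of_affine_le_deriv (f := fun t => x t * z t - y t ^ 2 - l * y t) hc0
      (fun t ht => (hd t ht).fun_sub ((hy t ht).const_mul l)) (fun t ht => ?_) ht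
    have h1 := hdl t ht
    have hx1 := hx0 t ht; have hz2 := hz0 t ht; have hd1 := hd0 t ht
    have hy0 := abs_nonneg (y t)
    have hyl := neg_abs_le (y t); have hyu := le_abs_self (y t)
    have h2 : y t ^ 2 ≤ b * x t := by nlinarith [hzb t ht]
    have h3 : -(c * |y t| + c * x t) ≤
        α * x t * y t + β * (x t * z t + y t ^ 2) + γ * y t * z t := by
      have e1 : -(α * b * |y t|) ≤ α * x t * y t := by
        have : x t * |y t| ≤ b * |y t| := mul_le_mul_of_nonneg_right (hxb t ht) hy0
        nlinarith [mul_le_mul_of_nonneg_left this hα.le,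
          mul_le_mul_of_nonneg_left hyl (mul_pos hα hx1).le]
      have e2 : -(γ * b * |y t|) ≤ γ * y t * z t := by
        have : z t * |y t| ≤ b * |y t| := mul_le_mul_of_nonneg_right (hzb t ht) hy0
        nlinarith [mul_le_mul_of_nonneg_left this hγ.le,
          mul_le_mul_of_nonneg_left hyl (mul_pos hγ hz2).le]
      have e3 : -(|β| * (2 * b * x t)) ≤ β * (x t * z t + y t ^ 2) := by
        have h5 : x t * z t + y t ^ 2 ≤ 2 * b * x t := by nlinarith [hzb t ht]
        have h6 : 0 ≤ x t * z t + y t ^ 2 := by positivity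
        nlinarith [neg_abs_le β]
      have e4 : 0 ≤ |β| * b * |y t| := by positivity
      have e5 : 0 ≤ (α + γ) * b * x t := by positivity
      rw [hc]; nlinarith
    have h4 : 2 * c * |y t| ≤ z₁ / 2 + 2 * c ^ 2 * b / z₁ * x t := by
      have e1 : 2 * c * |y t| ≤ z₁ / 2 + 2 * c ^ 2 * y t ^ 2 / z₁ := by
        have : z₁ / 2 + 2 * c ^ 2 * y t ^ 2 / z₁ - 2 * c * |y t|
            = (z₁ - 2 * c * |y t|) ^ 2 / (2 * z₁) := by
          rw [← sq_abs (y t)]; field_simp; ring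
        have : 0 ≤ (z₁ - 2 * c * |y t|) ^ 2 / (2 * z₁) := by positivity
        linarith
      have e2 : 2 * c ^ 2 * y t ^ 2 / z₁ ≤ 2 * c ^ 2 * b / z₁ * x t := by
        rw [div_mul_eq_mul_div]
        gcongr ?_ / _
        nlinarith [mul_le_mul_of_nonneg_left h2 (by positivity : 0 ≤ 2 * c ^ 2)]
      linarith
    have h5 : l * (2 * c * |y t| + c * x t) ≤ l * z₁ / 2 + kp * x t := by
      have := mul_le_mul_of_nonneg_right hl1 hx1.le
      have := mul_le_mul_of_nonneg_left h4 hl.le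
      linarith
    have h6 := mul_le_mul_of_nonneg_left h3 hl.le
    have h7 := mul_le_mul_of_nonneg_left (hzl t ht) hl.le
    have h8 := mul_le_mul_of_nonneg_left hyu (mul_pos hl hc0).le
    have h9 := mul_le_mul_of_nonneg_left hyl (mul_pos hl hc0).le
    linarith
  set η := min (ω / 2) (kp * (ω ^ 2 / (4 * l ^ 2 * b))) with hη
  have hη0 : 0 < η := lt_min (by positivity) (by positivity)
  refine ⟨b, min (x 0 * z 0 - y 0 ^ 2) (η / (c + 1)),
    lt_min (hd0 0 le_rfl) (by positivity), fun t ht => ⟨hb t ht, ?_⟩⟩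
  refine min_le_of_affine_le_deriv (f := fun t => x t * z t - y t ^ 2) (by positivity) hd
    (fun t ht => le_trans ?_ (hdl t ht)) ht
  have hx1 := hx0 t ht; have hd1 := hd0 t ht
  rcases le_or_gt (ω / 2) (x t * z t - y t ^ 2) with h | h
  · have : η ≤ ω / 2 := min_le_left _ _
    have := mul_pos hkp hx1
    linarith
  · have h1 : η ≤ kp * (ω ^ 2 / (4 * l ^ 2 * b)) := min_le_right _ _
    have h2 : ω / 2 ≤ -(l * y t) := by linarith [hwl t ht]
    have h3 : y t ^ 2 ≤ b * x t := by nlinarith [hzb t ht]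
    have h4 : ω ^ 2 / (4 * l ^ 2 * b) ≤ x t := by
      rw [div_le_iff₀ (by positivity)]
      nlinarith [mul_le_mul_of_nonneg_left h3 (sq_nonneg l)]
    have := mul_le_mul_of_nonneg_left h4 hkp.le
    linarith

/-! ### Bounded Lipschitz signals -/

/-- The signal `f` is bounded and Lipschitz on `[t₀, ∞)`. This is stronger than bounded and
uniformly continuous, and easier to propagate through products. -/
def BddLip {F : Type*} [SeminormedAddCommGroup F] (t₀ : ℝ) (f : ℝ → F) : Prop :=
  ∃ B, 0 ≤ B ∧ (∀ t, t₀ ≤ t → ‖f t‖ ≤ B) ∧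
    ∀ s, t₀ ≤ s → ∀ t, t₀ ≤ t → ‖f s - f t‖ ≤ B * |s - t|

namespace BddLip

variable {F : Type*} {t₀ : ℝ}

theorem of_bounds [SeminormedAddCommGroup F] {f : ℝ → F} {b c : ℝ}
    (hb : ∀ t, t₀ ≤ t → ‖f t‖ ≤ b)
    (hc : ∀ s, t₀ ≤ s → ∀ t, t₀ ≤ t → ‖f s - f t‖ ≤ c * |s - t|) : BddLip t₀ f :=
  ⟨max (max b c) 0, le_max_right _ _,
    fun t ht => (hb t ht).trans ((le_max_left _ _).trans (le_max_left _ _)),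
    fun s hs t ht => (hc s hs t ht).trans (mul_le_mul_of_nonneg_right
      ((le_max_right _ _).trans (le_max_left _ _)) (abs_nonneg _))⟩

theorem of_deriv [NormedAddCommGroup F] [NormedSpace ℝ F] {f f' : ℝ → F} {b c : ℝ}
    (hf : ∀ t, t₀ ≤ t → HasDerivWithinAt f (f' t) (Ici t₀) t)
    (hb : ∀ t, t₀ ≤ t → ‖f t‖ ≤ b) (hc : ∀ t, t₀ ≤ t → ‖f' t‖ ≤ c) : BddLip t₀ f :=
  of_bounds hb fun s hs t ht => by
    have := (convex_Ici t₀).norm_image_sub_le_of_norm_hasDerivWithin_le (f := f) hf hc ht hs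
    rwa [Real.norm_eq_abs] at this

variable [SeminormedAddCommGroup F] {f h : ℝ → F}

theorem congr (hf : BddLip t₀ f) (he : ∀ t, t₀ ≤ t → h t = f t) : BddLip t₀ h := by
  obtain ⟨b, hb, hf, hf'⟩ := hf
  exact ⟨b, hb, fun t ht => he t ht ▸ hf t ht, fun s hs t ht => he t ht ▸ he s hs ▸ hf' s hs t ht⟩

theorem mono (hf : BddLip t₀ f) {t₁ : ℝ} (ht : t₀ ≤ t₁) : BddLip t₁ f := by
  obtain ⟨b, hb, hf, hf'⟩ := hf
  exact ⟨b, hb, fun t h => hf t (ht.trans h), fun s hs t h => hf' s (ht.trans hs) t (ht.trans h)⟩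

theorem const (v : F) : BddLip t₀ fun _ => v :=
  of_bounds (b := ‖v‖) (c := 0) (fun _ _ => le_rfl) (by simp)

theorem add (hf : BddLip t₀ f) (hh : BddLip t₀ h) : BddLip t₀ fun t => f t + h t := by
  obtain ⟨b, hb, hf, hf'⟩ := hf
  obtain ⟨c, hc, hh, hh'⟩ := hh
  refine ⟨b + c, add_nonneg hb hc, fun t ht => norm_add_le_of_le (hf t ht) (hh t ht),
    fun s hs t ht => ?_⟩
  rw [add_sub_add_comm, add_mul]
  exact norm_add_le_of_le (hf' s hs t ht) (hh' s hs t ht)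

theorem neg (hf : BddLip t₀ f) : BddLip t₀ fun t => -f t := by
  obtain ⟨b, hb, hf, hf'⟩ := hf
  refine ⟨b, hb, fun t ht => by simpa using hf t ht, fun s hs t ht => ?_⟩
  rw [neg_sub_neg, norm_sub_rev]
  exact hf' s hs t ht

theorem sub (hf : BddLip t₀ f) (hh : BddLip t₀ h) : BddLip t₀ fun t => f t - h t :=
  (hf.add hh.neg).congr fun _ _ => sub_eq_add_neg _ _

theorem bddUnifCont {F : Type*} [NormedAddCommGroup F] {f : ℝ → F} (hf : BddLip t₀ f) :
    BddUnifCont t₀ f := by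
  obtain ⟨b, hb, hf, hf'⟩ := hf
  refine ⟨⟨b, hf⟩, LipschitzOnWith.uniformContinuousOn (K := ⟨b, hb⟩)
    (LipschitzOnWith.of_dist_le_mul fun s hs t ht => ?_)⟩
  rw [dist_eq_norm, Real.dist_eq]
  exact hf' s hs t ht

/-- A Lipschitz signal on `[0, ∞)`, frozen at negative times, is continuous. -/
theorem continuous_max (hf : BddLip 0 f) : Continuous fun t => f (max t 0) := by
  obtain ⟨b, hb, hf, hf'⟩ := hf
  refine LipschitzWith.continuous (K := ⟨b, hb⟩) (LipschitzWith.of_dist_le_mul fun s t => ?_)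
  rw [dist_eq_norm, Real.dist_eq]
  exact (hf' _ (le_max_right _ _) _ (le_max_right _ _)).trans
    (mul_le_mul_of_nonneg_left (by simpa using abs_max_sub_max_le_max s 0 t 0) hb)

theorem const_smul [NormedSpace ℝ F] (hf : BddLip t₀ f) (c : ℝ) : BddLip t₀ fun t => c • f t := by
  obtain ⟨b, hb, hf, hf'⟩ := hf
  refine ⟨‖c‖ * b, by positivity, fun t ht => ?_, fun s hs t ht => ?_⟩
  · rw [norm_smul]
    exact mul_le_mul_of_nonneg_left (hf t ht) (norm_nonneg _)
  · rw [← smul_sub, norm_smul, mul_assoc]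
    exact mul_le_mul_of_nonneg_left (hf' s hs t ht) (norm_nonneg _)

theorem mul {k l n : Type*} [Fintype k] [Fintype l] [Fintype n] {f : ℝ → Matrix k l ℝ}
    {h : ℝ → Matrix l n ℝ} (hf : BddLip t₀ f) (hh : BddLip t₀ h) :
    BddLip t₀ fun t => f t * h t := by
  obtain ⟨b, hb, hf, hf'⟩ := hf
  obtain ⟨c, hc, hh, hh'⟩ := hh
  refine of_bounds (b := b * c) (c := b * c + b * c) (fun t ht => ?_) (fun s hs t ht => ?_)
  · exact (Matrix.frobenius_norm_mul _ _).trans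
      (mul_le_mul (hf t ht) (hh t ht) (norm_nonneg _) hb)
  · have e : f s * h s - f t * h t = f s * (h s - h t) + (f s - f t) * h t := by
      rw [Matrix.mul_sub, Matrix.sub_mul]; abel
    rw [e, add_mul]
    refine norm_add_le_of_le ((Matrix.frobenius_norm_mul _ _).trans ?_)
      ((Matrix.frobenius_norm_mul _ _).trans ?_)
    · rw [mul_assoc]
      exact mul_le_mul (hf s hs) (hh' s hs t ht) (norm_nonneg _) hb
    · rw [mul_right_comm]
      exact mul_le_mul (hf' s hs t ht) (hh t ht) (norm_nonneg _)
        (mul_nonneg hb (abs_nonneg _))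

theorem transpose {k l : Type*} [Fintype k] [Fintype l] {f : ℝ → Matrix k l ℝ}
    (hf : BddLip t₀ f) : BddLip t₀ fun t => (f t)ᵀ := by
  obtain ⟨b, hb, hf, hf'⟩ := hf
  refine ⟨b, hb, fun t ht => ?_, fun s hs t ht => ?_⟩
  · rw [Matrix.frobenius_norm_transpose]; exact hf t ht
  · rw [← Matrix.transpose_sub, Matrix.frobenius_norm_transpose]; exact hf' s hs t ht

theorem of_skew {w : ℝ → Vec3} (hw : BddLip t₀ fun t => skew (w t)) : BddLip t₀ w := by
  have hn : ∀ v : Vec3, ‖v‖ ≤ ‖skew v‖ := fun v => by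
    refine (pi_norm_le_iff_of_nonneg (norm_nonneg _)).2 fun i => ?_
    rw [Real.norm_eq_abs]
    fin_cases i
    · simpa [skew] using abs_entry_le_norm (skew v) 2 1
    · simpa [skew] using abs_entry_le_norm (skew v) 0 2
    · simpa [skew] using abs_entry_le_norm (skew v) 1 0
  obtain ⟨b, hb, hf, hf'⟩ := hw
  refine ⟨b, hb, fun t ht => (hn _).trans (hf t ht), fun s hs t ht => ?_⟩
  refine (hn _).trans ?_
  have e : skew (w s - w t) = skew (w s) - skew (w t) := by
    ext i j; fin_cases i <;> fin_cases j <;> simp [skew] <;> ring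
  rw [e]; exact hf' s hs t ht

end BddLip

/-! ### The observer in the frame of the auxiliary state -/

/-- The gains `k_v, k_p` as a diagonal matrix. -/
def Gains.prop (K : Gains) : Matrix (Fin 2) (Fin 2) ℝ := !![K.kv, 0; 0, K.kp]

/-- The gains `k_d, k_c` as a diagonal matrix. -/
def Gains.corr (K : Gains) : Matrix (Fin 2) (Fin 2) ℝ := !![K.kd, 0; 0, K.kc]

theorem smul_vecMulVec_add (a b : ℝ) :
    a • vecMulVec Cp Cp + b • vecMulVec Cv Cv = !![b, 0; 0, a] := by
  ext i j; fin_cases i <;> fin_cases j <;> simp [Cp, Cv]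

/-- The translation block of `Z⁻¹ X`. -/
def relTra (X Z : Mat5) : Matrix (Fin 3) (Fin 2) ℝ := (rot Z)ᵀ * (tra X - tra Z * (scl Z)⁻¹)

/-- The reference direction in the frame of `Z`. -/
def relDir (m : Vec3) (Z : Mat5) : Vec3 := (rot Z)ᵀ *ᵥ m

/-- The matrix `∑ₛ μₛ μₛᵀ`. -/
def coefS (K : Gains) (m : Vec3) (X Z : Mat5) : Matrix (Fin 3) (Fin 3) ℝ :=
  relTra X Z * K.corr * (relTra X Z)ᵀ + K.km • vecMulVec (relDir m Z) (relDir m Z)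

/-- The matrix through which the translation error acts on the attitude error. -/
def coefB (K : Gains) (X Z : Mat5) : Matrix (Fin 3) (Fin 2) ℝ :=
  relTra X Z * K.corr * ((scl Z)⁻¹)ᵀ

/-- The matrix of the linear translation error equation `V' = -V M`. -/
def coefM (K : Gains) (Z : Mat5) : Matrix (Fin 2) (Fin 2) ℝ :=
  (1 / 2 : ℝ) • ((scl Z)ᵀ * K.Kq * scl Z)
    + (scl Z)⁻¹ * ((1 / 2 : ℝ) • K.prop + K.corr) * ((scl Z)⁻¹)ᵀ

theorem SGamma_eq (K : Gains) (Z : Mat5) : SGamma K Z = (1 / 2 : ℝ) • ((scl Z)ᵀ * K.Kq * scl Z)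
    - (1 / 2 : ℝ) • ((scl Z)⁻¹ * K.prop * ((scl Z)⁻¹)ᵀ) := by
  rw [SGamma, Gains.prop, ← smul_vecMulVec_add, Matrix.mul_add, Matrix.add_mul, smul_add,
    sub_sub]
  simp only [Matrix.mul_smul, Matrix.smul_mul, smul_smul]
  congr 3 <;> ring

/-- In the translation error equation, the contribution of `W_Δ` outweighs the negative terms of
`S_Γ`. -/
theorem coefM_eq (K : Gains) (Z : Mat5) :
    coefM K Z = SGamma K Z + (scl Z)⁻¹ * (K.prop + K.corr) * ((scl Z)⁻¹)ᵀ := by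
  rw [SGamma_eq, coefM]
  simp only [Matrix.mul_add, Matrix.add_mul, Matrix.mul_smul, Matrix.smul_mul]
  module

theorem recentre_hp (X Z : Mat5) :
    recentre Z Cp (hp X) = (tra X - tra Z * (scl Z)⁻¹) *ᵥ Cp := by
  rw [recentre, Matrix.sub_mulVec]
  congr 1
  ext i; simp [hp, Cp, mulVec, dotProduct, Fin.sum_univ_two]

theorem recentre_hv (X Z : Mat5) :
    recentre Z Cv (hv X) = (tra X - tra Z * (scl Z)⁻¹) *ᵥ Cv := by
  rw [recentre, Matrix.sub_mulVec]
  congr 1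
  ext i; simp [hv, Cv, mulVec, dotProduct, Fin.sum_univ_two]

theorem pull_mulVec (Z : Mat5) (C : Fin 2 → ℝ) (N : Matrix (Fin 3) (Fin 2) ℝ) :
    pull Z C (N *ᵥ C) = (rot Z)ᵀ * N * vecMulVec C C * ((scl Z)⁻¹)ᵀ := by
  rw [pull, ← Matrix.mul_vecMulVec, ← Matrix.mul_assoc]

theorem gains_sum (K : Gains) : (K.kp + K.kc) • vecMulVec Cp Cp + (K.kv + K.kd) • vecMulVec Cv Cv
    = K.prop + K.corr := by
  rw [smul_vecMulVec_add]
  ext i j; fin_cases i <;> fin_cases j <;> simp [Gains.prop, Gains.corr]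

theorem WGamma_eq (K : Gains) (X Z : Mat5) :
    WGamma K X Z = -(relTra X Z * (K.prop + K.corr) * ((scl Z)⁻¹)ᵀ) := by
  rw [WGamma, recentre_hp, recentre_hv, pull_mulVec, pull_mulVec, ← gains_sum, Matrix.mul_add,
    Matrix.add_mul]
  simp only [Matrix.mul_smul, Matrix.smul_mul, relTra]
  abel

theorem WDelta_eq (K : Gains) (X Xh Z : Mat5) :
    WDelta K X Xh Z =
      (relTra X Z - relTra Xh Z) * (K.prop + K.corr) * ((scl Z)⁻¹)ᵀ := by
  have h1 : hp X - hp Xh = (tra X - tra Xh) *ᵥ Cp := by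
    ext i; simp [hp, Cp, mulVec, dotProduct, Fin.sum_univ_two]
  have h2 : hv X - hv Xh = (tra X - tra Xh) *ᵥ Cv := by
    ext i; simp [hv, Cv, mulVec, dotProduct, Fin.sum_univ_two]
  have h3 : relTra X Z - relTra Xh Z = (rot Z)ᵀ * (tra X - tra Xh) := by
    rw [relTra, relTra, ← Matrix.mul_sub, sub_sub_sub_cancel_right]
  rw [WDelta, h1, h2, pull_mulVec, pull_mulVec, ← gains_sum, Matrix.mul_add,
    Matrix.add_mul, h3]
  simp only [Matrix.mul_smul, Matrix.smul_mul]

theorem skew_OmegaDelta (K : Gains) (m : Vec3) (X Xh : Mat5) {Z : Mat5}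
    (hZ : rot Z ∈ specialOrthogonalGroup (Fin 3) ℝ) :
    skew (OmegaDelta K m X Xh Z) = (4 : ℝ) •
      (relTra X Z * K.corr * (relTra Xh Z)ᵀ - relTra Xh Z * K.corr * (relTra X Z)ᵀ
        + K.km • (vecMulVec (relDir m Z) ((rot Z)ᵀ *ᵥ (rot Xh *ᵥ hm m X))
          - vecMulVec ((rot Z)ᵀ *ᵥ (rot Xh *ᵥ hm m X)) (relDir m Z))) := by
  have key : ∀ u w : Vec3, skew ((rot Z)ᵀ *ᵥ (skew u *ᵥ w)) =
      vecMulVec ((rot Z)ᵀ *ᵥ w) ((rot Z)ᵀ *ᵥ u) - vecMulVec ((rot Z)ᵀ *ᵥ u) ((rot Z)ᵀ *ᵥ w) := by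
    intro u w
    rw [skew_mulVec_of_mem_SO3 (transpose_mem_SO3 hZ), skew_skew_mulVec, Matrix.mul_sub,
      Matrix.sub_mul]
    simp only [Matrix.mul_vecMulVec, Matrix.vecMulVec_mul,
      transpose_transpose, ← Matrix.vecMul_transpose]
  have hcorr : K.corr = K.kc • vecMulVec Cp Cp + K.kd • vecMulVec Cv Cv :=
    (smul_vecMulVec_add _ _).symm
  have hrel : ∀ (P Q : Matrix (Fin 3) (Fin 2) ℝ) (C : Fin 2 → ℝ),
      vecMulVec (P *ᵥ C) (Q *ᵥ C) = P * vecMulVec C C * Qᵀ := fun P Q C => by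
    rw [Matrix.mul_vecMulVec, Matrix.vecMulVec_mul, Matrix.vecMul_transpose]
  rw [OmegaDelta, skew_add, skew_add, skew_smul, skew_smul, skew_smul, key, key, key,
    recentre_hp, recentre_hv, recentre_hp, recentre_hv, hcorr]
  have e : ∀ (Y : Mat5) (C : Fin 2 → ℝ), (rot Z)ᵀ *ᵥ ((tra Y - tra Z * (scl Z)⁻¹) *ᵥ C) =
      relTra Y Z *ᵥ C := fun _ _ => mulVec_mulVec _ _ _
  simp only [e, hrel, relDir, Matrix.mul_add, Matrix.add_mul, Matrix.mul_smul, Matrix.smul_mul]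
  module

/-! ### Blocks of `SE₂(3)` and `SIM₂(3)` -/

theorem fromBlocks_of_mem_SIM23 {Z : Mat5} (hZ : Z ∈ SIM23) :
    rot Z ∈ specialOrthogonalGroup (Fin 3) ℝ ∧ IsUnit (scl Z) ∧
      Z = fromBlocks (rot Z) (tra Z) 0 (scl Z) := by
  obtain ⟨R, hR, V, A, hA, rfl⟩ := hZ
  simp only [rot, tra, scl, toBlocks_fromBlocks₁₁, toBlocks_fromBlocks₁₂, toBlocks_fromBlocks₂₂]
  exact ⟨hR, hA, trivial⟩

theorem fromBlocks_of_mem_SE23 {X : Mat5} (hX : X ∈ SE23) :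
    rot X ∈ specialOrthogonalGroup (Fin 3) ℝ ∧ X = fromBlocks (rot X) (tra X) 0 1 := by
  obtain ⟨R, hR, V, rfl⟩ := hX
  simp only [rot, tra, toBlocks_fromBlocks₁₁, toBlocks_fromBlocks₁₂]
  exact ⟨hR, trivial⟩

theorem inv_fromBlocks {R : Matrix (Fin 3) (Fin 3) ℝ} (hR : R ∈ specialOrthogonalGroup (Fin 3) ℝ)
    (V : Matrix (Fin 3) (Fin 2) ℝ) {A : Matrix (Fin 2) (Fin 2) ℝ} (hA : IsUnit A) :
    IsUnit (fromBlocks R V 0 A) ∧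
      (fromBlocks R V 0 A)⁻¹ = fromBlocks Rᵀ (-(Rᵀ * V * A⁻¹)) 0 A⁻¹ := by
  have hA' := (Matrix.isUnit_iff_isUnit_det A).1 hA
  have h : fromBlocks R V 0 A * fromBlocks Rᵀ (-(Rᵀ * V * A⁻¹)) 0 A⁻¹ = 1 := by
    rw [fromBlocks_multiply, ← fromBlocks_one]
    congr 1
    · simp [mul_transpose_of_mem_SO3 hR]
    · rw [Matrix.mul_neg, ← Matrix.mul_assoc, ← Matrix.mul_assoc, mul_transpose_of_mem_SO3 hR,
        Matrix.one_mul, neg_add_cancel]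
    · simp
    · simp [Matrix.mul_nonsing_inv A hA']
  exact ⟨IsUnit.of_mul_eq_one _ h, Matrix.inv_eq_right_inv h⟩

theorem isUnit_of_mem_SIM23 {Z : Mat5} (hZ : Z ∈ SIM23) : IsUnit Z := by
  obtain ⟨h1, h2, h3⟩ := fromBlocks_of_mem_SIM23 hZ
  rw [h3]; exact (inv_fromBlocks h1 _ h2).1

theorem mem_SIM23_of_mem_SE23 {X : Mat5} (hX : X ∈ SE23) : X ∈ SIM23 := by
  obtain ⟨R, hR, V, rfl⟩ := hX
  exact ⟨R, hR, V, 1, isUnit_one, rfl⟩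

theorem fromBlocks_mem_SE23 {R : Matrix (Fin 3) (Fin 3) ℝ} {V : Matrix (Fin 3) (Fin 2) ℝ}
    {C : Matrix (Fin 2) (Fin 3) ℝ} {A : Matrix (Fin 2) (Fin 2) ℝ}
    (hR : R ∈ specialOrthogonalGroup (Fin 3) ℝ) (hC : C = 0) (hA : A = 1) :
    fromBlocks R V C A ∈ SE23 :=
  ⟨R, hR, V, by rw [hC, hA]⟩

theorem fromBlocks_sub_fromBlocks {l m n o : Type*} (A A' : Matrix n l ℝ) (B B' : Matrix n m ℝ)
    (C C' : Matrix o l ℝ) (D D' : Matrix o m ℝ) : fromBlocks A B C D - fromBlocks A' B' C' D' =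
      fromBlocks (A - A') (B - B') (C - C') (D - D') := by
  simp only [sub_eq_add_neg, fromBlocks_neg, fromBlocks_add]

theorem inv_mul_fromBlocks {X Z : Mat5} (hX : X ∈ SE23) (hZ : Z ∈ SIM23) :
    Z⁻¹ * X = fromBlocks ((rot Z)ᵀ * rot X) (relTra X Z) 0 (scl Z)⁻¹ := by
  obtain ⟨h1, h2, h3⟩ := fromBlocks_of_mem_SIM23 hZ
  obtain ⟨-, h4⟩ := fromBlocks_of_mem_SE23 hX
  conv_lhs => rw [h3, h4, (inv_fromBlocks h1 _ h2).2, fromBlocks_multiply]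
  congr 1
  · simp
  · rw [relTra, Matrix.mul_sub, Matrix.mul_one, ← Matrix.mul_assoc, sub_eq_add_neg]
  · simp
  · simp

/-- The subgroup property behind `Ē ∈ SE₂(3)`: conjugation by `SIM₂(3)` preserves `SE₂(3)`. -/
theorem inv_mul_mul_inv_mul_mem_SE23 {X Y Z : Mat5} (hX : X ∈ SE23) (hY : Y ∈ SE23)
    (hZ : Z ∈ SIM23) : Z⁻¹ * X * Y⁻¹ * Z ∈ SE23 := by
  rw [inv_mul_fromBlocks hX hZ]
  obtain ⟨hX1, -⟩ := fromBlocks_of_mem_SE23 hX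
  obtain ⟨R, hR, V, A, hA, rfl⟩ := hZ
  obtain ⟨Q, hQ, W, rfl⟩ := hY
  have hA' := (Matrix.isUnit_iff_isUnit_det A).1 hA
  rw [(inv_fromBlocks hQ W isUnit_one).2, fromBlocks_multiply, fromBlocks_multiply]
  refine fromBlocks_mem_SE23 ?_ ?_ ?_
  · rw [Matrix.mul_zero, Matrix.mul_zero, add_zero, add_zero]
    exact mul_mem (mul_mem (mul_mem (transpose_mem_SO3 hR) hX1) (transpose_mem_SO3 hQ)) hR
  · simp
  · simp [scl, Matrix.nonsing_inv_mul A hA']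

/-! ### The error vector field -/

/-- The symmetric matrix `S` perturbed by the translation error. -/
def coefG (K : Gains) (m : Vec3) (X Z : Mat5) (V : Matrix (Fin 3) (Fin 2) ℝ) :
    Matrix (Fin 3) (Fin 3) ℝ := coefS K m X Z - coefB K X Z * Vᵀ

section

variable {K : Gains} {m : Vec3} {X Xh Z : Mat5} {R : Matrix (Fin 3) (Fin 3) ℝ}
  {V : Matrix (Fin 3) (Fin 2) ℝ}

/-- The identity `E Z⁻¹ X̂ = Z⁻¹ X` expresses the estimate through the state and the error. -/
theorem estimate_blocks (hX : X ∈ SE23) (hXh : Xh ∈ SE23) (hZ : Z ∈ SIM23)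
    (hR : R ∈ specialOrthogonalGroup (Fin 3) ℝ)
    (hE : fromBlocks R V 0 1 * (Z⁻¹ * Xh) = Z⁻¹ * X) :
    relTra Xh Z = Rᵀ * (relTra X Z - V * (scl Z)⁻¹) ∧
      (rot Z)ᵀ * rot Xh = Rᵀ * ((rot Z)ᵀ * rot X) := by
  rw [inv_mul_fromBlocks hX hZ, inv_mul_fromBlocks hXh hZ, fromBlocks_multiply,
    fromBlocks_inj] at hE
  obtain ⟨h1, h2, -, -⟩ := hE
  rw [Matrix.mul_zero, add_zero] at h1
  constructor
  · rw [← h2, add_sub_cancel_right, ← Matrix.mul_assoc, transpose_mul_of_mem_SO3 hR,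
      Matrix.one_mul]
  · rw [← h1, ← Matrix.mul_assoc, transpose_mul_of_mem_SO3 hR, Matrix.one_mul]

theorem corr_transpose (K : Gains) : K.corrᵀ = K.corr := by
  ext i j; fin_cases i <;> fin_cases j <;> simp [Gains.corr]

theorem coefS_transpose (K : Gains) (m : Vec3) (X Z : Mat5) :
    (coefS K m X Z)ᵀ = coefS K m X Z := by
  simp only [coefS, transpose_add, transpose_smul, transpose_mul, transpose_transpose,
    corr_transpose, Matrix.mul_assoc, transpose_vecMulVec]

/-- In terms of the error, the angular correction is the skew part of `G R`. -/
theorem skew_OmegaDelta_eq (hX : X ∈ SE23) (hXh : Xh ∈ SE23) (hZ : Z ∈ SIM23)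
    (hR : R ∈ specialOrthogonalGroup (Fin 3) ℝ)
    (hE : fromBlocks R V 0 1 * (Z⁻¹ * Xh) = Z⁻¹ * X) :
    skew (OmegaDelta K m X Xh Z) =
      (4 : ℝ) • (coefG K m X Z V * R - Rᵀ * (coefG K m X Z V)ᵀ) := by
  obtain ⟨h1, h2⟩ := estimate_blocks hX hXh hZ hR hE
  obtain ⟨hZ1, -, -⟩ := fromBlocks_of_mem_SIM23 hZ
  have h3 : (rot Z)ᵀ *ᵥ (rot Xh *ᵥ hm m X) = Rᵀ *ᵥ relDir m Z := by
    have hXX := mul_transpose_of_mem_SO3 (fromBlocks_of_mem_SE23 hX).1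
    rw [mulVec_mulVec, h2, hm, relDir, mulVec_mulVec, mulVec_mulVec, Matrix.mul_assoc,
      Matrix.mul_assoc, hXX, Matrix.mul_one]
  have h4 : vecMulVec (relDir m Z) (Rᵀ *ᵥ relDir m Z) =
      vecMulVec (relDir m Z) (relDir m Z) * R := by
    rw [Matrix.vecMulVec_mul, Matrix.mulVec_transpose]
  rw [skew_OmegaDelta K m X Xh hZ1, h3, h1, h4, ← Matrix.mul_vecMulVec]
  simp only [coefG, transpose_sub, coefS_transpose]
  simp only [coefS, coefB, transpose_mul, transpose_sub, transpose_transpose, corr_transpose,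
    Matrix.add_mul, Matrix.sub_mul, Matrix.mul_add, Matrix.mul_sub, Matrix.mul_assoc,
    Matrix.smul_mul, Matrix.mul_smul]
  module

theorem WDelta_add_WGamma (hX : X ∈ SE23) (hXh : Xh ∈ SE23) (hZ : Z ∈ SIM23)
    (hR : R ∈ specialOrthogonalGroup (Fin 3) ℝ)
    (hE : fromBlocks R V 0 1 * (Z⁻¹ * Xh) = Z⁻¹ * X) :
    WDelta K X Xh Z = -WGamma K X Z -
      Rᵀ * (relTra X Z - V * (scl Z)⁻¹) * (K.prop + K.corr) * ((scl Z)⁻¹)ᵀ := by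
  rw [WDelta_eq, WGamma_eq, (estimate_blocks hX hXh hZ hR hE).1, neg_neg, Matrix.sub_mul,
    Matrix.sub_mul]

/-- The right-hand side of the error equation: the translation error obeys a linear equation of its own and the
attitude error a matrix Riccati equation. -/
theorem error_field (hX : X ∈ SE23) (hXh : Xh ∈ SE23) (hZ : Z ∈ SIM23)
    (hR : R ∈ specialOrthogonalGroup (Fin 3) ℝ)
    (hE : fromBlocks R V 0 1 * (Z⁻¹ * Xh) = Z⁻¹ * X) :
    Gamma K X Z * fromBlocks R V 0 1 - fromBlocks R V 0 1 * Gamma K X Z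
        - fromBlocks R V 0 1 * Delta K m X Xh Z =
      fromBlocks ((4 : ℝ) • ((coefG K m X Z V)ᵀ - R * coefG K m X Z V * R))
        (-(V * coefM K Z)) 0 0 := by
  have h0 : skew OmegaGamma = 0 := by
    ext i j; fin_cases i <;> fin_cases j <;> simp [skew, OmegaGamma]
  have hRR := mul_transpose_of_mem_SO3 hR
  rw [Gamma, Delta, h0, skew_OmegaDelta_eq hX hXh hZ hR hE, WDelta_add_WGamma hX hXh hZ hR hE,
    fromBlocks_multiply, fromBlocks_multiply, fromBlocks_multiply, fromBlocks_sub_fromBlocks,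
    fromBlocks_sub_fromBlocks]
  congr 1
  · simp only [Matrix.mul_smul, Matrix.mul_sub, ← Matrix.mul_assoc, hRR, Matrix.one_mul]
    simp only [Matrix.zero_mul, Matrix.mul_zero, add_zero, Matrix.mul_assoc]
    module
  · rw [coefM_eq, Matrix.mul_sub, ← Matrix.mul_assoc R, ← Matrix.mul_assoc R, ← Matrix.mul_assoc R, hRR,
      WGamma_eq]
    simp only [Matrix.mul_neg, Matrix.mul_add, Matrix.sub_mul, Matrix.zero_mul, Matrix.mul_one,
      Matrix.one_mul, Matrix.mul_assoc, Matrix.mul_zero, add_zero, zero_add, Matrix.add_mul]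
    abel
  · simp
  · simp

end

section

variable {K : Gains} {g m : Vec3} {Ω a : ℝ → Vec3} {X Z Xh : ℝ → Mat5} {t₀ : ℝ}

theorem hasDerivWithinAt_inv_Z (hZ : IsAuxiliary K g X Z) {t : ℝ} (ht : 0 ≤ t) :
    HasDerivWithinAt (fun t => (Z t)⁻¹) (Gamma K (X t) (Z t) * (Z t)⁻¹
      - (Z t)⁻¹ * (gravG g + matD)) (Ici 0) t := by
  have hu := isUnit_of_mem_SIM23 (hZ t ht).1
  have hd := (Matrix.isUnit_iff_isUnit_det _).1 hu
  refine (hasDerivWithinAt_matrix_inv (hZ t ht).2 hu).congr_deriv ?_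
  rw [Matrix.mul_sub, Matrix.sub_mul, ← Matrix.mul_assoc (Z t)⁻¹ (Z t), Matrix.nonsing_inv_mul _ hd,
    Matrix.one_mul, Matrix.mul_assoc, Matrix.mul_assoc, Matrix.mul_nonsing_inv _ hd, Matrix.mul_one,
    neg_sub]

theorem err_mul (hXh : Xh t₀ ∈ SE23) (hZ : Z t₀ ∈ SIM23) :
    err X Z Xh t₀ * ((Z t₀)⁻¹ * Xh t₀) = (Z t₀)⁻¹ * X t₀ := by
  have h1 := (Matrix.isUnit_iff_isUnit_det _).1 (isUnit_of_mem_SIM23 hZ)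
  have h2 := (Matrix.isUnit_iff_isUnit_det _).1 (isUnit_of_mem_SIM23 (mem_SIM23_of_mem_SE23 hXh))
  rw [err, Matrix.mul_assoc, ← Matrix.mul_assoc (Z t₀), Matrix.mul_nonsing_inv _ h1, Matrix.one_mul,
    Matrix.mul_assoc, Matrix.nonsing_inv_mul _ h2, Matrix.mul_one]

theorem hasDerivWithinAt_err (hX : IsSystem g Ω a X) (hZ : IsAuxiliary K g X Z) (ht₀ : 0 ≤ t₀)
    (hXh : IsEstimate K g m Ω a X Z t₀ Xh) {t : ℝ} (ht : t₀ ≤ t) :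
    HasDerivWithinAt (err X Z Xh) (Gamma K (X t) (Z t) * err X Z Xh t
      - err X Z Xh t * Gamma K (X t) (Z t)
      - err X Z Xh t * Delta K m (X t) (Xh t) (Z t)) (Ici t₀) t := by
  have ht' := ht₀.trans ht
  have hsub : Ici t₀ ⊆ Ici 0 := Ici_subset_Ici.2 ht₀
  have hu := isUnit_of_mem_SIM23 (mem_SIM23_of_mem_SE23 (hXh t ht).1)
  have hd := (Matrix.isUnit_iff_isUnit_det _).1 hu
  have hdZ := (Matrix.isUnit_iff_isUnit_det _).1 (isUnit_of_mem_SIM23 (hZ t ht').1)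
  refine (hasDerivWithinAt_matrix_mul (hasDerivWithinAt_matrix_mul (hasDerivWithinAt_matrix_mul
    ((hasDerivWithinAt_inv_Z hZ ht').mono hsub) ((hX t ht').2.mono hsub))
    (hasDerivWithinAt_matrix_inv (hXh t ht).2 hu)) ((hZ t ht').2.mono hsub)).congr_deriv ?_
  have e1 := Matrix.mul_nonsing_inv _ hd
  have e2 := Matrix.nonsing_inv_mul _ hd
  have e3 := Matrix.nonsing_inv_mul _ hdZ
  have e2' : ∀ M : Mat5, (Xh t)⁻¹ * (Xh t * M) = M := fun M => by
    rw [← Matrix.mul_assoc, e2, Matrix.one_mul]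
  simp only [err, Matrix.mul_add, Matrix.add_mul, Matrix.mul_sub, Matrix.sub_mul, Matrix.mul_assoc,
    Matrix.mul_neg, Matrix.neg_mul, e1, e3, e2', Matrix.mul_one]
  abel

/-- Reconstruction of the estimate from a solution of the error dynamics. -/
theorem exists_isEstimate (hX : IsSystem g Ω a X) (hZ : IsAuxiliary K g X Z) (ht₀ : 0 ≤ t₀)
    {R : ℝ → Matrix (Fin 3) (Fin 3) ℝ} {V : ℝ → Matrix (Fin 3) (Fin 2) ℝ}
    (hR : ∀ t, t₀ ≤ t → R t ∈ specialOrthogonalGroup (Fin 3) ℝ)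
    (hR' : ∀ t, t₀ ≤ t → HasDerivWithinAt R ((4 : ℝ) • ((coefG K m (X t) (Z t) (V t))ᵀ
      - R t * coefG K m (X t) (Z t) (V t) * R t)) (Ici t₀) t)
    (hV' : ∀ t, t₀ ≤ t → HasDerivWithinAt V (-(V t * coefM K (Z t))) (Ici t₀) t) :
    ∃ Xh, IsEstimate K g m Ω a X Z t₀ Xh ∧
      ∀ t, t₀ ≤ t → err X Z Xh t = fromBlocks (R t) (V t) 0 1 := by
  set E : ℝ → Mat5 := fun t => fromBlocks (R t) (V t) 0 1 with hEdef
  have hE : ∀ t, t₀ ≤ t → E t ∈ SE23 := fun t ht => ⟨R t, hR t ht, V t, rfl⟩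
  set Xh : ℝ → Mat5 := fun t => Z t * (E t)⁻¹ * (Z t)⁻¹ * X t with hXhdef
  have hmem : ∀ t, t₀ ≤ t → Xh t ∈ SE23 := by
    intro t ht
    have hZ1 := (hZ t (ht₀.trans ht)).1
    obtain ⟨h1, h2, h3⟩ := fromBlocks_of_mem_SIM23 hZ1
    obtain ⟨h4, h5⟩ := fromBlocks_of_mem_SE23 (hX t (ht₀.trans ht)).1
    have hA' := (Matrix.isUnit_iff_isUnit_det _).1 h2
    simp only [hXhdef, hEdef]
    rw [(inv_fromBlocks (hR t ht) _ isUnit_one).2, Matrix.mul_assoc,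
      inv_mul_fromBlocks (hX t (ht₀.trans ht)).1 hZ1]
    nth_rewrite 1 [h3]
    rw [fromBlocks_multiply, fromBlocks_multiply]
    refine fromBlocks_mem_SE23 ?_ ?_ ?_
    · rw [Matrix.mul_zero, Matrix.mul_zero, add_zero, add_zero]
      exact mul_mem (mul_mem h1 (transpose_mem_SO3 (hR t ht)))
        (mul_mem (transpose_mem_SO3 h1) h4)
    · simp
    · simp [Matrix.mul_nonsing_inv _ hA']
  have hEd : ∀ t, t₀ ≤ t → IsUnit (E t) := fun t ht =>
    isUnit_of_mem_SIM23 (mem_SIM23_of_mem_SE23 (hE t ht))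
  have hkey : ∀ t, t₀ ≤ t → E t * ((Z t)⁻¹ * Xh t) = (Z t)⁻¹ * X t := by
    intro t ht
    have h1 := (Matrix.isUnit_iff_isUnit_det _).1 (isUnit_of_mem_SIM23 (hZ t (ht₀.trans ht)).1)
    have h2 := (Matrix.isUnit_iff_isUnit_det _).1 (hEd t ht)
    simp only [hXhdef, Matrix.mul_assoc]
    rw [← Matrix.mul_assoc (Z t)⁻¹ (Z t), Matrix.nonsing_inv_mul _ h1, Matrix.one_mul,
      ← Matrix.mul_assoc (E t), Matrix.mul_nonsing_inv _ h2, Matrix.one_mul]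
  refine ⟨Xh, fun t ht => ⟨hmem t ht, ?_⟩, fun t ht => ?_⟩
  · have ht' := ht₀.trans ht
    have hsub : Ici t₀ ⊆ Ici 0 := Ici_subset_Ici.2 ht₀
    have hEder : HasDerivWithinAt E (Gamma K (X t) (Z t) * E t - E t * Gamma K (X t) (Z t)
        - E t * Delta K m (X t) (Xh t) (Z t)) (Ici t₀) t := by
      refine (hasDerivWithinAt_fromBlocks (hR' t ht) (hV' t ht)
        (hasDerivWithinAt_const t _ (0 : Matrix (Fin 2) (Fin 3) ℝ))
        (hasDerivWithinAt_const t _ (1 : Matrix (Fin 2) (Fin 2) ℝ))).congr_deriv ?_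
      exact (error_field (hX t ht').1 (hmem t ht) (hZ t ht').1 (hR t ht) (hkey t ht)).symm
    refine (hasDerivWithinAt_matrix_mul (hasDerivWithinAt_matrix_mul (hasDerivWithinAt_matrix_mul
      ((hZ t ht').2.mono hsub) (hasDerivWithinAt_matrix_inv hEder (hEd t ht)))
      ((hasDerivWithinAt_inv_Z hZ ht').mono hsub)) ((hX t ht').2.mono hsub)).congr_deriv ?_
    have hdE := (Matrix.isUnit_iff_isUnit_det _).1 (hEd t ht)
    have hdZ := (Matrix.isUnit_iff_isUnit_det _).1 (isUnit_of_mem_SIM23 (hZ t ht').1)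
    have e1 := Matrix.mul_nonsing_inv _ hdE
    have e2 := Matrix.nonsing_inv_mul _ hdE
    have e3 := Matrix.nonsing_inv_mul _ hdZ
    have e2' : ∀ M : Mat5, (E t)⁻¹ * (E t * M) = M := fun M => by
      rw [← Matrix.mul_assoc, e2, Matrix.one_mul]
    have e3' : ∀ M : Mat5, (Z t)⁻¹ * (Z t * M) = M := fun M => by
      rw [← Matrix.mul_assoc, e3, Matrix.one_mul]
    have e4 : Xh t = Z t * ((E t)⁻¹ * ((Z t)⁻¹ * X t)) := by
      simp only [hXhdef, Matrix.mul_assoc]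
    generalize Delta K m (X t) (Xh t) (Z t) = Δ
    rw [e4]
    simp only [Matrix.mul_add, Matrix.add_mul, Matrix.mul_sub, Matrix.sub_mul,
      Matrix.mul_assoc, Matrix.mul_neg, Matrix.neg_mul, e1, e2', e3', Matrix.mul_one]
    abel
  · have h1 := err_mul (X := X) (hmem t ht) (hZ t (ht₀.trans ht)).1
    have hu : IsUnit ((Z t)⁻¹ * Xh t) :=
      ((Matrix.isUnit_nonsing_inv_iff).2 (isUnit_of_mem_SIM23 (hZ t (ht₀.trans ht)).1)).mul
        (isUnit_of_mem_SIM23 (mem_SIM23_of_mem_SE23 (hmem t ht)))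
    exact hu.mul_right_cancel (h1.trans (hkey t ht).symm)

end

/-! ### Bounds for the auxiliary state -/

/-- The lower right block of `matD`. -/
def matSD : Matrix (Fin 2) (Fin 2) ℝ := !![0, -1; 0, 0]

theorem matD_eq : matD = fromBlocks 0 0 0 matSD := rfl

namespace BoundedFrom

variable {t₀ : ℝ}

theorem add {F : Type*} [SeminormedAddCommGroup F] {f h : ℝ → F} (hf : BoundedFrom t₀ f)
    (hh : BoundedFrom t₀ h) : BoundedFrom t₀ fun t => f t + h t :=
  ⟨hf.choose + hh.choose, fun t ht => norm_add_le_of_le (hf.choose_spec t ht)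
    (hh.choose_spec t ht)⟩

theorem sub {F : Type*} [SeminormedAddCommGroup F] {f h : ℝ → F} (hf : BoundedFrom t₀ f)
    (hh : BoundedFrom t₀ h) : BoundedFrom t₀ fun t => f t - h t :=
  ⟨hf.choose + hh.choose, fun t ht => norm_sub_le_of_le (hf.choose_spec t ht)
    (hh.choose_spec t ht)⟩

theorem const_smul {F : Type*} [SeminormedAddCommGroup F] [NormedSpace ℝ F] {f : ℝ → F}
    (hf : BoundedFrom t₀ f) (c : ℝ) : BoundedFrom t₀ fun t => c • f t :=
  ⟨‖c‖ * hf.choose, fun t ht => by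
    rw [norm_smul]
    exact mul_le_mul_of_nonneg_left (hf.choose_spec t ht) (norm_nonneg _)⟩

theorem const {F : Type*} [SeminormedAddCommGroup F] (v : F) : BoundedFrom t₀ fun _ : ℝ => v :=
  ⟨‖v‖, fun _ _ => le_rfl⟩

theorem mul {k l n : Type*} [Fintype k] [Fintype l] [Fintype n] {f : ℝ → Matrix k l ℝ}
    {h : ℝ → Matrix l n ℝ} (hf : BoundedFrom t₀ f) (hh : BoundedFrom t₀ h) :
    BoundedFrom t₀ fun t => f t * h t :=
  ⟨hf.choose * hh.choose, fun t ht => (Matrix.frobenius_norm_mul _ _).trans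
    (mul_le_mul (hf.choose_spec t ht) (hh.choose_spec t ht) (norm_nonneg _)
      ((norm_nonneg _).trans (hf.choose_spec t ht)))⟩

theorem transpose {k l : Type*} [Fintype k] [Fintype l] {f : ℝ → Matrix k l ℝ}
    (hf : BoundedFrom t₀ f) : BoundedFrom t₀ fun t => (f t)ᵀ :=
  ⟨hf.choose, fun t ht => by rw [Matrix.frobenius_norm_transpose]; exact hf.choose_spec t ht⟩

theorem of_mem_SO3 {R : ℝ → Matrix (Fin 3) (Fin 3) ℝ}
    (hR : ∀ t, t₀ ≤ t → R t ∈ specialOrthogonalGroup (Fin 3) ℝ) : BoundedFrom t₀ R :=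
  ⟨9, fun t ht => norm_le_of_mem_SO3 (hR t ht)⟩

theorem bddLip {F : Type*} [NormedAddCommGroup F] [NormedSpace ℝ F] {f f' : ℝ → F}
    (hf : BoundedFrom t₀ f) (hd : ∀ t, t₀ ≤ t → HasDerivWithinAt f (f' t) (Ici t₀) t)
    (hf' : BoundedFrom t₀ f') : BddLip t₀ f :=
  BddLip.of_deriv hd hf.choose_spec hf'.choose_spec

end BoundedFrom

theorem mulVec_dotProduct_self_le {l n : Type*} [Fintype l] [Fintype n] (A : Matrix l n ℝ)
    (v : n → ℝ) : (A *ᵥ v) ⬝ᵥ (A *ᵥ v) ≤ ‖A‖ ^ 2 * (v ⬝ᵥ v) := by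
  rw [frobenius_norm_sq, Finset.sum_mul]
  refine Finset.sum_le_sum fun i _ => ?_
  have h := Finset.sum_mul_sq_le_sq_mul_sq Finset.univ (A i) v
  simp only [mulVec, dotProduct, ← sq] at h ⊢
  exact h

/-- A linear matrix equation with a uniformly coercive coefficient and a bounded source has bounded
solutions. -/
theorem boundedFrom_of_coercive {l n : Type*} [Fintype l] [Fintype n] {N F : ℝ → Matrix l n ℝ}
    {M : ℝ → Matrix n n ℝ} {t₀ κ : ℝ} (hκ : 0 < κ)
    (hM : ∀ t, t₀ ≤ t → ∀ v : n → ℝ, κ * (v ⬝ᵥ v) ≤ v ⬝ᵥ M t *ᵥ v)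
    (hN : ∀ t, t₀ ≤ t → HasDerivWithinAt N (-(N t * M t) + F t) (Ici t₀) t)
    (hF : BoundedFrom t₀ F) : BoundedFrom t₀ N := by
  obtain ⟨c, hc⟩ := hF
  have hd : ∀ t, t₀ ≤ t → HasDerivWithinAt (fun t => ‖N t‖ ^ 2)
      (∑ i, ∑ j, 2 * (N t i j * (-(N t * M t) i j + F t i j))) (Ici t₀) t := by
    intro t ht
    simp only [frobenius_norm_sq]
    refine HasDerivWithinAt.fun_sum fun i _ => HasDerivWithinAt.fun_sum fun j _ => ?_
    refine ((hasDerivWithinAt_matrix.1 (hN t ht) i j).fun_pow 2).congr_deriv ?_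
    simp only [Matrix.add_apply, Matrix.neg_apply]; ring
  have hb : ∀ t, t₀ ≤ t → ∑ i, ∑ j, 2 * (N t i j * (-(N t * M t) i j + F t i j)) ≤
      -κ * ‖N t‖ ^ 2 + c ^ 2 / κ := by
    intro t ht
    have h1 : κ * ∑ i, ∑ j, N t i j ^ 2 ≤ ∑ i, ∑ j, N t i j * (N t * M t) i j := by
      rw [Finset.mul_sum]
      refine Finset.sum_le_sum fun i _ => ?_
      have h := hM t ht (N t i)
      have e : N t i ⬝ᵥ M t *ᵥ N t i = ∑ j, N t i j * (N t * M t) i j := by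
        rw [dotProduct_mulVec, dotProduct_comm]; rfl
      rw [e] at h
      simpa only [dotProduct, ← sq] using h
    have h2 : ∑ i, ∑ j, 2 * (N t i j * F t i j) ≤
        κ * ∑ i, ∑ j, N t i j ^ 2 + (∑ i, ∑ j, F t i j ^ 2) / κ := by
      simp only [Finset.mul_sum, Finset.sum_div, ← Finset.sum_add_distrib]
      refine Finset.sum_le_sum fun i _ => Finset.sum_le_sum fun j _ => ?_
      have h := two_mul_le_add_sq (κ * N t i j) (F t i j)
      rw [← sub_nonneg]
      have e : κ * N t i j ^ 2 + F t i j ^ 2 / κ - 2 * (N t i j * F t i j) =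
          (κ * N t i j - F t i j) ^ 2 / κ := by field_simp; ring
      rw [e]; positivity
    have h3 : ∑ i, ∑ j, 2 * (N t i j * (-(N t * M t) i j + F t i j)) =
        -2 * ∑ i, ∑ j, N t i j * (N t * M t) i j + ∑ i, ∑ j, 2 * (N t i j * F t i j) := by
      simp only [Finset.mul_sum, ← Finset.sum_add_distrib]
      exact Finset.sum_congr rfl fun i _ => Finset.sum_congr rfl fun j _ => by ring
    have h4 : (∑ i, ∑ j, F t i j ^ 2) / κ ≤ c ^ 2 / κ := by
      rw [← frobenius_norm_sq]
      have := hc t ht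
      gcongr
    rw [h3, frobenius_norm_sq]
    linarith
  refine ⟨√(max (‖N t₀‖ ^ 2) (c ^ 2 / κ / κ)), fun t ht => Real.le_sqrt_of_sq_le ?_⟩
  exact le_max_of_deriv_le_affine hκ hd hb ht

section

variable {K : Gains} {g m : Vec3} {Ω a : ℝ → Vec3} {X Z : ℝ → Mat5}

theorem aux_field_blocks (K : Gains) (g : Vec3) (X : Mat5) {Z : Mat5} (hZ : Z ∈ SIM23) :
    (gravG g + matD) * Z - Z * Gamma K X Z =
      fromBlocks 0 (firstCol g * scl Z - (rot Z * WGamma K X Z + tra Z * SGamma K Z)) 0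
        (matSD * scl Z - scl Z * SGamma K Z) := by
  have h0 : skew OmegaGamma = 0 := by
    ext i j; fin_cases i <;> fin_cases j <;> simp [skew, OmegaGamma]
  conv_lhs => rw [(fromBlocks_of_mem_SIM23 hZ).2.2]
  rw [gravG, matD_eq, Gamma, h0, fromBlocks_add, fromBlocks_multiply, fromBlocks_multiply,
    fromBlocks_sub_fromBlocks, ← (fromBlocks_of_mem_SIM23 hZ).2.2]
  simp

theorem hasDerivWithinAt_rot_Z (hZ : IsAuxiliary K g X Z) {t : ℝ} (ht : 0 ≤ t) :
    HasDerivWithinAt (fun t => rot (Z t)) 0 (Ici 0) t := by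
  have := hasDerivWithinAt_submatrix Sum.inl Sum.inl (hZ t ht).2
  rw [aux_field_blocks K g _ (hZ t ht).1] at this
  exact this

theorem hasDerivWithinAt_tra_Z (hZ : IsAuxiliary K g X Z) {t : ℝ} (ht : 0 ≤ t) :
    HasDerivWithinAt (fun t => tra (Z t)) (firstCol g * scl (Z t)
      - (rot (Z t) * WGamma K (X t) (Z t) + tra (Z t) * SGamma K (Z t))) (Ici 0) t := by
  have := hasDerivWithinAt_submatrix Sum.inl Sum.inr (hZ t ht).2
  rw [aux_field_blocks K g _ (hZ t ht).1] at this
  exact this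

theorem hasDerivWithinAt_scl_Z (hZ : IsAuxiliary K g X Z) {t : ℝ} (ht : 0 ≤ t) :
    HasDerivWithinAt (fun t => scl (Z t)) (matSD * scl (Z t) - scl (Z t) * SGamma K (Z t))
      (Ici 0) t := by
  have := hasDerivWithinAt_submatrix Sum.inr Sum.inr (hZ t ht).2
  rw [aux_field_blocks K g _ (hZ t ht).1] at this
  exact this

theorem hasDerivWithinAt_tra_X (hX : IsSystem g Ω a X) {t : ℝ} (ht : 0 ≤ t) :
    HasDerivWithinAt (fun t => tra (X t)) (rot (X t) * firstCol (a t) + firstCol g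
      - tra (X t) * matSD) (Ici 0) t := by
  have := hasDerivWithinAt_submatrix Sum.inl Sum.inr (hX t ht).2
  refine this.congr_deriv ?_
  obtain ⟨-, h⟩ := fromBlocks_of_mem_SE23 (hX t ht).1
  conv_lhs => rw [h]
  rw [inputU, gravG, matD_eq, fromBlocks_multiply, fromBlocks_multiply, fromBlocks_multiply,
    fromBlocks_multiply, fromBlocks_add, fromBlocks_add, fromBlocks_sub_fromBlocks]
  ext i j
  simp

theorem rot_Z_eq (hZ : IsAuxiliary K g X Z) {t : ℝ} (ht : 0 ≤ t) : rot (Z t) = rot (Z 0) := by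
  refine eq_of_sub_eq_zero (norm_le_zero_iff.1 ?_)
  have := (convex_Ici (0 : ℝ)).norm_image_sub_le_of_norm_hasDerivWithin_le (C := 0)
    (fun s hs => hasDerivWithinAt_rot_Z hZ hs) (fun s _ => by simp) (mem_Ici.2 le_rfl)
    (mem_Ici.2 ht)
  simpa using this

theorem Kq_entries (K : Gains) : K.Kq 1 0 = K.Kq 0 1 ∧ 0 < K.Kq 0 0 ∧ 0 < K.Kq 1 1 ∧
    0 < K.Kq 0 0 * K.Kq 1 1 - K.Kq 0 1 ^ 2 := by
  have h1 : K.Kq 1 0 = K.Kq 0 1 := by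
    have := K.Kq_posDef.isHermitian.apply 0 1
    simpa using this
  have h2 := K.Kq_posDef.det_pos
  rw [Matrix.det_fin_two, h1, ← sq] at h2
  exact ⟨h1, K.Kq_posDef.diag_pos, K.Kq_posDef.diag_pos, h2⟩

theorem scl_mul_SGamma (K : Gains) {Z : Mat5} (hZ : IsUnit (scl Z)) :
    scl Z * SGamma K Z * (scl Z)ᵀ = (1 / 2 : ℝ) • (scl Z * (scl Z)ᵀ * K.Kq * (scl Z * (scl Z)ᵀ)
      - K.prop) := by
  have h := (Matrix.isUnit_iff_isUnit_det _).1 hZ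
  have e1 := Matrix.mul_nonsing_inv _ h
  have e2 : ((scl Z)⁻¹)ᵀ * (scl Z)ᵀ = 1 := by rw [← transpose_mul, e1, transpose_one]
  rw [SGamma_eq, smul_sub, Matrix.mul_sub, Matrix.sub_mul]
  simp only [Matrix.mul_smul, Matrix.smul_mul, Matrix.mul_assoc, e2, Matrix.mul_one]
  rw [← Matrix.mul_assoc (scl Z) (scl Z)⁻¹, e1, Matrix.one_mul]

theorem SGamma_transpose (K : Gains) (Z : Mat5) : (SGamma K Z)ᵀ = SGamma K Z := by
  have h1 : K.Kqᵀ = K.Kq := by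
    have := K.Kq_posDef.isHermitian.eq
    rwa [conjTranspose_eq_transpose_of_trivial] at this
  have h2 : K.propᵀ = K.prop := by
    ext i j; fin_cases i <;> fin_cases j <;> simp [Gains.prop]
  simp only [SGamma_eq, transpose_sub, transpose_smul, transpose_mul, transpose_transpose, h1, h2,
    Matrix.mul_assoc]

/-- The matrix `A_Z A_Zᵀ` solves a Riccati equation. -/
theorem hasDerivWithinAt_gram (hZ : IsAuxiliary K g X Z) {t : ℝ} (ht : 0 ≤ t) :
    HasDerivWithinAt (fun t => scl (Z t) * (scl (Z t))ᵀ)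
      (matSD * (scl (Z t) * (scl (Z t))ᵀ)
        + scl (Z t) * (scl (Z t))ᵀ * matSDᵀ
        - (scl (Z t) * (scl (Z t))ᵀ * K.Kq * (scl (Z t) * (scl (Z t))ᵀ)) + K.prop) (Ici 0) t := by
  have h := hasDerivWithinAt_scl_Z hZ ht
  refine (hasDerivWithinAt_matrix_mul h (hasDerivWithinAt_matrix_transpose h)).congr_deriv ?_
  have e := scl_mul_SGamma K (fromBlocks_of_mem_SIM23 (hZ t ht).1).2.1
  simp only [Matrix.mul_assoc] at e
  simp only [transpose_sub, transpose_mul, SGamma_transpose, Matrix.sub_mul, Matrix.mul_sub,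
    Matrix.mul_assoc, e]
  module

/-- The trace of `Q = A_Z A_Zᵀ` is `|A_Z|²`, and `|A_Z⁻¹|² = tr Q / det Q` in dimension two. -/
theorem boundedFrom_scl (hZ : IsAuxiliary K g X Z) : BoundedFrom 0 (fun t => scl (Z t)) ∧
    BoundedFrom 0 (fun t => (scl (Z t))⁻¹) := by
  obtain ⟨hs, hα, hγ, hK⟩ := Kq_entries K
  set Q : ℝ → Matrix (Fin 2) (Fin 2) ℝ := fun t => scl (Z t) * (scl (Z t))ᵀ with hQ
  have hd := fun t (ht : 0 ≤ t) => hasDerivWithinAt_matrix.1 (hasDerivWithinAt_gram hZ ht)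
  have hsym : ∀ t, Q t 1 0 = Q t 0 1 := fun t => by
    simp only [hQ, Matrix.mul_apply, Fin.sum_univ_two, transpose_apply]; ring
  have hdet : ∀ t, Q t 0 0 * Q t 1 1 - Q t 0 1 ^ 2 = (scl (Z t)).det ^ 2 := fun t => by
    simp only [hQ, Matrix.mul_apply, Fin.sum_univ_two, transpose_apply, Matrix.det_fin_two]; ring
  have hdet0 : ∀ t, 0 ≤ t → 0 < Q t 0 0 * Q t 1 1 - Q t 0 1 ^ 2 := fun t ht => by
    have h := (Matrix.isUnit_iff_isUnit_det _).1 (fromBlocks_of_mem_SIM23 (hZ t ht).1).2.1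
    rw [hdet]
    have := h.ne_zero
    positivity
  have h00 : ∀ t, 0 ≤ Q t 0 0 := fun t => by
    simp only [hQ, Matrix.mul_apply, Fin.sum_univ_two, transpose_apply]
    nlinarith [sq_nonneg (scl (Z t) 0 0), sq_nonneg (scl (Z t) 0 1)]
  have h11 : ∀ t, 0 ≤ Q t 1 1 := fun t => by
    simp only [hQ, Matrix.mul_apply, Fin.sum_univ_two, transpose_apply]
    nlinarith [sq_nonneg (scl (Z t) 1 0), sq_nonneg (scl (Z t) 1 1)]
  have hpos : ∀ t, 0 ≤ t → 0 < Q t 0 0 ∧ 0 < Q t 1 1 := fun t ht => by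
    have h := hdet0 t ht
    constructor
    · refine lt_of_le_of_ne (h00 t) fun h' => ?_
      rw [← h'] at h; nlinarith [sq_nonneg (Q t 0 1)]
    · refine lt_of_le_of_ne (h11 t) fun h' => ?_
      rw [← h'] at h; nlinarith [sq_nonneg (Q t 0 1)]
  obtain ⟨b, d, hd0, hbd⟩ : ∃ b d, 0 < d ∧ ∀ t, 0 ≤ t → Q t 0 0 + Q t 1 1 ≤ b ∧
      d ≤ Q t 0 0 * Q t 1 1 - Q t 0 1 ^ 2 := by
    refine exists_riccati_bounds (x := fun t => Q t 0 0) (y := fun t => Q t 0 1)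
      (z := fun t => Q t 1 1) (β := K.Kq 0 1) hα hγ hK K.kv_nonneg K.kp_pos
      (fun t ht => (hd t ht 0 0).congr_deriv ?_) (fun t ht => (hd t ht 0 1).congr_deriv ?_)
      (fun t ht => (hd t ht 1 1).congr_deriv ?_) (fun t ht => (hpos t ht).1)
      (fun t ht => (hpos t ht).2) hdet0
    all_goals
      change (matSD * Q t + Q t * matSDᵀ - Q t * K.Kq * Q t + K.prop) _ _ = _
      simp only [Matrix.add_apply, Matrix.sub_apply, Matrix.mul_apply, Fin.sum_univ_two,
        transpose_apply, hsym, hs]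
      simp [matSD, Gains.prop]
      ring
  · have htr : ∀ t, ‖scl (Z t)‖ ^ 2 = Q t 0 0 + Q t 1 1 := fun t => by
      simp only [frobenius_norm_sq, hQ, Matrix.mul_apply, Fin.sum_univ_two, transpose_apply]; ring
    refine ⟨⟨√b, fun t ht => Real.le_sqrt_of_sq_le ?_⟩,
      ⟨√(b / d), fun t ht => Real.le_sqrt_of_sq_le ?_⟩⟩
    · rw [htr]; exact (hbd t ht).1
    · have h1 : ‖(scl (Z t))⁻¹‖ ^ 2 = (Q t 0 0 + Q t 1 1) / (scl (Z t)).det ^ 2 := by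
        rw [← htr, frobenius_norm_sq, frobenius_norm_sq, Matrix.inv_def, Matrix.adjugate_fin_two]
        simp only [Fin.sum_univ_two, Matrix.smul_apply, Ring.inverse_eq_inv', smul_eq_mul,
          of_apply, cons_val', cons_val_zero, cons_val_one, cons_val_fin_one]
        rw [div_eq_inv_mul]; ring
      obtain ⟨h2, h3⟩ := hbd t ht
      rw [h1, ← hdet]
      exact div_le_div₀ (by linarith [h00 t, h11 t]) h2 hd0 h3

end

section

variable {K : Gains} {g m : Vec3} {Ω a : ℝ → Vec3} {X Z : ℝ → Mat5}

theorem dotProduct_mulVec_transpose_mul (n : Fin 2 → ℝ) (A B : Matrix (Fin 2) (Fin 2) ℝ) :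
    n ⬝ᵥ (Aᵀ * B * A) *ᵥ n = (A *ᵥ n) ⬝ᵥ B *ᵥ (A *ᵥ n) := by
  rw [Matrix.mul_assoc, ← mulVec_mulVec, dotProduct_mulVec, vecMul_transpose, ← mulVec_mulVec]

/-- Coercivity comes from the term with `K_q`, by the bound for `A_Z⁻¹`; the other terms of `coefM`
are positive semidefinite. -/
theorem exists_coefM_coercive (hZ : IsAuxiliary K g X Z) : ∃ κ > 0, ∀ t, 0 ≤ t → ∀ n : Fin 2 → ℝ,
    κ * (n ⬝ᵥ n) ≤ n ⬝ᵥ coefM K (Z t) *ᵥ n := by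
  obtain ⟨hs, hα, hγ, hK⟩ := Kq_entries K
  obtain ⟨k, hk, hkq⟩ := exists_quadratic_form_lower_bound hα hγ hK
  obtain ⟨b, hb⟩ := (boundedFrom_scl hZ).2
  have hb' : 0 < b ^ 2 + 1 := by positivity
  refine ⟨1 / 2 * (k / (b ^ 2 + 1)), by positivity, fun t ht n => ?_⟩
  set A := scl (Z t) with hA
  have h1 : k / (b ^ 2 + 1) * (n ⬝ᵥ n) ≤ n ⬝ᵥ (Aᵀ * K.Kq * A) *ᵥ n := by
    rw [dotProduct_mulVec_transpose_mul]
    have hu := (Matrix.isUnit_iff_isUnit_det _).1 (fromBlocks_of_mem_SIM23 (hZ t ht).1).2.1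
    have h2 : n ⬝ᵥ n ≤ (b ^ 2 + 1) * ((A *ᵥ n) ⬝ᵥ (A *ᵥ n)) := by
      have h3 := mulVec_dotProduct_self_le A⁻¹ (A *ᵥ n)
      rw [mulVec_mulVec, Matrix.nonsing_inv_mul _ hu, one_mulVec] at h3
      refine h3.trans (mul_le_mul_of_nonneg_right ?_ ?_)
      · have := pow_le_pow_left₀ (norm_nonneg _) (hb t ht) 2
        linarith
      · exact Finset.sum_nonneg fun i _ => mul_self_nonneg _
    have h4 : ∀ v : Fin 2 → ℝ, k * (v ⬝ᵥ v) ≤ v ⬝ᵥ K.Kq *ᵥ v := fun v => by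
      have := hkq (v 0) (v 1)
      simp only [dotProduct, mulVec, Fin.sum_univ_two, hs]
      linarith
    refine le_trans ?_ (h4 _)
    rw [div_mul_eq_mul_div, div_le_iff₀ hb']
    nlinarith [mul_le_mul_of_nonneg_left h2 hk.le]
  have h5 : 0 ≤ n ⬝ᵥ (A⁻¹ * ((1 / 2 : ℝ) • K.prop + K.corr) * (A⁻¹)ᵀ) *ᵥ n := by
    have := dotProduct_mulVec_transpose_mul n (A⁻¹)ᵀ ((1 / 2 : ℝ) • K.prop + K.corr)
    rw [transpose_transpose] at this
    rw [this]
    generalize (A⁻¹)ᵀ *ᵥ n = v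
    have e : v ⬝ᵥ ((1 / 2 : ℝ) • K.prop + K.corr) *ᵥ v =
        (1 / 2 * K.kv + K.kd) * v 0 ^ 2 + (1 / 2 * K.kp + K.kc) * v 1 ^ 2 := by
      simp [dotProduct, mulVec, Fin.sum_univ_two, Gains.prop, Gains.corr]
      ring
    rw [e]
    have := K.kp_pos; have := K.kc_pos; have := K.kv_nonneg; have := K.kd_nonneg
    positivity
  rw [coefM, add_mulVec, dotProduct_add, smul_mulVec, dotProduct_smul, smul_eq_mul]
  linarith

theorem boundedFrom_SGamma (hZ : IsAuxiliary K g X Z) : BoundedFrom 0 fun t => SGamma K (Z t) := by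
  obtain ⟨h1, h2⟩ := boundedFrom_scl hZ
  simp only [SGamma_eq]
  exact (((h1.transpose.mul (.const _)).mul h1).const_smul _).sub
    (((h2.mul (.const _)).mul h2.transpose).const_smul _)

theorem bddLip_scl (hZ : IsAuxiliary K g X Z) : BddLip 0 fun t => scl (Z t) := by
  obtain ⟨h1, h2⟩ := boundedFrom_scl hZ
  exact h1.bddLip (fun t ht => hasDerivWithinAt_scl_Z hZ ht)
    (((BoundedFrom.const _).mul h1).sub (h1.mul (boundedFrom_SGamma hZ)))

theorem bddLip_inv_scl (hZ : IsAuxiliary K g X Z) : BddLip 0 fun t => (scl (Z t))⁻¹ := by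
  obtain ⟨h1, h2⟩ := boundedFrom_scl hZ
  refine h2.bddLip (fun t ht => hasDerivWithinAt_matrix_inv (hasDerivWithinAt_scl_Z hZ ht)
    (fromBlocks_of_mem_SIM23 (hZ t ht).1).2.1) ?_
  simpa only [neg_one_smul] using ((h2.mul (((BoundedFrom.const _).mul h1).sub
    (h1.mul (boundedFrom_SGamma hZ)))).mul h2).const_smul (-1)

theorem bddLip_coefM (hZ : IsAuxiliary K g X Z) : BddLip 0 fun t => coefM K (Z t) := by
  have h1 := bddLip_scl hZ
  have h2 := bddLip_inv_scl hZ
  exact (((h1.transpose.mul (.const _)).mul h1).const_smul _).add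
    ((h2.mul (.const _)).mul h2.transpose)

theorem boundedFrom_firstCol (hU : BoundedFrom 0 fun t => inputU (Ω t) (a t)) :
    BoundedFrom 0 fun t => firstCol (a t) := by
  obtain ⟨b, hb⟩ := hU
  refine ⟨b, fun t ht => le_trans ?_ (hb t ht)⟩
  apply le_of_sq_le_sq _ (norm_nonneg _)
  rw [frobenius_norm_sq, frobenius_norm_sq]
  simp only [inputU, Fintype.sum_sum_type, fromBlocks_apply₁₁, fromBlocks_apply₁₂,
    Finset.sum_add_distrib]
  have h1 : 0 ≤ ∑ i, ∑ j, skew (Ω t) i j ^ 2 := by positivity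
  simp only [fromBlocks_apply₂₁, fromBlocks_apply₂₂, Matrix.zero_apply]
  simp only [ne_eq, OfNat.ofNat_ne_zero, not_false_eq_true, zero_pow, Finset.sum_const_zero]
  linarith

/-- The relative translation is bounded: the difference `V_X A_Z - V_Z` obeys the linear equation of
the translation error, forced by the bounded input. -/
theorem bddLip_relTra (hX : IsSystem g Ω a X) (hZ : IsAuxiliary K g X Z)
    (hU : BoundedFrom 0 fun t => inputU (Ω t) (a t)) :
    BddLip 0 fun t => relTra (X t) (Z t) := by
  set N : ℝ → Matrix (Fin 3) (Fin 2) ℝ := fun t =>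
    (rot (Z t))ᵀ * (tra (X t) * scl (Z t) - tra (Z t)) with hN
  have hu := fun t (ht : 0 ≤ t) =>
    (Matrix.isUnit_iff_isUnit_det _).1 (fromBlocks_of_mem_SIM23 (hZ t ht).1).2.1
  have hP : ∀ t, 0 ≤ t → relTra (X t) (Z t) = N t * (scl (Z t))⁻¹ := fun t ht => by
    rw [relTra, hN]
    simp only [Matrix.mul_assoc, Matrix.sub_mul, Matrix.mul_nonsing_inv _ (hu t ht), Matrix.mul_one]
  set F : ℝ → Matrix (Fin 3) (Fin 2) ℝ := fun t =>
    (rot (Z t))ᵀ * rot (X t) * firstCol (a t) * scl (Z t)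
  have hN' : ∀ t, 0 ≤ t → HasDerivWithinAt N (-(N t * coefM K (Z t)) + F t) (Ici 0) t := by
    intro t ht
    refine (hasDerivWithinAt_matrix_mul (hasDerivWithinAt_matrix_transpose
      (hasDerivWithinAt_rot_Z hZ ht)) ((hasDerivWithinAt_matrix_mul (hasDerivWithinAt_tra_X hX ht)
      (hasDerivWithinAt_scl_Z hZ ht)).fun_sub (hasDerivWithinAt_tra_Z hZ ht))).congr_deriv ?_
    have h1 : ∀ M : Matrix (Fin 3) (Fin 2) ℝ, (rot (Z t))ᵀ * (rot (Z t) * M) = M := fun M => by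
      rw [← Matrix.mul_assoc, transpose_mul_of_mem_SO3 (fromBlocks_of_mem_SIM23 (hZ t ht).1).1,
        Matrix.one_mul]
    have h2 : N t * ((scl (Z t))⁻¹ * (K.prop + K.corr) * ((scl (Z t))⁻¹)ᵀ) =
        -WGamma K (X t) (Z t) := by
      rw [WGamma_eq, hP t ht, neg_neg]
      simp only [Matrix.mul_assoc]
    rw [coefM_eq, Matrix.mul_add, h2, neg_add, neg_neg]
    simp only [hN, F, matSD, transpose_zero, Matrix.zero_mul, Matrix.mul_sub,
      Matrix.mul_add, Matrix.add_mul, Matrix.sub_mul, h1, Matrix.mul_assoc]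
    abel
  obtain ⟨κ, hκ, hc⟩ := exists_coefM_coercive hZ
  have hA := bddLip_scl hZ
  have hA1 := (boundedFrom_scl hZ).1
  have hF : BoundedFrom 0 F := (((BoundedFrom.of_mem_SO3 fun t ht =>
    (fromBlocks_of_mem_SIM23 (hZ t ht).1).1).transpose.mul (BoundedFrom.of_mem_SO3 fun t ht =>
    (fromBlocks_of_mem_SE23 (hX t ht).1).1)).mul (boundedFrom_firstCol hU)).mul hA1
  have hNb := boundedFrom_of_coercive hκ hc hN' hF
  have hM : BoundedFrom 0 fun t => coefM K (Z t) := (bddLip_coefM hZ).bddUnifCont.1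
  refine BddLip.congr (BddLip.mul (hNb.bddLip hN' ?_) (bddLip_inv_scl hZ)) hP
  simpa only [neg_one_smul] using ((hNb.mul hM).const_smul (-1)).add hF

theorem bddLip_coefB (hX : IsSystem g Ω a X) (hZ : IsAuxiliary K g X Z)
    (hU : BoundedFrom 0 fun t => inputU (Ω t) (a t)) : BddLip 0 fun t => coefB K (X t) (Z t) :=
  ((bddLip_relTra hX hZ hU).mul (.const _)).mul (bddLip_inv_scl hZ).transpose

theorem relDir_eq (hZ : IsAuxiliary K g X Z) {t : ℝ} (ht : 0 ≤ t) :
    relDir m (Z t) = relDir m (Z 0) := by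
  rw [relDir, relDir, rot_Z_eq hZ ht]

theorem bddLip_coefS (hX : IsSystem g Ω a X) (hZ : IsAuxiliary K g X Z)
    (hU : BoundedFrom 0 fun t => inputU (Ω t) (a t)) : BddLip 0 fun t => coefS K m (X t) (Z t) := by
  have hP := bddLip_relTra hX hZ hU
  refine BddLip.add ((hP.mul (.const _)).mul hP.transpose) (BddLip.const_smul ?_ _)
  exact (BddLip.const _).congr fun t ht => by rw [relDir_eq hZ ht]

theorem bddLip_WGamma (hX : IsSystem g Ω a X) (hZ : IsAuxiliary K g X Z)
    (hU : BoundedFrom 0 fun t => inputU (Ω t) (a t)) : BddLip 0 fun t => WGamma K (X t) (Z t) := by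
  simp only [WGamma_eq]
  exact (((bddLip_relTra hX hZ hU).mul (.const _)).mul (bddLip_inv_scl hZ).transpose).neg

theorem bddLip_SGamma (hZ : IsAuxiliary K g X Z) : BddLip 0 fun t => SGamma K (Z t) := by
  have h1 := bddLip_scl hZ
  have h2 := bddLip_inv_scl hZ
  simp only [SGamma_eq]
  exact (((h1.transpose.mul (.const _)).mul h1).const_smul _).sub
    (((h2.mul (.const _)).mul h2.transpose).const_smul _)

/-! ### Persistence of excitation -/

theorem excitation_add (S T : Matrix (Fin 3) (Fin 3) ℝ) :
    excitation (S + T) = excitation S + excitation T := by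
  rw [excitation, excitation, excitation, trace_add, add_smul]; abel

theorem excitation_vecMulVec (v : Vec3) : excitation (vecMulVec v v) = -(skew v * skew v) := by
  ext i j
  fin_cases i <;> fin_cases j <;>
    simp [excitation, skew, Matrix.trace, Fin.sum_univ_three, vecMulVec_apply] <;> ring

theorem skew_transpose (v : Vec3) : (skew v)ᵀ = -skew v := by
  ext i j
  fin_cases i <;> fin_cases j <;> simp [skew]

theorem coefS_eq_sum (K : Gains) (m : Vec3) (X Z : ℝ → Mat5) (t : ℝ) :
    coefS K m (X t) (Z t) = vecMulVec (muP K X Z t) (muP K X Z t)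
      + vecMulVec (muV K X Z t) (muV K X Z t) + vecMulVec (muM K m Z t) (muM K m Z t) := by
  have hc : K.corr = K.kc • vecMulVec Cp Cp + K.kd • vecMulVec Cv Cv :=
    (smul_vecMulVec_add _ _).symm
  have h : ∀ (k : ℝ), 0 ≤ k → ∀ v : Vec3, vecMulVec (√k • v) (√k • v) = k • vecMulVec v v :=
    fun k hk v => by
      rw [smul_vecMulVec, vecMulVec_smul, smul_smul, Real.mul_self_sqrt hk]
  have e : ∀ (P : Matrix (Fin 3) (Fin 2) ℝ) (C : Fin 2 → ℝ),
      vecMulVec (P *ᵥ C) (P *ᵥ C) = P * vecMulVec C C * Pᵀ := fun P C => by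
    rw [Matrix.mul_vecMulVec, Matrix.vecMulVec_mul, Matrix.vecMul_transpose]
  rw [muP, muV, muM, h _ K.kc_pos.le, h _ K.kd_nonneg, h _ K.km_nonneg, recentre_hp, recentre_hv,
    mulVec_mulVec, mulVec_mulVec, e, e, coefS, hc]
  simp only [relTra, relDir, Matrix.mul_add, Matrix.add_mul, Matrix.mul_smul, Matrix.smul_mul]

theorem excitation_coefS (K : Gains) (m : Vec3) (X Z : ℝ → Mat5) (t : ℝ) :
    excitation (coefS K m (X t) (Z t)) = -∑ k, skew (![muP K X Z, muV K X Z, muM K m Z] k t)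
      * skew (![muP K X Z, muV K X Z, muM K m Z] k t) := by
  rw [coefS_eq_sum, excitation_add, excitation_add, excitation_vecMulVec, excitation_vecMulVec,
    excitation_vecMulVec, Fin.sum_univ_three, neg_add, neg_add]
  rfl

theorem excitation_coefS_nonneg (K : Gains) (m : Vec3) (X Z : ℝ → Mat5) (t : ℝ) (w : Vec3) :
    0 ≤ w ⬝ᵥ excitation (coefS K m (X t) (Z t)) *ᵥ w := by
  have h : ∀ v : Vec3, 0 ≤ w ⬝ᵥ excitation (vecMulVec v v) *ᵥ w := fun v => by
    rw [excitation_vecMulVec, ← Matrix.neg_mul, ← skew_transpose, ← mulVec_mulVec,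
      dotProduct_mulVec, vecMul_transpose]
    exact Finset.sum_nonneg fun i _ => mul_self_nonneg _
  rw [coefS_eq_sum, excitation_add, excitation_add, add_mulVec, add_mulVec, dotProduct_add,
    dotProduct_add]
  exact add_nonneg (add_nonneg (h _) (h _)) (h _)

/-- The error dynamics of the observer as `ErrorData`. The coefficients are frozen at negative times,
where they are not controlled, by means of `t ↦ max t 0`. -/
theorem exists_errorData (hX : IsSystem g Ω a X) (hZ : IsAuxiliary K g X Z)
    (hU : BoundedFrom 0 fun t => inputU (Ω t) (a t))
    (hPE : PersistentlyExciting ![muP K X Z, muV K X Z, muM K m Z]) :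
    ∃ D : ErrorData, ∀ t, 0 ≤ t → D.S t = coefS K m (X t) (Z t) ∧
      D.B t = coefB K (X t) (Z t) ∧ D.M t = coefM K (Z t) := by
  obtain ⟨δ, hδ, T, hT, hPE⟩ := hPE
  obtain ⟨κ, hκ, hc⟩ := exists_coefM_coercive hZ
  have hS := bddLip_coefS (m := m) hX hZ hU
  have hB := bddLip_coefB hX hZ hU
  have hM := bddLip_coefM hZ
  have hSc := hS.continuous_max
  obtain ⟨bS, hbS⟩ := hS.bddUnifCont.1
  obtain ⟨bB, hbB⟩ := hB.bddUnifCont.1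
  obtain ⟨bM, hbM⟩ := hM.bddUnifCont.1
  have hcont : ∀ i j, Continuous fun t =>
      excitation (coefS K m (X (max t 0)) (Z (max t 0))) i j := by
    intro i j
    have h : Continuous fun t => excitation (coefS K m (X (max t 0)) (Z (max t 0))) :=
      (hSc.matrix_trace.smul continuous_const).sub hSc
    exact h.matrix_elem i j
  refine ⟨{ S := fun t => coefS K m (X (max t 0)) (Z (max t 0))
            B := fun t => coefB K (X (max t 0)) (Z (max t 0))
            M := fun t => coefM K (Z (max t 0))
            S_cont := hSc
            B_cont := hB.continuous_max
            M_cont := hM.continuous_max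
            bound := max bS (max bB bM)
            S_le := fun t => (hbS _ (le_max_right _ _)).trans (le_max_left _ _)
            B_le := fun t => (hbB _ (le_max_right _ _)).trans
              ((le_max_left _ _).trans (le_max_right _ _))
            M_le := fun t => (hbM _ (le_max_right _ _)).trans
              ((le_max_right _ _).trans (le_max_right _ _))
            S_symm := fun t => coefS_transpose _ _ _ _
            exc_nonneg := fun t w => excitation_coefS_nonneg _ _ _ _ _ _
            δ := δ
            T := T
            δ_pos := hδ
            T_pos := hT
            excited := fun t ht w => ?_
            κM := κ
            κM_pos := hκ
            coercive := fun t n => hc _ (le_max_right _ _) n }, fun t ht => ?_⟩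
  · have h1 := (hPE t ht).posSemidef.dotProduct_mulVec_nonneg w
    have h2 : (-(Matrix.of fun i j => ∫ τ in t..(t + T), (∑ k,
        skew (![muP K X Z, muV K X Z, muM K m Z] k τ)
          * skew (![muP K X Z, muV K X Z, muM K m Z] k τ)) i j)) =
        Matrix.of fun i j => ∫ τ in t..(t + T),
          excitation (coefS K m (X (max τ 0)) (Z (max τ 0))) i j := by
      ext i j
      rw [Matrix.neg_apply, of_apply, of_apply, ← intervalIntegral.integral_neg]
      refine intervalIntegral.integral_congr fun τ hτ => ?_
      rw [uIcc_of_le (by linarith)] at hτ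
      simp only [max_eq_left (ht.trans hτ.1), excitation_coefS, Matrix.neg_apply]
    have h3 : w ⬝ᵥ (Matrix.of fun i j => ∫ τ in t..(t + T),
          excitation (coefS K m (X (max τ 0)) (Z (max τ 0))) i j) *ᵥ w =
        ∫ τ in t..(t + T), w ⬝ᵥ excitation (coefS K m (X (max τ 0)) (Z (max τ 0))) *ᵥ w := by
      simp only [dotProduct, mulVec, of_apply]
      rw [intervalIntegral.integral_finsetSum fun i _ => ?_]
      · refine Finset.sum_congr rfl fun i _ => ?_
        rw [intervalIntegral.integral_const_mul, intervalIntegral.integral_finsetSum fun j _ => ?_]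
        · simp only [intervalIntegral.integral_mul_const]
        · exact ((hcont i j).mul continuous_const).intervalIntegrable _ _
      · exact (continuous_const.mul (continuous_finsetSum _ fun j _ =>
          (hcont i j).mul continuous_const)).intervalIntegrable _ _
    rw [h2, star_trivial, sub_mulVec, dotProduct_sub, smul_mulVec, one_mulVec, dotProduct_smul,
      h3, smul_eq_mul] at h1
    linarith
  · simp only [max_eq_left ht, and_self]

end

/-! ### Convergence and equilibria of the error dynamics -/

theorem tendsto_fromBlocks_one {R : ℝ → Matrix (Fin 3) (Fin 3) ℝ}
    {V : ℝ → Matrix (Fin 3) (Fin 2) ℝ}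
    (hR : Tendsto R atTop (𝓝 1)) (hV : Tendsto V atTop (𝓝 0)) :
    Tendsto (fun t => fromBlocks (R t) (V t) 0 1 : ℝ → Mat5) atTop (𝓝 1) := by
  have h : Continuous fun p : Matrix (Fin 3) (Fin 3) ℝ × Matrix (Fin 3) (Fin 2) ℝ =>
      (fromBlocks p.1 p.2 0 1 : Mat5) :=
    continuous_fst.matrix_fromBlocks continuous_snd continuous_const continuous_const
  have := (h.tendsto (1, 0)).comp (hR.prodMk_nhds hV)
  rwa [fromBlocks_one] at this

theorem trace_one_sub_of_quat {R : Matrix (Fin 3) (Fin 3) ℝ} {x : Fin 4 → ℝ} (hx : x ≠ 0)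
    (hR : quatRot x = R) : (1 - R).trace = 4 * (1 - x 0 ^ 2 / normSq x) ∧
      ‖R - 1‖ ^ 2 = 2 * (1 - R).trace := by
  have h := (normSq_pos hx).ne'
  rw [← hR, trace_quatRot hx, norm_quatRot_sub_one_sq hx]
  have := normSq_eq x
  constructor
  · field_simp; rw [this]; ring
  · ring

/-- Half turns are represented by purely imaginary quaternions. -/
theorem apply_zero_of_trace_eq {R : Matrix (Fin 3) (Fin 3) ℝ} {x : Fin 4 → ℝ} (hx : x ≠ 0)
    (hR : quatRot x = R) (htr : R.trace = -1) : x 0 = 0 := by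
  have h := (trace_one_sub_of_quat hx hR).1
  rw [trace_sub, htr, trace_one, Fintype.card_fin] at h
  have h0 : x 0 ^ 2 / normSq x = 0 := by push_cast at h; linarith
  rcases div_eq_zero_iff.1 h0 with h | h
  · exact pow_eq_zero_iff two_ne_zero |>.1 h
  · exact absurd h (normSq_pos hx).ne'

theorem cost_fromBlocks (R : Matrix (Fin 3) (Fin 3) ℝ) (V : Matrix (Fin 3) (Fin 2) ℝ) :
    cost (fromBlocks R V 0 1) = (1 - R).trace + ‖V‖ ^ 2 := by
  rw [cost, rot, tra, toBlocks_fromBlocks₁₁, toBlocks_fromBlocks₁₂]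

namespace ErrorData

variable {D : ErrorData} {t₀ : ℝ} {R : ℝ → Matrix (Fin 3) (Fin 3) ℝ}
  {V : ℝ → Matrix (Fin 3) (Fin 2) ℝ}

theorem IsTra.eq_zero (hV : D.IsTra t₀ V) (h0 : V t₀ = 0) {t : ℝ} (ht : t₀ ≤ t) : V t = 0 := by
  have := hV.norm_le ht
  rw [h0, norm_zero, mul_zero] at this
  exact norm_le_zero_iff.1 this

theorem G_zero (D : ErrorData) (t : ℝ) : D.G t 0 = D.S t := by
  rw [G, transpose_zero, Matrix.mul_zero, sub_zero]

/-- Without translation error, the real part of the quaternion is conserved. -/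
theorem IsLift.apply_zero_eq {x : ℝ → Fin 4 → ℝ} (hV : D.IsTra t₀ V) (h0 : V t₀ = 0)
    (hx : D.IsLift t₀ V x) {t : ℝ} (ht : t₀ ≤ t) : x t 0 = x t₀ 0 := by
  have hd : ∀ t ∈ Ici t₀, HasDerivWithinAt (fun t => x t 0) 0 (Ici t₀) t := fun t ht => by
    refine (hasDerivWithinAt_pi.1 (hx t ht) 0).congr_deriv ?_
    rw [hV.eq_zero h0 ht, G_zero, quatGen_mulVec_zero]
  have := (convex_Ici t₀).norm_image_sub_le_of_norm_hasDerivWithin_le (C := 0) hd (by simp)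
    (mem_Ici.2 le_rfl) (mem_Ici.2 ht)
  rw [zero_mul] at this
  exact sub_eq_zero.1 (norm_le_zero_iff.1 this)

/-- The error whose attitude is represented by the quaternion `x₀` converges to the identity if the
limit functional does not vanish at `x₀`. -/
theorem IsErr.tendsto_one (ht₀ : 0 ≤ t₀) (h : D.IsErr t₀ R V) {x₀ : Fin 4 → ℝ} (hx₀ : x₀ ≠ 0)
    (hR : quatRot x₀ = R t₀) {L : Matrix (Fin 3) (Fin 2) ℝ → (Fin 4 → ℝ) →ₗ[ℝ] ℝ}
    (hL : ∀ V x, D.IsTra t₀ V → D.IsLift t₀ V x →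
      Tendsto (fun t => x t 0) atTop (𝓝 (L (V t₀) (x t₀)))) (hne : L (V t₀) x₀ ≠ 0) :
    Tendsto R atTop (𝓝 1) := by
  obtain ⟨x, h0, hx, hxR⟩ := h.exists_lift hx₀ hR
  have := hx.quatRot_tendsto_one ht₀ h.tra (hL V x h.tra hx) (by rwa [h0])
  refine this.congr' ?_
  filter_upwards [eventually_ge_atTop t₀] with t ht using (hxR t ht).2.symm

/-- At an error without translation part, on the identity or on a half turn, the cost stays
constant. -/
theorem IsErr.cost_eq (h : D.IsErr t₀ R V) (hV : V t₀ = 0) (hR : R t₀ = 1 ∨ (R t₀).trace = -1)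
    {t : ℝ} (ht : t₀ ≤ t) : cost (fromBlocks (R t) (V t) 0 1) =
      cost (fromBlocks (R t₀) (V t₀) 0 1) := by
  rw [cost_fromBlocks, cost_fromBlocks, h.tra.eq_zero hV ht, hV]
  congr 1
  rcases hR with hR | hR
  · have h1 : D.IsRot t₀ V fun _ => 1 := fun t ht => by
      refine (hasDerivWithinAt_const t _ (1 : Matrix (Fin 3) (Fin 3) ℝ)).congr_deriv ?_
      rw [h.tra.eq_zero hV ht, G_zero, D.S_symm, Matrix.one_mul, Matrix.mul_one, sub_self,
        smul_zero]
    rw [h.rot.unique h.tra h1 h.mem (fun _ _ => one_mem _) hR ht, hR]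
  · obtain ⟨x₀, hx₀, hq⟩ := exists_quatRot_eq (h.mem t₀ le_rfl)
    obtain ⟨x, h0, hx, hxR⟩ := h.exists_lift hx₀ hq
    have e0 := (trace_one_sub_of_quat hx₀ hq).1
    have hz := apply_zero_of_trace_eq hx₀ hq hR
    obtain ⟨hxt, hRt⟩ := hxR t ht
    have e1 := (trace_one_sub_of_quat hxt hRt.symm).1
    have hzt : x t 0 = 0 := by rw [hx.apply_zero_eq h.tra hV ht, h0, hz]
    rw [hz] at e0
    rw [hzt] at e1
    rw [e0, e1, zero_pow two_ne_zero, zero_div, zero_div]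

/-- If the cost is constant along an error without translation part, the attitude error is the
identity or a half turn: otherwise the real part of the quaternion, which is conserved, is
nonzero, and the error converges to the identity. -/
theorem IsErr.eq_one_or_trace (ht₀ : 0 ≤ t₀) (h : D.IsErr t₀ R V) (hV : V t₀ = 0)
    (hc : ∀ t, t₀ ≤ t → cost (fromBlocks (R t) (V t) 0 1) =
      cost (fromBlocks (R t₀) (V t₀) 0 1)) : R t₀ = 1 ∨ (R t₀).trace = -1 := by
  obtain ⟨L, hL, -, -, hL0⟩ := D.exists_limit_functional ht₀
  obtain ⟨x₀, hx₀, hq⟩ := exists_quatRot_eq (h.mem t₀ le_rfl)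
  obtain ⟨e1, e2⟩ := trace_one_sub_of_quat hx₀ hq
  by_cases hz : x₀ 0 = 0
  · right
    rw [hz, trace_sub, trace_one, Fintype.card_fin] at e1
    push_cast at e1
    norm_num at e1
    linarith
  · left
    have hR := h.tendsto_one ht₀ hx₀ hq hL (by rwa [hV, hL0])
    have h1 : Tendsto (fun t => (1 - R t).trace + ‖V t‖ ^ 2) atTop (𝓝 0) := by
      have h2 : Tendsto (fun t => (1 - R t).trace) atTop
          (𝓝 (1 - 1 : Matrix (Fin 3) (Fin 3) ℝ).trace) :=
        ((continuous_const.sub continuous_id).matrix_trace.tendsto 1).comp hR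
      have h3 := (h.tra.tendsto_zero.norm).pow 2
      have := h2.add h3
      simpa using this
    have h2 : Tendsto (fun t => (1 - R t).trace + ‖V t‖ ^ 2) atTop
        (𝓝 ((1 - R t₀).trace + ‖V t₀‖ ^ 2)) := by
      refine tendsto_const_nhds.congr' ?_
      filter_upwards [eventually_ge_atTop t₀] with t ht
      have := hc t ht
      rw [cost_fromBlocks, cost_fromBlocks] at this
      exact this.symm
    have h3 := tendsto_nhds_unique h2 h1
    rw [hV, norm_zero, zero_pow two_ne_zero, add_zero] at h3
    rw [h3, mul_zero] at e2
    exact sub_eq_zero.1 (norm_eq_zero.1 ((pow_eq_zero_iff two_ne_zero).1 e2))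

theorem hasDerivWithinAt_cost (h : D.IsErr t₀ R V) {t : ℝ} (ht : t₀ ≤ t) :
    HasDerivWithinAt (fun t => cost (fromBlocks (R t) (V t) 0 1))
      (-(4 * ((1 - R t * R t) * D.G t (V t)).trace) - 2 * (V t * D.M t * (V t)ᵀ).trace)
      (Ici t₀) t := by
  have h1 := hasDerivWithinAt_matrix.1 (h.rot t ht)
  have h2 := hasDerivWithinAt_matrix.1 (h.tra t ht)
  have h3 : HasDerivWithinAt (fun t => (1 - R t).trace)
      (-((4 : ℝ) • ((D.G t (V t))ᵀ - R t * D.G t (V t) * R t)).trace) (Ici t₀) t := by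
    simp only [trace_sub, trace_fin_three]
    exact ((((h1 0 0).fun_add (h1 1 1)).fun_add (h1 2 2)).const_sub _)
  have h4 : HasDerivWithinAt (fun t => ‖V t‖ ^ 2)
      (∑ i, ∑ j, 2 * V t i j * (-(V t * D.M t)) i j) (Ici t₀) t := by
    simp only [frobenius_norm_sq]
    refine HasDerivWithinAt.fun_sum fun i _ => HasDerivWithinAt.fun_sum fun j _ => ?_
    exact ((h2 i j).fun_pow 2).congr_deriv (by ring)
  simp only [cost_fromBlocks]
  refine (h3.fun_add h4).congr_deriv ?_
  have e1 : (R t * D.G t (V t) * R t).trace = (R t * R t * D.G t (V t)).trace := by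
    rw [trace_mul_comm, ← Matrix.mul_assoc]
  have e2 : ∑ i, ∑ j, 2 * V t i j * (-(V t * D.M t)) i j =
      -(2 * (V t * D.M t * (V t)ᵀ).trace) := by
    rw [Matrix.trace, Finset.mul_sum, ← Finset.sum_neg_distrib]
    refine Finset.sum_congr rfl fun i _ => ?_
    rw [diag_apply, Matrix.mul_apply (M := V t * D.M t), Finset.mul_sum, ← Finset.sum_neg_distrib]
    refine Finset.sum_congr rfl fun j _ => ?_
    rw [Matrix.neg_apply, transpose_apply]; ring
  rw [e2, trace_smul, trace_sub, trace_transpose, e1, Matrix.sub_mul, Matrix.one_mul, trace_sub,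
    smul_eq_mul]
  ring

end ErrorData

/-- Completion of squares in the derivative of the cost. With `P` the relative translation,
`W = V A⁻¹`, `N` the correction gains and `c` the contribution of the reference direction, both
traces on the right are nonnegative. The terms of `V M Vᵀ` that are not used here, with `K_q` and
the proportional gains, bound the decrease of the cost from below. -/
theorem cost_deriv_eq {R : Matrix (Fin 3) (Fin 3) ℝ} (hR : R ∈ specialOrthogonalGroup (Fin 3) ℝ)
    (P W : Matrix (Fin 3) (Fin 2) ℝ) {N : Matrix (Fin 2) (Fin 2) ℝ} (hN : Nᵀ = N)
    (c : Matrix (Fin 3) (Fin 3) ℝ) (hc : cᵀ = c) :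
    4 * ((1 - R * R) * (P * N * Pᵀ + c - P * N * Wᵀ)).trace + 2 * (W * N * Wᵀ).trace =
      2 * (((R - Rᵀ) * P + Rᵀ * W) * N * ((R - Rᵀ) * P + Rᵀ * W)ᵀ).trace
        + 2 * ((R - Rᵀ) * c * (R - Rᵀ)ᵀ).trace := by
  have h1 := mul_transpose_of_mem_SO3 hR
  have h2 := transpose_mul_of_mem_SO3 hR
  have h1' : ∀ {n : ℕ} (M : Matrix (Fin 3) (Fin n) ℝ), R * (Rᵀ * M) = M := fun M => by
    rw [← Matrix.mul_assoc, h1, Matrix.one_mul]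
  have hsq : ∀ S : Matrix (Fin 3) (Fin 3) ℝ, Sᵀ = S →
      ((R - Rᵀ) * S * (R - Rᵀ)ᵀ).trace = 2 * ((1 - R * R) * S).trace := by
    intro S hS
    have e : ((Rᵀ * Rᵀ) * S).trace = (R * R * S).trace := by
      rw [← trace_transpose, transpose_mul, transpose_mul, transpose_transpose, hS,
        trace_mul_comm]
    rw [trace_mul_comm, ← Matrix.mul_assoc, transpose_sub, transpose_transpose, Matrix.sub_mul,
      Matrix.mul_sub, Matrix.mul_sub, h1, h2]
    simp only [Matrix.sub_mul, trace_sub, e, Matrix.one_mul]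
    ring
  have hcross : ∀ S : Matrix (Fin 3) (Fin 3) ℝ,
      ((R - Rᵀ) * S * R).trace = -((1 - R * R) * S).trace := by
    intro S
    rw [trace_mul_comm, ← Matrix.mul_assoc, Matrix.mul_sub, h1, ← trace_neg, ← Matrix.neg_mul,
      neg_sub]
  have hS0 : (P * N * Pᵀ)ᵀ = P * N * Pᵀ := by
    simp only [transpose_mul, transpose_transpose, hN, Matrix.mul_assoc]
  have e1 : ((R - Rᵀ) * P * N * ((R - Rᵀ) * P)ᵀ).trace = 2 * ((1 - R * R) * (P * N * Pᵀ)).trace := by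
    rw [← hsq _ hS0, transpose_mul]
    simp only [Matrix.mul_assoc]
  have e2 : ((R - Rᵀ) * P * N * (Rᵀ * W)ᵀ).trace = -((1 - R * R) * (P * N * Wᵀ)).trace := by
    rw [← hcross, transpose_mul, transpose_transpose]
    simp only [Matrix.mul_assoc]
  have e3 : (Rᵀ * W * N * ((R - Rᵀ) * P)ᵀ).trace = -((1 - R * R) * (P * N * Wᵀ)).trace := by
    rw [← e2, ← trace_transpose]
    simp only [transpose_mul, transpose_transpose, hN, Matrix.mul_assoc]
  have e4 : (Rᵀ * W * N * (Rᵀ * W)ᵀ).trace = (W * N * Wᵀ).trace := by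
    rw [transpose_mul, transpose_transpose, trace_mul_comm]
    simp only [Matrix.mul_assoc, h1']
    rw [trace_mul_comm, Matrix.mul_assoc]
  rw [hsq c hc, transpose_add]
  simp only [Matrix.add_mul, Matrix.mul_add, Matrix.mul_sub, trace_add, trace_sub, e1, e2, e3, e4]
  ring

/-! ### Errors and estimates -/

section

variable {K : Gains} {g m : Vec3} {Ω a : ℝ → Vec3} {X Z Xh : ℝ → Mat5} {t₀ : ℝ} {D : ErrorData}

/-- The error data `D` describes the error dynamics of the observer. -/
def Represents (D : ErrorData) (K : Gains) (m : Vec3) (X Z : ℝ → Mat5) : Prop :=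
  ∀ t, 0 ≤ t → D.S t = coefS K m (X t) (Z t) ∧ D.B t = coefB K (X t) (Z t) ∧ D.M t = coefM K (Z t)

theorem Represents.G_eq (hD : Represents D K m X Z) {t : ℝ} (ht : 0 ≤ t)
    (V : Matrix (Fin 3) (Fin 2) ℝ) : D.G t V = coefG K m (X t) (Z t) V := by
  rw [ErrorData.G, coefG, (hD t ht).1, (hD t ht).2.1]

theorem err_eq (hX : IsSystem g Ω a X) (hZ : IsAuxiliary K g X Z) (ht₀ : 0 ≤ t₀)
    (hXh : IsEstimate K g m Ω a X Z t₀ Xh) {t : ℝ} (ht : t₀ ≤ t) :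
    rot (err X Z Xh t) ∈ specialOrthogonalGroup (Fin 3) ℝ ∧
      err X Z Xh t = fromBlocks (rot (err X Z Xh t)) (tra (err X Z Xh t)) 0 1 :=
  fromBlocks_of_mem_SE23 (inv_mul_mul_inv_mul_mem_SE23 (hX t (ht₀.trans ht)).1 (hXh t ht).1
    (hZ t (ht₀.trans ht)).1)

theorem isErr_of_isEstimate (hD : Represents D K m X Z) (hX : IsSystem g Ω a X)
    (hZ : IsAuxiliary K g X Z) (ht₀ : 0 ≤ t₀) (hXh : IsEstimate K g m Ω a X Z t₀ Xh) :
    D.IsErr t₀ (fun t => rot (err X Z Xh t)) (fun t => tra (err X Z Xh t)) := by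
  have hd : ∀ t, t₀ ≤ t → HasDerivWithinAt (err X Z Xh)
      (fromBlocks ((4 : ℝ) • ((D.G t (tra (err X Z Xh t)))ᵀ
        - rot (err X Z Xh t) * D.G t (tra (err X Z Xh t)) * rot (err X Z Xh t)))
        (-(tra (err X Z Xh t) * D.M t)) 0 0) (Ici t₀) t := by
    intro t ht
    have ht' := ht₀.trans ht
    obtain ⟨hR, he⟩ := err_eq hX hZ ht₀ hXh ht
    have hkey := err_mul (X := X) (hXh t ht).1 (hZ t ht').1
    refine (hasDerivWithinAt_err hX hZ ht₀ hXh ht).congr_deriv ?_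
    rw [hD.G_eq ht', (hD t ht').2.2, ← error_field (hX t ht').1 (hXh t ht).1 (hZ t ht').1 hR
      (he ▸ hkey), ← he]
  exact ⟨fun t ht => hasDerivWithinAt_submatrix Sum.inl Sum.inr (hd t ht),
    fun t ht => hasDerivWithinAt_submatrix Sum.inl Sum.inl (hd t ht),
    fun t ht => (err_eq hX hZ ht₀ hXh ht).1⟩

theorem exists_estimate_of_isErr (hD : Represents D K m X Z) (hX : IsSystem g Ω a X)
    (hZ : IsAuxiliary K g X Z) (ht₀ : 0 ≤ t₀) {R : ℝ → Matrix (Fin 3) (Fin 3) ℝ}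
    {V : ℝ → Matrix (Fin 3) (Fin 2) ℝ} (h : D.IsErr t₀ R V) :
    ∃ Xh, IsEstimate K g m Ω a X Z t₀ Xh ∧
      ∀ t, t₀ ≤ t → err X Z Xh t = fromBlocks (R t) (V t) 0 1 := by
  refine exists_isEstimate hX hZ ht₀ h.mem (fun t ht => ?_) (fun t ht => ?_)
  · rw [← hD.G_eq (ht₀.trans ht)]; exact h.rot t ht
  · rw [← (hD t (ht₀.trans ht)).2.2]; exact h.tra t ht

theorem exists_estimate_of_err_eq (hD : Represents D K m X Z) (hX : IsSystem g Ω a X)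
    (hZ : IsAuxiliary K g X Z) (ht₀ : 0 ≤ t₀) {R₀ : Matrix (Fin 3) (Fin 3) ℝ}
    (hR₀ : R₀ ∈ specialOrthogonalGroup (Fin 3) ℝ) (V₀ : Matrix (Fin 3) (Fin 2) ℝ) :
    ∃ Xh, IsEstimate K g m Ω a X Z t₀ Xh ∧ err X Z Xh t₀ = fromBlocks R₀ V₀ 0 1 := by
  obtain ⟨R, V, h, hR, hV⟩ := D.exists_isErr t₀ hR₀ V₀
  obtain ⟨Xh, h1, h2⟩ := exists_estimate_of_isErr hD hX hZ ht₀ h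
  exact ⟨Xh, h1, by rw [h2 t₀ le_rfl, hR, hV]⟩

theorem tendsto_err_one (hX : IsSystem g Ω a X) (hZ : IsAuxiliary K g X Z) (ht₀ : 0 ≤ t₀)
    (hXh : IsEstimate K g m Ω a X Z t₀ Xh)
    (hR : Tendsto (fun t => rot (err X Z Xh t)) atTop (𝓝 1))
    (hV : Tendsto (fun t => tra (err X Z Xh t)) atTop (𝓝 0)) :
    Tendsto (err X Z Xh) atTop (𝓝 1) := by
  refine (tendsto_fromBlocks_one hR hV).congr' ?_
  filter_upwards [eventually_ge_atTop t₀] with t ht using (err_eq hX hZ ht₀ hXh ht).2.symm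

/-! ### Innovation terms and convergence of the estimate -/

theorem norm_fromBlocks_sq (A : Matrix (Fin 3) (Fin 3) ℝ) (B : Matrix (Fin 3) (Fin 2) ℝ) :
    ‖(fromBlocks A B 0 0 : Mat5)‖ ^ 2 = ‖A‖ ^ 2 + ‖B‖ ^ 2 := by
  rw [frobenius_norm_sq, frobenius_norm_sq, frobenius_norm_sq]
  simp [Fintype.sum_sum_type, Finset.sum_add_distrib]

theorem norm_fromBlocks_le (A : Matrix (Fin 3) (Fin 3) ℝ) (B : Matrix (Fin 3) (Fin 2) ℝ) :
    ‖A‖ ≤ ‖(fromBlocks A B 0 0 : Mat5)‖ ∧ ‖B‖ ≤ ‖(fromBlocks A B 0 0 : Mat5)‖ ∧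
      ‖(fromBlocks A B 0 0 : Mat5)‖ ≤ ‖A‖ + ‖B‖ := by
  have h := norm_fromBlocks_sq A B
  have hA := norm_nonneg A
  have hB := norm_nonneg B
  have hC := norm_nonneg (fromBlocks A B 0 0 : Mat5)
  exact ⟨by nlinarith, by nlinarith, by nlinarith⟩

theorem fromBlocks_sub_one (R : Matrix (Fin 3) (Fin 3) ℝ) (V : Matrix (Fin 3) (Fin 2) ℝ) :
    (fromBlocks R V 0 1 : Mat5) - 1 = fromBlocks (R - 1) V 0 0 := by
  rw [← fromBlocks_one, fromBlocks_sub_fromBlocks, sub_zero, sub_zero, sub_self]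

/-- The innovation terms are polynomials in bounded Lipschitz signals. -/
theorem innovations_bddUnifCont (hD : Represents D K m X Z) (hX : IsSystem g Ω a X)
    (hZ : IsAuxiliary K g X Z) (hU : BoundedFrom 0 fun t => inputU (Ω t) (a t)) (ht₀ : 0 ≤ t₀)
    (hXh : IsEstimate K g m Ω a X Z t₀ Xh) :
    BddUnifCont t₀ (fun t => OmegaDelta K m (X t) (Xh t) (Z t)) ∧
      BddUnifCont t₀ (fun t => WDelta K (X t) (Xh t) (Z t)) ∧
      BddUnifCont t₀ (fun _ => OmegaGamma) ∧
      BddUnifCont t₀ (fun t => WGamma K (X t) (Z t)) ∧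
      BddUnifCont t₀ (fun t => SGamma K (Z t)) := by
  have h := isErr_of_isEstimate hD hX hZ ht₀ hXh
  set R := fun t => rot (err X Z Xh t) with hR
  set V := fun t => tra (err X Z Xh t) with hV
  have hP := (bddLip_relTra hX hZ hU).mono ht₀
  have hA := (bddLip_inv_scl hZ).mono ht₀
  have hS : BddLip t₀ fun t => D.S t :=
    ((bddLip_coefS (m := m) hX hZ hU).mono ht₀).congr fun t ht => (hD t (ht₀.trans ht)).1
  have hB : BddLip t₀ fun t => D.B t :=
    ((bddLip_coefB hX hZ hU).mono ht₀).congr fun t ht => (hD t (ht₀.trans ht)).2.1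
  have hW := (bddLip_WGamma hX hZ hU).mono ht₀
  have hVb : BoundedFrom t₀ V := ⟨‖V t₀‖, fun t ht => (h.tra.norm_le ht).trans
    (mul_le_of_le_one_left (norm_nonneg _) (Real.exp_le_one_iff.2
      (by nlinarith [D.κM_pos])))⟩
  have hVL : BddLip t₀ V := hVb.bddLip h.tra (by
    simpa only [neg_one_smul] using (hVb.mul ⟨D.bound, fun t _ => D.M_le t⟩).const_smul (-1))
  have hG : BddLip t₀ fun t => D.G t (V t) := hS.sub (hB.mul hVL.transpose)
  have hRb : BoundedFrom t₀ R := BoundedFrom.of_mem_SO3 h.mem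
  have hGb := hG.bddUnifCont.1
  have hRL : BddLip t₀ R :=
    hRb.bddLip h.rot ((hGb.transpose.sub ((hRb.mul hGb).mul hRb)).const_smul 4)
  have hkey : ∀ t, t₀ ≤ t → fromBlocks (R t) (V t) 0 1 * ((Z t)⁻¹ * Xh t) = (Z t)⁻¹ * X t :=
    fun t ht => by
      rw [hR, hV, ← (err_eq hX hZ ht₀ hXh ht).2]
      exact err_mul (hXh t ht).1 (hZ t (ht₀.trans ht)).1
  refine ⟨(BddLip.of_skew ?_).bddUnifCont, BddLip.bddUnifCont ?_, (BddLip.const _).bddUnifCont,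
    hW.bddUnifCont, ((bddLip_SGamma hZ).mono ht₀).bddUnifCont⟩
  · refine (((hG.mul hRL).sub (hRL.transpose.mul hG.transpose)).const_smul 4).congr fun t ht => ?_
    have ht' := ht₀.trans ht
    rw [hD.G_eq ht']
    exact skew_OmegaDelta_eq (hX t ht').1 (hXh t ht).1 (hZ t ht').1 (h.mem t ht) (hkey t ht)
  · refine (hW.neg.sub (((hRL.transpose.mul (hP.sub (hVL.mul hA))).mul
      (.const (K.prop + K.corr))).mul hA.transpose)).congr fun t ht => ?_
    have ht' := ht₀.trans ht
    exact WDelta_add_WGamma (hX t ht').1 (hXh t ht).1 (hZ t ht').1 (h.mem t ht) (hkey t ht)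

/-- The estimate converges to the state along with the error: both are compared in the frame of
`Z`, in which the translation part of the state is bounded. -/
theorem tendsto_sub_of_tendsto_err (hX : IsSystem g Ω a X) (hZ : IsAuxiliary K g X Z)
    (hU : BoundedFrom 0 fun t => inputU (Ω t) (a t)) (ht₀ : 0 ≤ t₀)
    (hXh : IsEstimate K g m Ω a X Z t₀ Xh)
    (h : Tendsto (fun t => ‖err X Z Xh t - 1‖) atTop (𝓝 0)) :
    Tendsto (fun t => ‖X t - Xh t‖) atTop (𝓝 0) := by
  obtain ⟨bP, hbP⟩ := (bddLip_relTra hX hZ hU).bddUnifCont.1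
  obtain ⟨bA, hbA⟩ := (boundedFrom_scl hZ).2
  have hle : ∀ t, t₀ ≤ t → ‖X t - Xh t‖ ≤
      (9 * (9 * 9) + 9 * (bP + 9 * bA)) * ‖err X Z Xh t - 1‖ := by
    intro t ht
    have ht' := ht₀.trans ht
    obtain ⟨hR, he⟩ := err_eq hX hZ ht₀ hXh ht
    have hkey := err_mul (X := X) (hXh t ht).1 (hZ t ht').1
    rw [he] at hkey
    obtain ⟨h1, h2⟩ := estimate_blocks (hX t ht').1 (hXh t ht).1 (hZ t ht').1 hR hkey
    obtain ⟨hX1, hX2⟩ := fromBlocks_of_mem_SE23 (hX t ht').1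
    obtain ⟨hY1, hY2⟩ := fromBlocks_of_mem_SE23 (hXh t ht).1
    have hZ1 := (fromBlocks_of_mem_SIM23 (hZ t ht').1).1
    rw [he, fromBlocks_sub_one]
    set R := rot (err X Z Xh t)
    set V := tra (err X Z Xh t)
    obtain ⟨h3, h4, -⟩ := norm_fromBlocks_le (R - 1) V
    set e := ‖(fromBlocks (R - 1) V 0 0 : Mat5)‖
    have h3' : ‖1 - Rᵀ‖ ≤ e := by
      rwa [← transpose_one, ← transpose_sub, Matrix.frobenius_norm_transpose, norm_sub_rev]
    have hZZ := mul_transpose_of_mem_SO3 hZ1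
    have d1 : rot (X t) - rot (Xh t) =
        rot (Z t) * ((1 - Rᵀ) * ((rot (Z t))ᵀ * rot (X t))) := by
      rw [Matrix.sub_mul, ← h2, Matrix.one_mul, ← Matrix.mul_sub, ← Matrix.mul_assoc, hZZ,
        Matrix.one_mul]
    have d2 : tra (X t) - tra (Xh t) = rot (Z t) *
        ((1 - Rᵀ) * relTra (X t) (Z t) + Rᵀ * (V * (scl (Z t))⁻¹)) := by
      have : (1 - Rᵀ) * relTra (X t) (Z t) + Rᵀ * (V * (scl (Z t))⁻¹) =
          relTra (X t) (Z t) - relTra (Xh t) (Z t) := by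
        rw [h1, Matrix.mul_sub, Matrix.sub_mul, Matrix.one_mul]; abel
      rw [this, relTra, relTra, ← Matrix.mul_sub, ← Matrix.mul_assoc, hZZ, Matrix.one_mul,
        sub_sub_sub_cancel_right]
    have n1 := norm_le_of_mem_SO3 hZ1
    have n2 := norm_le_of_mem_SO3 hX1
    have n3 := norm_le_of_mem_SO3 (transpose_mem_SO3 hZ1)
    have n4 := norm_le_of_mem_SO3 (transpose_mem_SO3 hR)
    have n5 := hbP t ht'
    have n6 := hbA t ht'
    have he0 : 0 ≤ e := norm_nonneg _
    have hmul : ∀ {j k l : ℕ} {A : Matrix (Fin j) (Fin k) ℝ} {B : Matrix (Fin k) (Fin l) ℝ}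
        {u v : ℝ}, ‖A‖ ≤ u → ‖B‖ ≤ v → ‖A * B‖ ≤ u * v := fun hA hB =>
      (Matrix.frobenius_norm_mul _ _).trans
        (mul_le_mul hA hB (norm_nonneg _) ((norm_nonneg _).trans hA))
    have m1 : ‖rot (X t) - rot (Xh t)‖ ≤ 9 * (e * (9 * 9)) := by
      rw [d1]; exact hmul n1 (hmul h3' (hmul n3 n2))
    have m2 : ‖tra (X t) - tra (Xh t)‖ ≤ 9 * (e * bP + 9 * (e * bA)) := by
      rw [d2]
      exact hmul n1 (norm_add_le_of_le (hmul h3' n5) (hmul n4 (hmul h4 n6)))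
    have hXX : X t - Xh t = fromBlocks (rot (X t) - rot (Xh t)) (tra (X t) - tra (Xh t)) 0 0 := by
      conv_lhs => rw [hX2, hY2, fromBlocks_sub_fromBlocks, sub_self, sub_self]
    rw [hXX]
    refine (norm_fromBlocks_le _ _).2.2.trans ?_
    linarith
  have h2 := h.const_mul (9 * (9 * 9) + 9 * (bP + 9 * bA))
  rw [mul_zero] at h2
  refine squeeze_zero' (Eventually.of_forall fun t => norm_nonneg _) ?_ h2
  filter_upwards [eventually_ge_atTop t₀] with t ht using hle t ht

/-! ### Stability and equilibria -/

theorem corr_posSemidef (K : Gains) : K.corr.PosSemidef ∧ K.prop.PosSemidef := by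
  have h1 : K.corr = diagonal ![K.kd, K.kc] := by
    ext i j; fin_cases i <;> fin_cases j <;> simp [Gains.corr]
  have h2 : K.prop = diagonal ![K.kv, K.kp] := by
    ext i j; fin_cases i <;> fin_cases j <;> simp [Gains.prop]
  rw [h1, h2, posSemidef_diagonal_iff, posSemidef_diagonal_iff]
  constructor
  · intro i; fin_cases i
    exacts [K.kd_nonneg, K.kc_pos.le]
  · intro i; fin_cases i
    exacts [K.kv_nonneg, K.kp_pos.le]

theorem trace_mul_mul_transpose_nonneg {k n : Type*} [Fintype k] [Fintype n] {N : Matrix n n ℝ}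
    (hN : N.PosSemidef) (Y : Matrix k n ℝ) : 0 ≤ (Y * N * Yᵀ).trace := by
  have := (hN.mul_mul_conjTranspose_same Y).trace_nonneg
  rwa [conjTranspose_eq_transpose_of_trivial] at this

theorem eq_zero_of_trace_mul_mul_transpose {k n : Type*} [Fintype k] [Fintype n]
    {N : Matrix n n ℝ} (hN : N.PosDef) {Y : Matrix k n ℝ} (h : (Y * N * Yᵀ).trace = 0) : Y = 0 := by
  have h1 := hN.posSemidef.mul_mul_conjTranspose_same Y
  rw [conjTranspose_eq_transpose_of_trivial] at h1
  have h2 := h1.trace_eq_zero_iff.1 h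
  by_contra hY
  obtain ⟨i, hi⟩ := Function.ne_iff.1 hY
  have h3 := hN.dotProduct_mulVec_pos hi
  have h4 : star (Y i) ⬝ᵥ N *ᵥ Y i = (Y * N * Yᵀ) i i := by
    rw [star_trivial, dotProduct_mulVec]; rfl
  rw [h4, h2] at h3
  exact lt_irrefl _ h3

/-- A stationary cost forces the translation error to vanish. -/
theorem eq_zero_of_cost_deriv_eq_zero (hD : Represents D K m X Z) (hZ : IsAuxiliary K g X Z)
    {t : ℝ} (ht : 0 ≤ t) {R : Matrix (Fin 3) (Fin 3) ℝ}
    (hR : R ∈ specialOrthogonalGroup (Fin 3) ℝ) {V : Matrix (Fin 3) (Fin 2) ℝ}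
    (h : -(4 * ((1 - R * R) * D.G t V).trace) - 2 * (V * D.M t * Vᵀ).trace = 0) : V = 0 := by
  obtain ⟨hc, hp⟩ := corr_posSemidef K
  set A := scl (Z t) with hA
  set W := V * A⁻¹ with hW
  set C := K.km • vecMulVec (relDir m (Z t)) (relDir m (Z t)) with hC
  have hCt : Cᵀ = C := by rw [hC, transpose_smul, transpose_vecMulVec]
  have hCp : C.PosSemidef := by
    have h1 := posSemidef_vecMulVec_self_star (relDir m (Z t))
    rw [star_trivial] at h1
    exact h1.smul K.km_nonneg
  have hG : D.G t V = relTra (X t) (Z t) * K.corr * (relTra (X t) (Z t))ᵀ + C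
      - relTra (X t) (Z t) * K.corr * Wᵀ := by
    rw [hD.G_eq ht, coefG, coefS, coefB, hW, transpose_mul, Matrix.mul_assoc _ _ Vᵀ]
  have hM : V * D.M t * Vᵀ = (1 / 2 : ℝ) • ((V * Aᵀ) * K.Kq * (V * Aᵀ)ᵀ)
      + (1 / 2 : ℝ) • (W * K.prop * Wᵀ) + W * K.corr * Wᵀ := by
    rw [(hD t ht).2.2, coefM, hW]
    simp only [transpose_mul, transpose_transpose, Matrix.mul_add, Matrix.add_mul, Matrix.mul_smul,
      Matrix.smul_mul, Matrix.mul_assoc]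
    abel
  have key := cost_deriv_eq hR (relTra (X t) (Z t)) W (corr_transpose K) C hCt
  rw [hG, hM, trace_add, trace_add, trace_smul, trace_smul, smul_eq_mul, smul_eq_mul] at h
  have p1 := trace_mul_mul_transpose_nonneg hc
    ((R - Rᵀ) * relTra (X t) (Z t) + Rᵀ * W)
  have p2 := trace_mul_mul_transpose_nonneg hCp (R - Rᵀ)
  have p3 := trace_mul_mul_transpose_nonneg hp W
  have p4 := trace_mul_mul_transpose_nonneg K.Kq_posDef.posSemidef (V * Aᵀ)
  have h0 := eq_zero_of_trace_mul_mul_transpose K.Kq_posDef (Y := V * Aᵀ) (by linarith)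
  have hu := (Matrix.isUnit_iff_isUnit_det _).1 (fromBlocks_of_mem_SIM23 (hZ t ht).1).2.1
  have : V * Aᵀ * (A⁻¹)ᵀ = V := by
    rw [Matrix.mul_assoc, ← transpose_mul, hA, Matrix.nonsing_inv_mul _ hu, transpose_one,
      Matrix.mul_one]
  rw [← this, h0, Matrix.zero_mul]

/-- Half turns are unstable: adding a small real part to the quaternion of a half turn lowers the
cost, and without translation error a nonzero real part leads to convergence. -/
theorem exists_tendsto_one_near (hD : Represents D K m X Z) (hX : IsSystem g Ω a X)
    (hZ : IsAuxiliary K g X Z) (ht₀ : 0 ≤ t₀) {E₀ : Mat5} (hE₀ : E₀ ∈ unstableSet) {ε : ℝ}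
    (hε : 0 < ε) : ∃ Xh, IsEstimate K g m Ω a X Z t₀ Xh ∧ ‖err X Z Xh t₀ - E₀‖ < ε ∧
      cost (err X Z Xh t₀) < cost E₀ ∧ Tendsto (err X Z Xh) atTop (𝓝 1) := by
  obtain ⟨hE, htr, hV⟩ := hE₀
  obtain ⟨hR, hEeq⟩ := fromBlocks_of_mem_SE23 hE
  rw [hV] at hEeq
  obtain ⟨x₀, hx₀, hq⟩ := exists_quatRot_eq hR
  have e0 := (trace_one_sub_of_quat hx₀ hq).1
  have hn := normSq_pos hx₀
  have hz := apply_zero_of_trace_eq hx₀ hq htr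
  -- a small rotation about the axis of the half turn makes the real part nonzero
  let y : ℝ → Fin 4 → ℝ := fun s => x₀ + s • Pi.single 0 1
  have hy0 : ∀ s, y s 0 = s := fun s => by simp [y, hz]
  have hyc : Continuous y := by fun_prop
  have hcn : Continuous fun s => normSq (y s) := by unfold normSq; fun_prop
  have hcm : Continuous fun s => quatMat (y s) := by
    refine continuous_matrix fun i j => ?_
    fin_cases i <;> fin_cases j <;> simp only [quatMat] <;> simp <;> fun_prop
  have hyz : y 0 = x₀ := by simp [y]
  have hc : Tendsto (fun s => quatRot (y s)) (𝓝 0) (𝓝 (rot E₀)) := by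
    have h1 := (hcn.tendsto 0).inv₀ (by rw [hyz]; exact hn.ne')
    have h2 := h1.smul (hcm.tendsto 0)
    rw [hyz] at h2
    rw [← hq]
    exact h2
  have hev : ∀ᶠ s in 𝓝 (0 : ℝ), ‖quatRot (y s) - rot E₀‖ < ε := by
    have := (hc.sub_const (rot E₀)).norm
    rw [sub_self, norm_zero] at this
    exact this.eventually (gt_mem_nhds hε)
  obtain ⟨s, hs, hs0⟩ := ((hev.filter_mono nhdsWithin_le_nhds).and
    (self_mem_nhdsWithin (a := (0 : ℝ)) (s := {0}ᶜ))).exists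
  have hs0 : s ≠ 0 := hs0
  have hys : y s ≠ 0 := fun h => hs0 (by rw [← hy0 s, h]; rfl)
  obtain ⟨R, V, h, hR0, hV0⟩ := D.exists_isErr t₀ (quatRot_mem hys) 0
  obtain ⟨Xh, h1, h2⟩ := exists_estimate_of_isErr hD hX hZ ht₀ h
  obtain ⟨L, hL, -, -, hL0⟩ := D.exists_limit_functional ht₀
  refine ⟨Xh, h1, ?_, ?_, ?_⟩
  · rw [h2 t₀ le_rfl, hR0, hV0, hEeq, fromBlocks_sub_fromBlocks, sub_self, sub_self, sub_self]
    have := (norm_fromBlocks_le (quatRot (y s) - rot E₀) 0).2.2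
    rw [norm_zero, add_zero] at this
    refine this.trans_lt ?_
    simpa [rot] using hs
  · rw [h2 t₀ le_rfl, hR0, hV0, hEeq, cost_fromBlocks, cost_fromBlocks, e0,
      (trace_one_sub_of_quat hys rfl).1, hz, hy0]
    have := normSq_pos hys
    have : 0 < s ^ 2 / normSq (y s) := by positivity
    simp
    linarith
  · refine (tendsto_fromBlocks_one (h.tendsto_one ht₀ hys hR0.symm hL ?_)
      h.tra.tendsto_zero).congr' ?_
    · rwa [hV0, hL0, hy0]
    · filter_upwards [eventually_ge_atTop t₀] with t ht using (h2 t ht).symm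

/-- Nonconvergent errors have a quaternion in the kernel of the limit functional. -/
theorem nullInSE23_not_tendsto (hD : Represents D K m X Z) (hX : IsSystem g Ω a X)
    (hZ : IsAuxiliary K g X Z) (ht₀ : 0 ≤ t₀) : NullInSE23
      {E₀ | ∃ Xh, IsEstimate K g m Ω a X Z t₀ Xh ∧ err X Z Xh t₀ = E₀ ∧
        ¬ Tendsto (err X Z Xh) atTop (𝓝 1)} := by
  obtain ⟨L, hL, hLc, hL1, -⟩ := D.exists_limit_functional ht₀
  refine measure_mono_null (image_mono ?_) (nullInSE23_of_linear_forms hLc hL1)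
  rintro _ ⟨Xh, hXh, rfl, hnot⟩
  obtain ⟨hR, he⟩ := err_eq hX hZ ht₀ hXh le_rfl
  obtain ⟨x₀, hx₀, hq⟩ := exists_quatRot_eq hR
  refine ⟨x₀, hx₀, tra (err X Z Xh t₀), ?_, by rw [hq, ← he]⟩
  by_contra hne
  have h := isErr_of_isEstimate hD hX hZ ht₀ hXh
  exact hnot (tendsto_err_one hX hZ ht₀ hXh (h.tendsto_one ht₀ hx₀ hq hL hne) h.tra.tendsto_zero)

/-- A cost with zero derivative forces `V = 0`, by completion of squares, and then an attitude that
is the identity or a half turn; conversely the cost is constant along these. -/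
theorem equilibria (hD : Represents D K m X Z) (hX : IsSystem g Ω a X)
    (hZ : IsAuxiliary K g X Z) (ht₀ : 0 ≤ t₀) (hXh : IsEstimate K g m Ω a X Z t₀ Xh) :
    (∀ t, t₀ ≤ t → HasDerivWithinAt (fun s => cost (err X Z Xh s)) 0 (Ici t₀) t) ↔
      err X Z Xh t₀ ∈ ({1} : Set Mat5) ∪ unstableSet := by
  have h := isErr_of_isEstimate hD hX hZ ht₀ hXh
  have he := fun t ht => (err_eq hX hZ ht₀ hXh (t := t) ht).2
  have hmem := inv_mul_mul_inv_mul_mem_SE23 (hX t₀ ht₀).1 (hXh t₀ le_rfl).1 (hZ t₀ ht₀).1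
  constructor
  · intro hd
    have hc : ∀ t, t₀ ≤ t → cost (err X Z Xh t) = cost (err X Z Xh t₀) := fun t ht => by
      have := (convex_Ici t₀).norm_image_sub_le_of_norm_hasDerivWithin_le (C := 0) hd (by simp)
        (mem_Ici.2 le_rfl) (mem_Ici.2 ht)
      rw [zero_mul] at this
      exact sub_eq_zero.1 (norm_le_zero_iff.1 this)
    have hd0 := (ErrorData.hasDerivWithinAt_cost h le_rfl).congr (f₁ := fun s => cost (err X Z Xh s))
      (fun t ht => congrArg cost (he t ht)) (congrArg cost (he t₀ le_rfl))
    have hV := eq_zero_of_cost_deriv_eq_zero hD hZ ht₀ (h.mem t₀ le_rfl)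
      ((uniqueDiffWithinAt_Ici t₀).eq_deriv _ hd0 (hd t₀ le_rfl))
    have hor := h.eq_one_or_trace ht₀ hV fun t ht => by
      rw [← he t ht, ← he t₀ le_rfl]; exact hc t ht
    rcases hor with hR | hR
    · left
      rw [mem_singleton_iff, he t₀ le_rfl, hR, hV, fromBlocks_one]
    · exact Or.inr ⟨hmem, hR, hV⟩
  · intro hE
    have hRV : tra (err X Z Xh t₀) = 0 ∧ (rot (err X Z Xh t₀) = 1 ∨
        (rot (err X Z Xh t₀)).trace = -1) := by
      rcases hE with hE | ⟨-, hR, hV⟩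
      · rw [mem_singleton_iff.1 hE, ← fromBlocks_one, tra, rot, toBlocks_fromBlocks₁₁,
          toBlocks_fromBlocks₁₂]
        exact ⟨rfl, Or.inl rfl⟩
      · exact ⟨hV, Or.inr hR⟩
    have hc : ∀ t, t₀ ≤ t → cost (err X Z Xh t) = cost (err X Z Xh t₀) := fun t ht => by
      rw [he t ht, he t₀ le_rfl]
      exact h.cost_eq hRV.1 hRV.2 ht
    exact fun t ht => (hasDerivWithinAt_const t _ (cost (err X Z Xh t₀))).congr
      (fun s hs => hc s hs) (hc t ht)

/-- Local exponential stability of the identity. -/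
theorem exists_err_decay (hD : Represents D K m X Z) (hX : IsSystem g Ω a X)
    (hZ : IsAuxiliary K g X Z) : ∃ r > (0 : ℝ), ∃ C > (0 : ℝ), ∃ κ > (0 : ℝ), ∀ t₀, 0 ≤ t₀ → ∀ Xh,
      IsEstimate K g m Ω a X Z t₀ Xh → ‖err X Z Xh t₀ - 1‖ < r → ∀ t, t₀ ≤ t →
        ‖err X Z Xh t - 1‖ ≤ C * Real.exp (-κ * (t - t₀)) * ‖err X Z Xh t₀ - 1‖ := by
  obtain ⟨r, hr, C, hC, κ, hκ, hκM, hdec⟩ := D.exists_local_decay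
  refine ⟨r / 2, by positivity, 2 * C + 1, by positivity, κ, hκ, fun t₀ ht₀ Xh hXh hlt t ht => ?_⟩
  have h := isErr_of_isEstimate hD hX hZ ht₀ hXh
  have he := (err_eq hX hZ ht₀ hXh ht).2
  have he0 := (err_eq hX hZ ht₀ hXh le_rfl).2
  rw [he0, fromBlocks_sub_one] at hlt ⊢
  rw [he, fromBlocks_sub_one]
  obtain ⟨a1, a2, -⟩ := norm_fromBlocks_le (rot (err X Z Xh t₀) - 1) (tra (err X Z Xh t₀))
  refine (norm_fromBlocks_le _ _).2.2.trans ?_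
  have b1 := hdec t₀ ht₀ _ _ h (by linarith) t ht
  have b2 := h.tra.norm_le ht
  set e := ‖(fromBlocks (rot (err X Z Xh t₀) - 1) (tra (err X Z Xh t₀)) 0 0 : Mat5)‖
  have hexp : Real.exp (-D.κM * (t - t₀)) ≤ Real.exp (-κ * (t - t₀)) :=
    Real.exp_le_exp.2 (by nlinarith)
  have he' := (Real.exp_pos (-κ * (t - t₀))).le
  have c1 : C * Real.exp (-κ * (t - t₀)) * (‖rot (err X Z Xh t₀) - 1‖ + ‖tra (err X Z Xh t₀)‖) ≤
      C * Real.exp (-κ * (t - t₀)) * (2 * e) :=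
    mul_le_mul_of_nonneg_left (by linarith) (by positivity)
  have c2 : Real.exp (-D.κM * (t - t₀)) * ‖tra (err X Z Xh t₀)‖ ≤ Real.exp (-κ * (t - t₀)) * e :=
    mul_le_mul hexp a2 (norm_nonneg _) he'
  linarith

end

end INS

end

theorem mainTheorem1 (K : INS.Gains) (g m : INS.Vec3) (hm : m ⬝ᵥ m = 1)
    (Ω a : ℝ → INS.Vec3) (X Z : ℝ → INS.Mat5)
    (hX : INS.IsSystem g Ω a X) (hZ : INS.IsAuxiliary K g X Z)
    (hU : INS.BoundedFrom 0 fun t => INS.inputU (Ω t) (a t))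
    (hXb : INS.BddUnifCont 0 X)
    (hPE : INS.PersistentlyExciting ![INS.muP K X Z, INS.muV K X Z, INS.muM K m Z]) :
    -- well-posedness: every initial error is the initial error of an estimate trajectory
    (∀ t₀, 0 ≤ t₀ → ∀ E₀ ∈ INS.SE23, ∃ Xh,
      INS.IsEstimate K g m Ω a X Z t₀ Xh ∧ INS.err X Z Xh t₀ = E₀) ∧
    -- (1) the innovation terms are bounded and uniformly continuous
    (∀ t₀, 0 ≤ t₀ → ∀ Xh, INS.IsEstimate K g m Ω a X Z t₀ Xh →
      INS.BddUnifCont t₀ (fun t => INS.OmegaDelta K m (X t) (Xh t) (Z t)) ∧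
      INS.BddUnifCont t₀ (fun t => INS.WDelta K (X t) (Xh t) (Z t)) ∧
      INS.BddUnifCont t₀ (fun _ => INS.OmegaGamma) ∧
      INS.BddUnifCont t₀ (fun t => INS.WGamma K (X t) (Z t)) ∧
      INS.BddUnifCont t₀ (fun t => INS.SGamma K (Z t))) ∧
    -- (2) global exponential stability of the velocity and position error
    (∃ C > (0 : ℝ), ∃ κ > (0 : ℝ), ∀ t₀, 0 ≤ t₀ → ∀ Xh,
      INS.IsEstimate K g m Ω a X Z t₀ Xh → ∀ t, t₀ ≤ t →
        ‖INS.tra (INS.err X Z Xh t)‖ ≤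
          C * Real.exp (-κ * (t - t₀)) * ‖INS.tra (INS.err X Z Xh t₀)‖) ∧
    -- (3a) local exponential stability of the identity
    (∃ r > (0 : ℝ), ∃ C > (0 : ℝ), ∃ κ > (0 : ℝ), ∀ t₀, 0 ≤ t₀ → ∀ Xh,
      INS.IsEstimate K g m Ω a X Z t₀ Xh → ‖INS.err X Z Xh t₀ - 1‖ < r → ∀ t, t₀ ≤ t →
        ‖INS.err X Z Xh t - 1‖ ≤
          C * Real.exp (-κ * (t - t₀)) * ‖INS.err X Z Xh t₀ - 1‖) ∧
    -- (3b) convergence from almost every initial error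
    (∀ t₀, 0 ≤ t₀ → INS.NullInSE23
      {E₀ | ∃ Xh, INS.IsEstimate K g m Ω a X Z t₀ Xh ∧ INS.err X Z Xh t₀ = E₀ ∧
        ¬ Tendsto (INS.err X Z Xh) atTop (𝓝 1)}) ∧
    -- (3c) the equilibria, i.e. the errors from which the cost has identically zero derivative
    (∀ t₀, 0 ≤ t₀ → ∀ Xh, INS.IsEstimate K g m Ω a X Z t₀ Xh →
      ((∀ t, t₀ ≤ t →
          HasDerivWithinAt (fun s => INS.cost (INS.err X Z Xh s)) 0 (Ici t₀) t) ↔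
        INS.err X Z Xh t₀ ∈ ({1} : Set INS.Mat5) ∪ INS.unstableSet)) ∧
    -- (3d) instability of every point of the unstable set
    (∀ t₀, 0 ≤ t₀ → ∀ E₀ ∈ INS.unstableSet, ∀ ε > (0 : ℝ), ∃ Xh,
      INS.IsEstimate K g m Ω a X Z t₀ Xh ∧ ‖INS.err X Z Xh t₀ - E₀‖ < ε ∧
      INS.cost (INS.err X Z Xh t₀) < INS.cost E₀ ∧
      Tendsto (INS.err X Z Xh) atTop (𝓝 1)) ∧
    -- (4) convergence of the error implies convergence of the estimate
    (∀ t₀, 0 ≤ t₀ → ∀ Xh, INS.IsEstimate K g m Ω a X Z t₀ Xh →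
      Tendsto (fun t => ‖INS.err X Z Xh t - 1‖) atTop (𝓝 0) →
      Tendsto (fun t => ‖X t - Xh t‖) atTop (𝓝 0)) := by
  obtain ⟨D, hD⟩ := INS.exists_errorData hX hZ hU hPE
  have hD : INS.Represents D K m X Z := hD
  refine ⟨fun t₀ ht₀ E₀ hE₀ => ?_,
    fun t₀ ht₀ Xh hXh => INS.innovations_bddUnifCont hD hX hZ hU ht₀ hXh,
    ⟨1, one_pos, D.κM, D.κM_pos, fun t₀ ht₀ Xh hXh t ht => ?_⟩,
    INS.exists_err_decay hD hX hZ,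
    fun t₀ ht₀ => INS.nullInSE23_not_tendsto hD hX hZ ht₀,
    fun t₀ ht₀ Xh hXh => INS.equilibria hD hX hZ ht₀ hXh,
    fun t₀ ht₀ E₀ hE₀ ε hε => INS.exists_tendsto_one_near hD hX hZ ht₀ hE₀ hε,
    fun t₀ ht₀ Xh hXh h => INS.tendsto_sub_of_tendsto_err hX hZ hU ht₀ hXh h⟩
  · obtain ⟨R, hR, V, rfl⟩ := hE₀
    exact INS.exists_estimate_of_err_eq hD hX hZ ht₀ hR V
  · rw [one_mul]
    exact (INS.isErr_of_isEstimate hD hX hZ ht₀ hXh).tra.norm_le ht
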